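/- **Transboundary modulus.** Let $G\subset\hat{\mathbb C}$ be a domain, $\mathcal C(G)$ the set of components of $\hat{\mathbb C}\setminus G$, $\hat G=G\cup\mathcal C(G)$ the quotient of $\hat{\mathbb C}$ in which each element of $\mathcal C(G)$ is collapsed to a point, and $\pi_G:\hat{\mathbb C}\to\hat G$ the quotient map. For a family $\Gamma$ of paths in $\hat G$, $$\operatorname{mod}(\Gamma)=\inf_\rho\Big(\int_{G}\rho^2\,dA+\sum_{p\in\mathcal C(G)}\rho(p)^2\Big),$$ the infimum being over the Borel functions $\rho:\hat G\to[0,\infty]$ such that $\int_\gamma\rho\,ds+\sum_{p\in\mathcal C(G)\cap|\gamma|}\rho(p)\ge 1$ for every $\gamma\in\Gamma$ whose restriction to $G$ is locally rectifiable; here $\int_\gamma\rho\,ds$ is the path integral (Euclidean arc length) over the restriction of $\gamma$ to $G$, and $dA$ is Lebesgue measure on $G\cap\mathbb C$. For $A,B\subset\hat{\mathbb C}$, $\operatorname{mod}(A,B;G)$ is the modulus of the family of all paths in $\hat G$ joining $\pi_G(A)$ and $\pi_G(B)$. **The domain.** For $k\ge0$ let $\mathcal W_k=\{0,1\}^k$,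 $\mathcal Y_k=\{0,1\}^k\times\{0,1,2,3\}^k$, and let $e$ be the empty word. Let $R_k>0$ with $R_{k+1}<R_k/2$, and let $Q_w=[x_w-R_k,x_w+R_k]\times[-R_k,R_k]$ ($w\in\mathcal W_k$, $k\ge 0$) be squares, disjoint for different $w$ of the same length, with $Q_{wa}\subset\operatorname{int}Q_w$ for $a\in\{0,1\}$. Let $K=\bigcap_k\bigcup_{w\in\mathcal W_k}Q_w$, and write $E_w=\operatorname{int}(Q_w)\setminus(Q_{w0}\cup Q_{w1})$. For $\bar w\in\{0,1\}^{\mathbb N}$ let $\bar w(k)$ be the word of its first $k$ letters, and $p_{\bar w}\in K$ the point with $\{p_{\bar w}\}=\bigcap_kQ_{\bar w(k)}$. Let $\epsilon_k>0$ $(k\ge0)$ satisfy $\epsilon_{k+1}\le\exp(-1)\,\epsilon_k$ and $10\,\epsilon_k<\operatorname{dist}(Q_{wa},\mathbb C\setminus Q_w)$ for all $w\in\mathcal W_{k+1}$, $a\in\{0,1\}$. For $(w,v)\in\mathcal Y_k$ and $m=1,2,3$ let $I_m(w,v)=[a_m(w,v),b_m(w,v)]\subset E_w$ be segments, pairwise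 disjoint for each $k$, those with $k=0$ of length larger than $\epsilon_1$, such that, writing $a_m,b_m$ for $a_m(w,v),b_m(w,v)$ and $\pi_1$ for the real part, $$\pi_1(a_1)<\pi_1(b_1)<x_{w0}-R_{k+1}<\pi_1(b_1)+\tfrac{\epsilon_{k+1}}{10},\qquad \pi_1(a_2)-\tfrac{\epsilon_{k+1}}{10}<x_{w0}+R_{k+1}<\pi_1(a_2),$$ $$\pi_1(a_2)<\pi_1(b_2)<x_{w1}-R_{k+1}<\pi_1(b_2)+\tfrac{\epsilon_{k+1}}{10},\qquad \pi_1(a_3)-\tfrac{\epsilon_{k+1}}{10}<x_{w1}+R_{k+1}<\pi_1(a_3)<\pi_1(b_3).$$ Let $\mathcal B_k$ be the family of the balls $B(z,\epsilon_k)$ with $z$ an endpoint of some $I_m(w,v)$, $(w,v)\in\mathcal Y_k$; for each $k$, different balls of $\mathcal B_k$ have disjoint closures. Finally, for $k\ge1$ and $(w,v)=(w'\alpha,v'\beta)\in\mathcal Y_k$ put $r_v=\epsilon_k$, $R_v=(\epsilon_{k-1}\epsilon_k)^{1/2}$ if $\beta\in\{0,1\}$, and $r_v=(\epsilon_{k-1}\epsilon_k)^{1/2}$,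 $R_v=\epsilon_{k-1}$ if $\beta\in\{2,3\}$. For every $r$ there are arcs, one pair for each $(w,v)$ with $r_v<r<R_v$, $$J_1(r,w,v)\subset S(b_{\alpha+1}(w',v'),r),\qquad J_3(r,w,v)\subset S(a_{\alpha+2}(w',v'),r),$$ whose relative interiors are pairwise disjoint and do not meet any segment $I_m(\tilde w,\tilde v)$ with $(\tilde w,\tilde v)\in\mathcal Y_\ell$, $\ell\le k$, such that $J_1(r,w,v)$ has one endpoint in $I_{\alpha+1}(w',v')$ and the other in $I_1(w,v)$, and $J_3(r,w,v)$ has one endpoint in $I_{\alpha+2}(w',v')$ and the other in $I_3(w,v)$. The domain $D$ is the complement in $\hat{\mathbb C}$ of $K$ and of all the segments $I_m(w,v)$. **The exhaustion.** Put $I(w,v)=I_1(w,v)\cup I_2(w,v)\cup I_3(w,v)$, and let $N_j(E)$ be the set of $x\in\mathbb C$ with $\operatorname{dist}(x,E)<\frac1{100}\min\{\epsilon_{j+1},\operatorname{dist}(E,\mathbb C\setminus(D\cup E))\}$. For $(w,v)\in\mathcal Y_k$ let $U(w,v)$ be a Jordan domain with $I(w,v)\subset U(w,v)\subset\overline U(w,v)\subset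 E_w$, where for each $k$ the closures $\overline U(w,v)$, $(w,v)\in\mathcal Y_k$, are pairwise disjoint, and such that for every $B\in\bigcup_{\ell<k}\mathcal B_\ell$ either $U(w,v)\cap B=\emptyset$, or $I(w,v)\cap B\ne\emptyset$ and $U(w,v)\cap B\subset N_k(I(w,v))$. Let $U_m(k+1,w,v)=U(w,v)$ for $m=1,2,3$, and for $j\ge k+2$ let $U_m(j,w,v)$ be Jordan domains with $$I_m(w,v)\subset U_m(j,w,v)\subset\overline U_m(j,w,v)\subset U_m(j-1,w,v)\cap N_j(I_m(w,v)),$$ where $\overline U_m(k+2,w,v)$, $m=1,2,3$, are pairwise disjoint. Let $D_j$ be the domain with $$\mathcal C(D_j)=\{Q_w:w\in\mathcal W_j\}\cup\{\overline U_m(j,w,v):m=1,2,3,\ (w,v)\in\mathcal Y_k,\ 0\le k\le j-1\}.$$ **Proposition.** For every domain $D$ and every exhaustion $(D_j)$ constructed in this way, there is $\delta>0$ such that for every $p_{\bar w}\in K$, every $j_0$ and every $j>j_0$, $$\operatorname{mod}(I_1(e,e),Q_{\bar w(j_0)};D_j)\ge\delta.$$ In fact $\delta=4^{-10}$ works for all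 such constructions. -/

import Mathlib

open Set
open scoped ENNReal

noncomputable section

namespace Transboundary

/-! ### Transboundary modulus on the Riemann sphere `OnePoint ℂ` -/

/-- The equivalence relation on the sphere which collapses every connected component of the
complement of `G` to a point. -/
def collapse (G : Set (OnePoint ℂ)) : Setoid (OnePoint ℂ) where
  r x y := x = y ∨
    (x ∈ Gᶜ ∧ y ∈ Gᶜ ∧ connectedComponentIn Gᶜ x = connectedComponentIn Gᶜ y)
  iseqv :=
    { refl := fun _ => Or.inl rfl
      symm := by
        rintro x y (h | ⟨hx, hy, h⟩)
        · exact Or.inl h.symm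
        · exact Or.inr ⟨hy, hx, h.symm⟩
      trans := by
        rintro x y z (h | ⟨hx, hy, h⟩) (h' | ⟨hy', hz, h'⟩)
        · exact Or.inl (h.trans h')
        · subst h; exact Or.inr ⟨hy', hz, h'⟩
        · subst h'; exact Or.inr ⟨hx, hy, h⟩
        · exact Or.inr ⟨hx, hz, h.trans h'⟩ }

/-- The quotient `Ĝ`, with the quotient topology. -/
abbrev Hat (G : Set (OnePoint ℂ)) : Type := Quotient (collapse G)

/-- The quotient map `π_G`. -/
def proj (G : Set (OnePoint ℂ)) (x : OnePoint ℂ) : Hat G := Quotient.mk (collapse G) x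

/-- The set of complementary components of `G`, as points of `Ĝ`. -/
def components (G : Set (OnePoint ℂ)) : Set (Hat G) := proj G '' Gᶜ

open Classical in
/-- The inverse of `π_G` on `π_G (G \ {∞})` (with junk value `0` elsewhere). -/
def coord (G : Set (OnePoint ℂ)) (q : Hat G) : ℂ :=
  if h : ∃ z : ℂ, (z : OnePoint ℂ) ∈ G ∧ proj G (z : OnePoint ℂ) = q then h.choose else 0

/-- The times at which a path in `Ĝ` is in `G \ {∞}`. -/
def freeTimes (G : Set (OnePoint ℂ)) (γ : C(unitInterval, Hat G)) : Set unitInterval :=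
  {t | ∃ z : ℂ, (z : OnePoint ℂ) ∈ G ∧ proj G (z : OnePoint ℂ) = γ t}

/-- The restriction of a path in `Ĝ` to `G \ {∞}`, as a planar path (used on `freeTimes` only). -/
def planar (G : Set (OnePoint ℂ)) (γ : C(unitInterval, Hat G)) (t : unitInterval) : ℂ :=
  coord G (γ t)

/-- The maximal intervals of times which a path in `Ĝ` spends in `G \ {∞}`. -/
def excursions (G : Set (OnePoint ℂ)) (γ : C(unitInterval, Hat G)) : Set (Set unitInterval) :=
  (fun t => connectedComponentIn (freeTimes G γ) t) '' freeTimes G γ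

/-- The restriction of `γ` to `G` is locally rectifiable. -/
def IsLocallyRectifiable (G : Set (OnePoint ℂ)) (γ : C(unitInterval, Hat G)) : Prop :=
  ∀ C ∈ excursions G γ, LocallyBoundedVariationOn (planar G γ) C

/-- `∫ ρ ds` along the planar path `f` restricted to `[a, b]`, through its arc length
parametrization. -/
def arcIntegral (ρ : ℂ → ℝ≥0∞) (f : unitInterval → ℂ) (a b : unitInterval) : ℝ≥0∞ :=
  ∫⁻ s in Icc (0 : ℝ) (eVariationOn f (Icc a b)).toReal,
    ρ (naturalParameterization f (Icc a b) a s)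

/-- `∫_γ ρ ds`: the sum, over the subpaths which form the restriction of `γ` to `G`, of the path
integrals of `ρ`; the path integral over an open subpath is the supremum over its closed
subpaths. -/
def pathIntegral (G : Set (OnePoint ℂ)) (ρ : Hat G → ℝ≥0∞) (γ : C(unitInterval, Hat G)) : ℝ≥0∞ :=
  ∑' C : excursions G γ, ⨆ (a : unitInterval) (b : unitInterval) (_ : a ≤ b)
    (_ : Icc a b ⊆ (C : Set unitInterval)),
      arcIntegral (fun z => ρ (proj G (z : OnePoint ℂ))) (planar G γ) a b

/-- The set `X(Γ)` of admissible functions; paths that are not locally rectifiable in `G` impose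
no condition. -/
def admissible (G : Set (OnePoint ℂ)) (Γ : Set C(unitInterval, Hat G)) : Set (Hat G → ℝ≥0∞) :=
  {ρ | @Measurable (Hat G) ℝ≥0∞ (borel (Hat G)) _ ρ ∧ ∀ γ ∈ Γ, IsLocallyRectifiable G γ →
    1 ≤ pathIntegral G ρ γ + ∑' p : ↥(components G ∩ range γ), ρ p}

/-- The transboundary modulus of a path family in `Ĝ`. -/
def modulus (G : Set (OnePoint ℂ)) (Γ : Set C(unitInterval, Hat G)) : ℝ≥0∞ :=
  ⨅ ρ ∈ admissible G Γ,
    (∫⁻ z in {z : ℂ | (z : OnePoint ℂ) ∈ G}, ρ (proj G (z : OnePoint ℂ)) ^ 2)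
      + ∑' p : components G, ρ p ^ 2

/-- The family `Γ(A, B; G)` of the paths in `Ĝ` joining `π_G(A)` and `π_G(B)`. -/
def joining (A B : Set (OnePoint ℂ)) (G : Set (OnePoint ℂ)) : Set C(unitInterval, Hat G) :=
  {γ | γ 0 ∈ proj G '' A ∧ γ 1 ∈ proj G '' B}

/-- `mod(A, B; G)` for plane sets `A`, `B`. -/
def modBetween (A B : Set ℂ) (G : Set (OnePoint ℂ)) : ℝ≥0∞ :=
  modulus G (joining ((↑) '' A) ((↑) '' B) G)

end Transboundary

namespace CantorExample

/-! ### The Cantor set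

Words over `{0,1}` are lists; `w ++ [a]` is the word `wa`. Everything indexed by a pair `(w, v)`
is only used when the words `w` and `v` have the same length. -/

/-- The closed square with centre `c` on the real axis and side length `2 r`. -/
def square (c r : ℝ) : Set ℂ := {z | |z.re - c| ≤ r ∧ |z.im| ≤ r}

/-- The first `k` letters of an infinite word. -/
def initialWord (wbar : ℕ → Fin 2) (k : ℕ) : List (Fin 2) := (List.range k).map wbar

/-- The nested squares `Q_w` with centres `x_w` and half side lengths `R_k`, `k` the length of
`w`. -/
structure Squares where
  R : ℕ → ℝ
  x : List (Fin 2) → ℝ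
  R_pos : ∀ k, 0 < R k
  R_half : ∀ k, R (k + 1) < R k / 2
  disjoint : ∀ w w' : List (Fin 2), w.length = w'.length → w ≠ w' →
    Disjoint (square (x w) (R w.length)) (square (x w') (R w'.length))
  nested : ∀ (w : List (Fin 2)) (i : Fin 2),
    square (x (w ++ [i])) (R (w.length + 1)) ⊆ interior (square (x w) (R w.length))

/-- The square `Q_w`. -/
def Squares.Q (S : Squares) (w : List (Fin 2)) : Set ℂ := square (S.x w) (S.R w.length)

/-- The Cantor set `K`. -/
def Squares.K (S : Squares) : Set ℂ :=
  ⋂ k : ℕ, ⋃ (w : List (Fin 2)) (_ : w.length = k), S.Q w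

/-- The region `int(Q_w) \ (Q_{w0} ∪ Q_{w1})`. -/
def Squares.collar (S : Squares) (w : List (Fin 2)) : Set ℂ :=
  interior (S.Q w) \ (S.Q (w ++ [0]) ∪ S.Q (w ++ [1]))

/-! ### The segments -/

/-- A family of points of the plane indexed by `m = 1, 2, 3` (written `0, 1, 2`) and `(w, v)`. -/
abbrev PointFamily := Fin 3 → List (Fin 2) → List (Fin 4) → ℂ

/-- The endpoints of the segments of generation `k`. -/
def endpoints (a b : PointFamily) (k : ℕ) : Set ℂ :=
  {z | ∃ m w v, w.length = k ∧ v.length = k ∧ (z = a m w v ∨ z = b m w v)}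

/-- The index of an arc: with `w = w'α`, `v = v'β`, it stands for `J_1(r, w, v)` if `side = 0` and
for `J_3(r, w, v)` if `side = 1`. -/
structure ArcIndex where
  side : Fin 2
  w' : List (Fin 2)
  v' : List (Fin 4)
  α : Fin 2
  β : Fin 4

namespace ArcIndex

variable (i : ArcIndex)

/-- The centre `b_{α+1}(w', v')` of `J_1`, respectively the centre `a_{α+2}(w', v')` of `J_3`. -/
def center (a b : PointFamily) : ℂ :=
  if i.side = 0 then b i.α.castSucc i.w' i.v' else a i.α.succ i.w' i.v'

/-- The segment `I_{α+1}(w', v')`, respectively `I_{α+2}(w', v')`. -/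
def parent (a b : PointFamily) : Set ℂ :=
  if i.side = 0 then segment ℝ (a i.α.castSucc i.w' i.v') (b i.α.castSucc i.w' i.v')
  else segment ℝ (a i.α.succ i.w' i.v') (b i.α.succ i.w' i.v')

/-- The segment `I_1(w'α, v'β)`, respectively `I_3(w'α, v'β)`. -/
def child (a b : PointFamily) : Set ℂ :=
  if i.side = 0 then segment ℝ (a 0 (i.w' ++ [i.α]) (i.v' ++ [i.β])) (b 0 (i.w' ++ [i.α]) (i.v' ++ [i.β]))
  else segment ℝ (a 2 (i.w' ++ [i.α]) (i.v' ++ [i.β])) (b 2 (i.w' ++ [i.α]) (i.v' ++ [i.β]))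

/-- The inner radius `r_v`, `v = v'β`. -/
def rInner (ε : ℕ → ℝ) : ℝ :=
  if i.β.val < 2 then ε (i.v'.length + 1) else Real.sqrt (ε i.v'.length * ε (i.v'.length + 1))

/-- The outer radius `R_v`, `v = v'β`. -/
def rOuter (ε : ℕ → ℝ) : ℝ :=
  if i.β.val < 2 then Real.sqrt (ε i.v'.length * ε (i.v'.length + 1)) else ε i.v'.length

/-- There is an arc of radius `r` with index `i`. -/
def IsActive (ε : ℕ → ℝ) (r : ℝ) : Prop :=
  i.w'.length = i.v'.length ∧ i.rInner ε < r ∧ r < i.rOuter ε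

end ArcIndex

/-- The arc `{c + r e^{iθ} : θ₁ < θ < θ₂}` without its endpoints. -/
def openArc (c : ℂ) (r θ₁ θ₂ : ℝ) : Set ℂ := circleMap c r '' Ioo θ₁ θ₂

/-- For the radius `r` there are arcs as required, one for each index that is active at `r`: their
relative interiors are pairwise disjoint and meet no segment of the same or of an earlier
generation, and each joins its parent segment and its child segment. -/
def HasArcs (ε : ℕ → ℝ) (a b : PointFamily) (r : ℝ) : Prop :=
  ∃ θ₁ θ₂ : ArcIndex → ℝ,
    (∀ i : ArcIndex, i.IsActive ε r →
      θ₁ i < θ₂ i ∧ θ₂ i < θ₁ i + 2 * Real.pi ∧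
      ((circleMap (i.center a b) r (θ₁ i) ∈ i.parent a b ∧
          circleMap (i.center a b) r (θ₂ i) ∈ i.child a b) ∨
        (circleMap (i.center a b) r (θ₁ i) ∈ i.child a b ∧
          circleMap (i.center a b) r (θ₂ i) ∈ i.parent a b)) ∧
      ∀ (m : Fin 3) (w : List (Fin 2)) (v : List (Fin 4)), w.length = v.length →
        w.length ≤ i.w'.length + 1 →
          Disjoint (openArc (i.center a b) r (θ₁ i) (θ₂ i)) (segment ℝ (a m w v) (b m w v))) ∧
    (∀ i i' : ArcIndex, i.IsActive ε r → i'.IsActive ε r → i ≠ i' →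
      Disjoint (openArc (i.center a b) r (θ₁ i) (θ₂ i))
        (openArc (i'.center a b) r (θ₁ i') (θ₂ i')))

/-- The construction of the domain: the squares, the scales `ε_k`, and the segments
`I_m(w, v) = [a_m(w, v), b_m(w, v)]`. -/
structure Segments extends Squares where
  ε : ℕ → ℝ
  ε_pos : ∀ k, 0 < ε k
  /-- the rate at which `ε_k` tends to zero -/
  ε_decay : ∀ k, ε (k + 1) ≤ ε k / Real.exp 1
  /-- `10 ε_k` is less than the distance from `Q_{wi}` to the complement of `Q_w`, for words `w`
  of length `k + 1` -/
  ε_small : ∀ (k : ℕ) (w : List (Fin 2)) (i : Fin 2), w.length = k + 1 →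
    |x (w ++ [i]) - x w| + R (k + 2) + 10 * ε k < R (k + 1)
  a : PointFamily
  b : PointFamily
  segment_subset : ∀ m w v, w.length = v.length →
    segment ℝ (a m w v) (b m w v) ⊆ toSquares.collar w
  segment_disjoint : ∀ m m' w w' v v', w.length = v.length → w'.length = v'.length →
    w.length = w'.length → (m, w, v) ≠ (m', w', v') →
      Disjoint (segment ℝ (a m w v) (b m w v)) (segment ℝ (a m' w' v') (b m' w' v'))
  first_length : ∀ m, ε 1 < dist (a m [] []) (b m [] [])
  position₁ : ∀ w v, w.length = v.length →
    (a 0 w v).re < (b 0 w v).re ∧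
    (b 0 w v).re < x (w ++ [0]) - R (w.length + 1) ∧
    x (w ++ [0]) - R (w.length + 1) < (b 0 w v).re + ε (w.length + 1) / 10
  position₂ : ∀ w v, w.length = v.length →
    (a 1 w v).re - ε (w.length + 1) / 10 < x (w ++ [0]) + R (w.length + 1) ∧
    x (w ++ [0]) + R (w.length + 1) < (a 1 w v).re ∧
    (a 1 w v).re < (b 1 w v).re ∧
    (b 1 w v).re < x (w ++ [1]) - R (w.length + 1) ∧
    x (w ++ [1]) - R (w.length + 1) < (b 1 w v).re + ε (w.length + 1) / 10
  position₃ : ∀ w v, w.length = v.length →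
    (a 2 w v).re - ε (w.length + 1) / 10 < x (w ++ [1]) + R (w.length + 1) ∧
    x (w ++ [1]) + R (w.length + 1) < (a 2 w v).re ∧
    (a 2 w v).re < (b 2 w v).re
  balls_disjoint : ∀ k, ∀ z ∈ endpoints a b k, ∀ z' ∈ endpoints a b k, z ≠ z' →
    Disjoint (Metric.closedBall z (ε k)) (Metric.closedBall z' (ε k))
  arcs : ∀ r : ℝ, HasArcs ε a b r

namespace Segments

variable (S : Segments)

/-- The segment `I_m(w, v)` (with `m = 1, 2, 3` written `0, 1, 2`). -/
def I (m : Fin 3) (w : List (Fin 2)) (v : List (Fin 4)) : Set ℂ := segment ℝ (S.a m w v) (S.b m w v)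

/-- `I(w, v) = I_1(w, v) ∪ I_2(w, v) ∪ I_3(w, v)`. -/
def triple (w : List (Fin 2)) (v : List (Fin 4)) : Set ℂ := ⋃ m : Fin 3, S.I m w v

/-- The domain `D`, the complement of the Cantor set and of all segments. -/
def domain : Set (OnePoint ℂ) :=
  ((↑) '' (S.K ∪ ⋃ (m : Fin 3) (w : List (Fin 2)) (v : List (Fin 4)) (_ : w.length = v.length),
    S.I m w v))ᶜ

/-- `ℂ \ (D ∪ E)`. -/
def rest (E : Set ℂ) : Set ℂ := {z : ℂ | (z : OnePoint ℂ) ∉ S.domain ∧ z ∉ E}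

/-- The neighbourhood `N_j(E)`: the points whose distance to `E` is less than one hundredth of
`min {ε_{j+1}, dist(E, ℂ \ (D ∪ E))}`. -/
def nbhd (j : ℕ) (E : Set ℂ) : Set ℂ :=
  {z | Metric.infDist z E < min (S.ε (j + 1)) (sInf (image2 dist E (S.rest E))) / 100}

end Segments

/-! ### The exhaustion -/

/-- A Jordan domain in the plane: a bounded domain whose boundary is a Jordan curve. -/
def IsJordanDomain (U : Set ℂ) : Prop :=
  IsOpen U ∧ IsConnected U ∧ Bornology.IsBounded U ∧
    ∃ γ : Circle → ℂ, Continuous γ ∧ Function.Injective γ ∧ frontier U = range γ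

/-- The construction of the exhaustion: the Jordan domains `U(w, v)` and `U_m(j, w, v)`. -/
structure Exhaustion extends Segments where
  U : List (Fin 2) → List (Fin 4) → Set ℂ
  U_jordan : ∀ w v, w.length = v.length → IsJordanDomain (U w v)
  triple_subset : ∀ w v, w.length = v.length → toSegments.triple w v ⊆ U w v
  U_subset : ∀ w v, w.length = v.length → closure (U w v) ⊆ toSquares.collar w
  U_disjoint : ∀ w v v', w.length = v.length → w.length = v'.length → v ≠ v' →
    Disjoint (closure (U w v)) (closure (U w v'))
  U_ball : ∀ w v, w.length = v.length → ∀ l < w.length, ∀ z ∈ endpoints a b l,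
    Disjoint (U w v) (Metric.ball z (ε l)) ∨
      ((toSegments.triple w v ∩ Metric.ball z (ε l)).Nonempty ∧
        U w v ∩ Metric.ball z (ε l) ⊆ toSegments.nbhd w.length (toSegments.triple w v))
  /-- `Um m j w v` is `U_m(j, w, v)`, for `j` greater than the length of `w` -/
  Um : Fin 3 → ℕ → List (Fin 2) → List (Fin 4) → Set ℂ
  Um_first : ∀ m w v, w.length = v.length → Um m (w.length + 1) w v = U w v
  Um_jordan : ∀ m w v j, w.length = v.length → w.length + 2 ≤ j → IsJordanDomain (Um m j w v)
  Um_disjoint : ∀ m m' w v, w.length = v.length → m ≠ m' →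
    Disjoint (closure (Um m (w.length + 2) w v)) (closure (Um m' (w.length + 2) w v))
  segment_subset_Um : ∀ m w v j, w.length = v.length → w.length + 2 ≤ j →
    toSegments.I m w v ⊆ Um m j w v
  Um_subset : ∀ m w v j, w.length = v.length → w.length + 1 ≤ j →
    closure (Um m (j + 1) w v) ⊆ Um m j w v ∩ toSegments.nbhd (j + 1) (toSegments.I m w v)

/-- The domain `D_j`: its complementary components are the squares `Q_w` with `w` of length `j`, and
the closures of the `U_m(j, w, v)` with `w` and `v` of the same length less than `j`. -/
def Exhaustion.Dj (E : Exhaustion) (j : ℕ) : Set (OnePoint ℂ) :=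
  ((↑) '' ((⋃ (w : List (Fin 2)) (_ : w.length = j), E.Q w) ∪
    ⋃ (m : Fin 3) (w : List (Fin 2)) (v : List (Fin 4)) (_ : w.length = v.length)
      (_ : w.length < j), closure (E.Um m j w v)))ᶜ

end CantorExample

end

/-! Fix an admissible ρ. It suffices to find one path from I_1(e,e) to a point of Q_{w̄(j₀)} along
which ρ has mass M with M² at most 4^10 times the energy of ρ, since admissibility gives M ≥ 1.

To pass from I_1(w,v) to I_3(w,v), take for α = 0 and then for α = 1 an arc J_1 from I_{α+1}(w,v)
down to I_1(wα,vβ), pass recursively to I_3(wα,vβ), and return along an arc J_3 to I_{α+2}(w,v). The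
recursion stops at generation j-1, where the three segments lie in one complementary component of
D_j. To reach Q_{w̄(j₀)} one descends along the letters of w̄, with a detour through the child 0
whenever the letter is 1. Both letters α may be needed, but β is free. Choosing β by averaging
bounds the mass by `branchSum`, in which each of the 8^n nodes at depth n has weight 4^{-n}. The
squares of the weights add up to 2^{-n} at depth n and to less than 2 in all, so by Cauchy-Schwarz
the mass is controlled by the ℓ² norm of the node masses, uniformly in j (`branchSum_sq_le`,
`Network.exists_pass`, `Network.exists_reach`).

The node masses are square summable: for fixed m different nodes are different components
(`vertex_injective`), and a length-area argument yields for each arc a radius at which the squared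
circle integral is at most 27 times the energy in the ball of radius ε_k about the hub
(`exists_circleLIntegral_sq_le`). For hubs of one kind these balls are disjoint (`disjoint_balls`).

The geometric difficulty is that the arcs avoid segments, whereas the components of D_j are
neighbourhoods of segments. For most radii an arc meets only the components at its two ends
(`arc_avoids_components`). Otherwise a point of the arc would be so close to a point y of another
segment that the direction of y falls within the arc. But the arc at the radius of y with the same
sense of rotation must stop before y, and its end segment would then have to cross the direction of
y or the parent segment (`ArcPair.same_side`). A variant treats the case where y lies on the end of
the other arc of the pair (`ArcPair.not_close_other`). -/

noncomputable section

namespace CantorExample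

/-! ### Circular arcs leaving a ray -/

/-- The open arc of directions of angular length `a` starting at `u`, in the sense of rotation
given by `σ = ± 1`. -/
def arcDir (u : ℂ) (σ a : ℝ) : Set ℂ :=
  (fun s : ℝ => u * Complex.exp ((σ * s : ℝ) * Complex.I)) '' Ioo 0 a

/-- The direction of `x` seen from `c`. -/
def dirFrom (c x : ℂ) : ℂ := (x - c) / (‖x - c‖ : ℝ)

lemma norm_dirFrom {c x : ℂ} (h : x ≠ c) : ‖dirFrom c x‖ = 1 := by
  have : ‖x - c‖ ≠ 0 := norm_ne_zero_iff.2 (sub_ne_zero.2 h)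
  simp only [dirFrom, norm_div, Complex.norm_real, norm_norm]
  exact div_self this

lemma add_norm_mul_dirFrom (c x : ℂ) : c + (‖x - c‖ : ℝ) * dirFrom c x = x := by
  rcases eq_or_ne x c with h | h
  · simp [h]
  · have : ((‖x - c‖ : ℝ) : ℂ) ≠ 0 := by
      exact_mod_cast norm_ne_zero_iff.2 (sub_ne_zero.2 h)
    rw [dirFrom, mul_div_cancel₀ _ this]; ring

lemma dirFrom_add_mul {c d : ℂ} {r : ℝ} (hr : 0 < r) (hd : ‖d‖ = 1) :
    dirFrom c (c + r * d) = d := by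
  have hr' : (r : ℂ) ≠ 0 := by exact_mod_cast hr.ne'
  have h1 : ‖(r : ℂ) * d‖ = r := by rw [norm_mul, hd, mul_one, Complex.norm_real, Real.norm_of_nonneg hr.le]
  rw [dirFrom, add_sub_cancel_left, h1, mul_div_cancel_left₀ _ hr']

lemma norm_add_mul_sub {c d : ℂ} {r : ℝ} (hr : 0 ≤ r) (hd : ‖d‖ = 1) :
    ‖c + r * d - c‖ = r := by
  rw [add_sub_cancel_left, norm_mul, hd, mul_one, Complex.norm_real, Real.norm_of_nonneg hr]

lemma dist_add_mul_dirFrom (c x : ℂ) (r : ℝ) (h : x ≠ c) :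
    dist (c + r * dirFrom c x) x = |r - ‖x - c‖| := by
  have : c + r * dirFrom c x - x = ((r - ‖x - c‖ : ℝ) : ℂ) * dirFrom c x := by
    have h1 := add_norm_mul_dirFrom c x
    push_cast
    linear_combination h1
  rw [dist_eq_norm, this, norm_mul, norm_dirFrom h, mul_one, Complex.norm_real, Real.norm_eq_abs]

lemma continuousOn_dirFrom (c : ℂ) : ContinuousOn (dirFrom c) {c}ᶜ := by
  refine ContinuousOn.div (by fun_prop) (by fun_prop) ?_
  intro x hx
  simpa [sub_eq_zero] using hx

lemma norm_mul_exp {u : ℂ} (hu : ‖u‖ = 1) (s : ℝ) :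
    ‖u * Complex.exp (s * Complex.I)‖ = 1 := by
  rw [norm_mul, hu, Complex.norm_exp_ofReal_mul_I, one_mul]

lemma exp_eq_imp {u : ℂ} (hu : ‖u‖ = 1) {σ s s' : ℝ} (hσ : σ = 1 ∨ σ = -1)
    (h : u * Complex.exp ((σ * s : ℝ) * Complex.I) = u * Complex.exp ((σ * s' : ℝ) * Complex.I)) :
    ∃ n : ℤ, s = s' + n * (2 * Real.pi) := by
  have hu0 : u ≠ 0 := by rintro rfl; simp at hu
  have h2 := mul_left_cancel₀ hu0 h
  obtain ⟨n, hn⟩ := Complex.exp_eq_exp_iff_exists_int.1 h2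
  have h3 : ((σ * s : ℝ) : ℂ) = ((σ * s' + n * (2 * Real.pi) : ℝ) : ℂ) := by
    apply mul_right_cancel₀ Complex.I_ne_zero
    rw [hn]; push_cast; ring
  have h4 : σ * s = σ * s' + n * (2 * Real.pi) := by exact_mod_cast h3
  rcases hσ with rfl | rfl
  · exact ⟨n, by linarith⟩
  · exact ⟨-n, by push_cast; linarith⟩

lemma exists_eq_exp {u d : ℂ} (hu : ‖u‖ = 1) (hd : ‖d‖ = 1) {σ : ℝ} (hσ : σ = 1 ∨ σ = -1) :
    ∃ s ∈ Ico 0 (2 * Real.pi), d = u * Complex.exp ((σ * s : ℝ) * Complex.I) := by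
  have hu0 : u ≠ 0 := by rintro rfl; simp at hu
  have h1 : ‖d / u‖ = 1 := by simp [hu, hd]
  have h2 : d / u = Complex.exp ((Complex.arg (d / u) : ℝ) * Complex.I) := by
    have := Complex.norm_mul_exp_arg_mul_I (d / u)
    rw [h1] at this; simpa using this.symm
  set θ := Complex.arg (d / u)
  refine ⟨toIcoMod Real.two_pi_pos 0 (σ * θ), by simpa using toIcoMod_mem_Ico Real.two_pi_pos 0 (σ * θ), ?_⟩
  rw [← mul_div_cancel₀ d hu0, h2]
  congr 1
  rw [Complex.exp_eq_exp_iff_exists_int]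
  have h3 := toIcoMod_add_toIcoDiv_zsmul Real.two_pi_pos 0 (σ * θ)
  set m := toIcoDiv Real.two_pi_pos 0 (σ * θ)
  set q := toIcoMod Real.two_pi_pos 0 (σ * θ)
  have h4 : q + m * (2 * Real.pi) = σ * θ := by simpa [zsmul_eq_mul] using h3
  rcases hσ with h | h
  · refine ⟨m, ?_⟩
    have : θ = σ * q + m * (2 * Real.pi) := by subst h; linarith
    rw [this]; push_cast; ring
  · refine ⟨-m, ?_⟩
    have : θ = σ * q - m * (2 * Real.pi) := by subst h; linarith
    rw [this]; push_cast; ring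

/-- A connected set of directions which meets an arc and its complement contains one of the two
endpoints of the arc. -/
lemma arc_trap {u : ℂ} (hu : ‖u‖ = 1) {σ a : ℝ} (hσ : σ = 1 ∨ σ = -1) (ha0 : 0 < a)
    (ha : a < 2 * Real.pi) {A : Set ℂ} (hA : IsPreconnected A) (hA1 : ∀ d ∈ A, ‖d‖ = 1)
    {d e : ℂ} (hd : d ∈ A) (hdJ : d ∈ arcDir u σ a) (he : e ∈ A) (heJ : e ∉ arcDir u σ a) :
    u ∈ A ∨ u * Complex.exp ((σ * a : ℝ) * Complex.I) ∈ A := by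
  set g : ℝ → ℂ := fun s => u * Complex.exp ((σ * s : ℝ) * Complex.I) with hg
  have hgc : Continuous g := by fun_prop
  have hper : g (2 * Real.pi) = g 0 := by
    simp only [hg]
    congr 1
    rcases hσ with rfl | rfl
    · simp
    · simp [Complex.exp_neg]
  have hg0 : g 0 = u := by simp [hg]
  have hcl : ∀ p q : ℝ, IsClosed (g '' Icc p q) := fun p q =>
    (isCompact_Icc.image hgc).isClosed
  -- The closed arc and the closed complementary arc cover the circle and share only the two ends,
  -- so a connected set meeting both contains an end.
  have hcov : A ⊆ g '' Icc 0 a ∪ g '' Icc a (2 * Real.pi) := by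
    intro x hx
    obtain ⟨s, hs, rfl⟩ := exists_eq_exp hu (hA1 x hx) hσ
    rcases le_total s a with h | h
    · exact Or.inl ⟨s, ⟨hs.1, h⟩, rfl⟩
    · exact Or.inr ⟨s, ⟨h, hs.2.le⟩, rfl⟩
  have h1 : (A ∩ g '' Icc 0 a).Nonempty := by
    obtain ⟨s, hs, rfl⟩ := hdJ
    exact ⟨_, hd, s, ⟨hs.1.le, hs.2.le⟩, rfl⟩
  have h2 : (A ∩ g '' Icc a (2 * Real.pi)).Nonempty := by
    refine ⟨e, he, ?_⟩
    rcases hcov he with ⟨s, hs, rfl⟩ | h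
    · rcases eq_or_lt_of_le hs.1 with h0 | h0
      · subst h0
        exact ⟨2 * Real.pi, ⟨ha.le, le_rfl⟩, hper⟩
      · rcases eq_or_lt_of_le hs.2 with h3 | h3
        · subst h3; exact ⟨s, ⟨le_rfl, ha.le⟩, rfl⟩
        · exact absurd ⟨s, ⟨h0, h3⟩, rfl⟩ heJ
    · exact h
  obtain ⟨x, hxA, ⟨s, hs, hsx⟩, ⟨s', hs', hsx'⟩⟩ :=
    isPreconnected_closed_iff.1 hA _ _ (hcl _ _) (hcl _ _) hcov h1 h2
  obtain ⟨n, hn⟩ := exp_eq_imp hu hσ (hsx'.trans hsx.symm)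
  have hpi := Real.pi_pos
  have hn0 : (0 : ℤ) ≤ n := by
    by_contra hneg
    have : (n : ℝ) ≤ -1 := by exact_mod_cast (by omega : n ≤ -1)
    nlinarith [hs.2, hs'.1, hs.1]
  rcases hn0.eq_or_lt with h | h
  · right
    have : s = a := by
      rw [← h] at hn; simp at hn; linarith [hs.2, hs'.1]
    rw [← this]
    have h5 : u * Complex.exp ((σ * s : ℝ) * Complex.I) = x := hsx
    rwa [h5]
  · left
    have : (1 : ℝ) ≤ n := by exact_mod_cast h
    have h0 : s = 0 := by nlinarith [hs'.2, hs.1]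
    rw [← hg0, ← h0, hsx]; exact hxA

/-- A pair of disjoint circular arcs about `c`, for every radius between `ri` and `ro`, which start
on the ray from `c` in the direction `u` and end on `t 0` and `t 1`, and avoid the set `O`. -/
structure ArcPair (c u : ℂ) (ri ro : ℝ) (P O : Set ℂ) (t : Fin 2 → Set ℂ) (σ a : Fin 2 → ℝ → ℝ) :
    Prop where
  norm_u : ‖u‖ = 1
  ri_nonneg : 0 ≤ ri
  sign : ∀ β, ∀ r ∈ Ioo ri ro, σ β r = 1 ∨ σ β r = -1
  length : ∀ β, ∀ r ∈ Ioo ri ro, 0 < a β r ∧ a β r < 2 * Real.pi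
  start_mem : ∀ r ∈ Ioo ri ro, c + (r : ℂ) * u ∈ P
  end_mem : ∀ β, ∀ r ∈ Ioo ri ro,
    c + (r : ℂ) * (u * Complex.exp ((σ β r * a β r : ℝ) * Complex.I)) ∈ t β
  disjoint_arcs : ∀ r ∈ Ioo ri ro, Disjoint (arcDir u (σ 0 r) (a 0 r)) (arcDir u (σ 1 r) (a 1 r))
  avoid : ∀ β, ∀ r ∈ Ioo ri ro, ∀ d ∈ arcDir u (σ β r) (a β r), c + (r : ℂ) * d ∉ O
  t_subset : ∀ β, t β ⊆ O
  disjoint_parent : ∀ β, Disjoint P (t β)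

namespace ArcPair

variable {c u : ℂ} {ri ro : ℝ} {P O : Set ℂ} {t : Fin 2 → Set ℂ} {σ a : Fin 2 → ℝ → ℝ}

/-- Both arcs start on the same ray, so with the same sense of rotation they would share an initial
piece. -/
lemma opposite (H : ArcPair c u ri ro P O t σ a) {r : ℝ} (hr : r ∈ Ioo ri ro) :
    σ 0 r ≠ σ 1 r := by
  intro h
  obtain ⟨h0, _⟩ := H.length 0 r hr
  obtain ⟨h1, _⟩ := H.length 1 r hr
  have hm : 0 < min (a 0 r) (a 1 r) := lt_min h0 h1
  refine Set.disjoint_left.1 (H.disjoint_arcs r hr)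
    ⟨min (a 0 r) (a 1 r) / 2, ⟨by linarith, ?_⟩, rfl⟩
    ⟨min (a 0 r) (a 1 r) / 2, ⟨by linarith, ?_⟩, by simp only [h]⟩
  · linarith [min_le_left (a 0 r) (a 1 r)]
  · linarith [min_le_right (a 0 r) (a 1 r)]

/-- The two signs at each radius exhaust ±1. Which of the two arcs carries a given sign may change
with the radius. -/
lemma exists_same_sign (H : ArcPair c u ri ro P O t σ a) {r r' : ℝ} (hr : r ∈ Ioo ri ro)
    (hr' : r' ∈ Ioo ri ro) (β : Fin 2) : ∃ i, σ i r' = σ β r := by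
  have h := H.opposite hr'
  rcases H.sign 0 r' hr' with h0 | h0 <;> rcases H.sign 1 r' hr' with h1 | h1 <;>
    rcases H.sign β r hr with h2 | h2 <;> rw [h0, h1] at h
  · exact absurd rfl h
  · exact absurd rfl h
  · exact ⟨0, by rw [h0, h2]⟩
  · exact ⟨1, by rw [h1, h2]⟩
  · exact ⟨1, by rw [h1, h2]⟩
  · exact ⟨0, by rw [h0, h2]⟩
  · exact absurd rfl h
  · exact absurd rfl h

/-- From every point of `t i` on the circle of radius `r'` one gets to the circle of radius `r`
along `t i` without leaving the closed annulus between the two circles. -/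
def Continues (c : ℂ) (T : Set ℂ) (r' r : ℝ) : Prop :=
  ∀ ζ ∈ T, ‖ζ - c‖ = r' → ∃ ξ ∈ T, ‖ξ - c‖ = r ∧ ∃ τ ⊆ T, IsPreconnected τ ∧ ζ ∈ τ ∧ ξ ∈ τ ∧
    ∀ x ∈ τ, ‖x - c‖ ∈ uIcc r' r

/-- Suppose the direction of y is in the arc of radius r. The arc of radius r' with the same
rotation avoids y, so it ends at some ζ of `t i` before y. Following `t i` from ζ to radius r leads
to a point ξ outside the arc of radius r, so on the way `t i` has to cross either the ray of the
parent or the direction of y. -/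
lemma same_side (H : ArcPair c u ri ro P O t σ a) {r r' : ℝ} (hr : r ∈ Ioo ri ro)
    (hr' : r' ∈ Ioo ri ro) {y : ℂ} (hy : ‖y - c‖ = r') (hyO : y ∈ O)
    (hcont : ∀ i, Continues c (t i) r' r) (hfar : ∀ i, ∀ x ∈ t i, |r - r'| < dist x y)
    (β : Fin 2) : dirFrom c y ∉ arcDir u (σ β r) (a β r) := by
  rintro ⟨s₀, hs₀, hs₀y⟩
  simp only at hs₀y
  obtain ⟨i, hi⟩ := H.exists_same_sign hr hr' β
  have hrpos : 0 < r := H.ri_nonneg.trans_lt hr.1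
  have hrpos' : 0 < r' := H.ri_nonneg.trans_lt hr'.1
  have hu := H.norm_u
  obtain ⟨ha0, ha⟩ := H.length i r' hr'
  obtain ⟨hb0, hb⟩ := H.length β r hr
  set ζ := c + (r' : ℂ) * (u * Complex.exp ((σ i r' * a i r' : ℝ) * Complex.I)) with hζ
  have hζt : ζ ∈ t i := H.end_mem i r' hr'
  have hζn : ‖ζ - c‖ = r' := norm_add_mul_sub hrpos'.le (norm_mul_exp hu _)
  obtain ⟨ξ, hξt, hξn, τ, hτt, hτc, hζτ, hξτ, hτ⟩ := hcont i ζ hζt hζn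
  have hne : ∀ x ∈ τ, x ≠ c := by
    rintro x hx rfl
    have := hτ x hx
    rw [sub_self, norm_zero, mem_uIcc] at this
    rcases this with h | h <;> linarith [h.1]
  have hyc : y ≠ c := by rintro rfl; simp at hy; linarith
  set A : Set ℂ := ((fun s : ℝ => u * Complex.exp ((σ i r' * s : ℝ) * Complex.I)) '' Ioc 0 (a i r'))
    ∪ dirFrom c '' τ with hA
  have hζd : dirFrom c ζ = u * Complex.exp ((σ i r' * a i r' : ℝ) * Complex.I) :=
    dirFrom_add_mul hrpos' (norm_mul_exp hu _)
  have hAc : IsPreconnected A := by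
    refine IsPreconnected.union (dirFrom c ζ) ⟨a i r', ⟨ha0, le_rfl⟩, hζd.symm⟩ ⟨ζ, hζτ, rfl⟩ ?_ ?_
    · exact isPreconnected_Ioc.image _ (by fun_prop)
    · exact hτc.image _ ((continuousOn_dirFrom c).mono fun x hx => hne x hx)
  have hA1 : ∀ d ∈ A, ‖d‖ = 1 := by
    rintro d (⟨s, _, rfl⟩ | ⟨x, hx, rfl⟩)
    · exact norm_mul_exp hu _
    · exact norm_dirFrom (hne x hx)
  have hs₀2 : s₀ < 2 * Real.pi := hs₀.2.trans hb
  have key : u ∈ A ∨ u * Complex.exp ((σ β r * s₀ : ℝ) * Complex.I) ∈ A := by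
    have hm : 0 < min s₀ (a i r') := lt_min hs₀.1 ha0
    -- The trap is the arc from u to the direction of y. It shares an initial piece with the arc of
    -- radius r', and ξ is outside it because the arc of radius r avoids O.
    refine arc_trap hu (H.sign β r hr) hs₀.1 hs₀2 hAc hA1
      (d := u * Complex.exp ((σ i r' * (min s₀ (a i r') / 2) : ℝ) * Complex.I)) (e := dirFrom c ξ)
      (Or.inl ⟨_, ⟨by linarith, by linarith [min_le_right s₀ (a i r')]⟩, rfl⟩)
      ⟨min s₀ (a i r') / 2, ⟨by linarith, by linarith [min_le_left s₀ (a i r')]⟩, by simp only [hi]⟩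
      (Or.inr ⟨ξ, hξτ, rfl⟩) ?_
    rintro ⟨s, hs, hsξ⟩
    refine H.avoid β r hr (dirFrom c ξ) ⟨s, ⟨hs.1, hs.2.trans hs₀.2⟩, hsξ⟩ (H.t_subset i ?_)
    rw [← hξn, add_norm_mul_dirFrom]; exact hξt
  -- Crossing u: the arc of radius r' is less than a full turn, and τ would meet the parent.
  -- Crossing the direction of y: the arc of radius r' would contain y or end at y, and a point of τ
  -- in that direction would be within |r - r'| of y.
  rcases key with (⟨s, hs, hsu⟩ | ⟨x, hx, hxu⟩) | h
  · have h0 : u * Complex.exp ((σ i r' * s : ℝ) * Complex.I)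
        = u * Complex.exp ((σ i r' * 0 : ℝ) * Complex.I) := by simpa using hsu
    obtain ⟨n, hn⟩ := exp_eq_imp hu (H.sign i r' hr') h0
    have h1 : (0 : ℝ) < n := by
      by_contra hneg
      have := Real.pi_pos
      nlinarith [hs.1]
    have h2 : (1 : ℝ) ≤ n := by exact_mod_cast (by exact_mod_cast h1 : (0 : ℤ) < n)
    have := Real.pi_pos
    nlinarith [hs.2]
  · have hxr : ‖x - c‖ ∈ Ioo ri ro := by
      have := hτ x hx
      rw [mem_uIcc] at this
      rcases this with h | h
      · exact ⟨hr'.1.trans_le h.1, h.2.trans_lt hr.2⟩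
      · exact ⟨hr.1.trans_le h.1, h.2.trans_lt hr'.2⟩
    have h1 := H.start_mem _ hxr
    rw [← hxu, add_norm_mul_dirFrom] at h1
    exact Set.disjoint_left.1 (H.disjoint_parent i) h1 (hτt hx)
  · rw [hs₀y] at h
    rcases h with ⟨s, hs, hsy⟩ | ⟨x, hx, hxy⟩
    · have hyeq : c + (r' : ℂ) * (u * Complex.exp ((σ i r' * s : ℝ) * Complex.I)) = y := by
        simp only at hsy
        rw [hsy, ← hy, add_norm_mul_dirFrom]
      rcases eq_or_lt_of_le hs.2 with h3 | h3
      · have : ζ = y := by rw [hζ, ← h3, hyeq]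
        have h4 := hfar i ζ hζt
        rw [this, dist_self] at h4
        exact absurd h4 (not_lt.2 (abs_nonneg _))
      · exact H.avoid i r' hr' _ ⟨s, ⟨hs.1, h3⟩, rfl⟩ (by rw [hyeq]; exact hyO)
    · have h4 := hfar i x (hτt hx)
      have h5 : dist x y = |‖x - c‖ - ‖y - c‖| := by
        have := dist_add_mul_dirFrom c y ‖x - c‖ hyc
        rwa [← hxy, add_norm_mul_dirFrom] at this
      rw [h5, hy] at h4
      have := hτ x hx
      rw [mem_uIcc] at this
      have h6 : |‖x - c‖ - r'| ≤ |r - r'| := by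
        rcases this with h | h
        · rw [abs_of_nonneg (by linarith), abs_of_nonneg (by linarith)]; linarith
        · rw [abs_of_nonpos (by linarith), abs_of_nonpos (by linarith)]; linarith
      linarith

/-- The radial projection moves x by at most dist z x, and dist z x + dist x y = dist z y. -/
lemma segment_close {c z y : ℂ} {r η : ℝ} (hz : ‖z - c‖ = r) (hzy : dist z y ≤ η) (hη : η < r)
    {x : ℂ} (hx : x ∈ segment ℝ z y) : x ≠ c ∧ dist (c + r * dirFrom c x) y ≤ η := by
  have h1 : dist z x + dist x y = dist z y := by
    rw [mem_segment_iff_wbtw] at hx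
    exact hx.dist_add_dist
  have hxc : x ≠ c := by
    rintro rfl
    have : dist z x = r := by rw [dist_eq_norm, hz]
    linarith [dist_nonneg (x := x) (y := y)]
  refine ⟨hxc, ?_⟩
  have h2 := dist_add_mul_dirFrom c x r hxc
  have h3 : |r - ‖x - c‖| ≤ dist z x := by
    rw [← hz, dist_eq_norm]
    simpa using abs_norm_sub_norm_le (z - c) (x - c)
  linarith [dist_triangle (c + r * dirFrom c x) x y]

/-- A point of an arc is not close to a point of `O` that is far away from the parent and from the
ends of the arcs. -/
lemma not_close (H : ArcPair c u ri ro P O t σ a) {r η : ℝ} (hr : r ∈ Ioo (ri + η) (ro - η))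
    {β : Fin 2} {z y : ℂ} (hzr : ‖z - c‖ = r) (hz : dirFrom c z ∈ arcDir u (σ β r) (a β r))
    (hyO : y ∈ O) (hzy : dist z y ≤ η) (hcont : ∀ i, ∀ r', |r - r'| ≤ η → Continues c (t i) r' r)
    (hP : ∀ x ∈ P, η < dist x y) (ht : ∀ i, ∀ x ∈ t i, η < dist x y) : False := by
  have hη : 0 ≤ η := dist_nonneg.trans hzy
  have hr1 : r ∈ Ioo ri ro := ⟨by linarith [hr.1], by linarith [hr.2]⟩
  have hrpos : η < r := by linarith [H.ri_nonneg, hr.1]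
  have hd : |r - ‖y - c‖| ≤ η := by
    rw [← hzr]
    refine le_trans ?_ hzy
    rw [dist_eq_norm]
    simpa using abs_norm_sub_norm_le (z - c) (y - c)
  have hd' := abs_le.1 hd
  have hr' : ‖y - c‖ ∈ Ioo ri ro := ⟨by linarith [hr.1], by linarith [hr.2]⟩
  have hyn := H.same_side hr1 hr' rfl hyO (fun i => hcont i _ hd)
    (fun i x hx => hd.trans_lt (ht i x hx)) β
  obtain ⟨ha0, ha⟩ := H.length β r hr1
  have hclose := fun x hx => segment_close (c := c) hzr hzy hrpos (x := x) hx
  have hA1 : ∀ d ∈ dirFrom c '' segment ℝ z y, ‖d‖ = 1 := by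
    rintro d ⟨x, hx, rfl⟩
    exact norm_dirFrom (hclose x hx).1
  have hAc : IsPreconnected (dirFrom c '' segment ℝ z y) :=
    (convex_segment z y).isPreconnected.image _
      ((continuousOn_dirFrom c).mono fun x hx => (hclose x hx).1)
  -- The directions along the segment from z to y leave the arc, so they pass one of its ends. That
  -- end lies on P or `t β` and would be within η of y.
  rcases arc_trap H.norm_u (H.sign β r hr1) ha0 ha hAc hA1 ⟨z, left_mem_segment ℝ z y, rfl⟩ hz
    ⟨y, right_mem_segment ℝ z y, rfl⟩ hyn with ⟨x, hx, hxu⟩ | ⟨x, hx, hxu⟩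
  · have h := (hclose x hx).2
    rw [hxu] at h
    linarith [hP _ (H.start_mem r hr1)]
  · have h := (hclose x hx).2
    rw [hxu] at h
    linarith [ht β _ (H.end_mem β r hr1)]

/-- A point of an arc is not close to a point of the end `t γ` of the other arc. -/
lemma not_close_other (H : ArcPair c u ri ro P O t σ a) {r η : ℝ} (hr : r ∈ Ioo (ri + η) (ro - η))
    {β γ : Fin 2} {z y : ℂ} (hzr : ‖z - c‖ = r) (hz : dirFrom c z ∈ arcDir u (σ β r) (a β r))
    (hyt : y ∈ t γ) (hzy : dist z y ≤ η) (hcont : ∀ i, ∀ r', |r - r'| ≤ η → Continues c (t i) r' r)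
    (hP : ∀ x ∈ P, ∀ y' ∈ t γ, η < dist x y') (ht : ∀ x ∈ t β, ∀ y' ∈ t γ, η < dist x y') :
    False := by
  have hη : 0 ≤ η := dist_nonneg.trans hzy
  have hr1 : r ∈ Ioo ri ro := ⟨by linarith [hr.1], by linarith [hr.2]⟩
  have hrpos : η < r := by linarith [H.ri_nonneg, hr.1]
  have hrpos0 : 0 < r := hη.trans_lt hrpos
  have hd : |r - ‖y - c‖| ≤ η := by
    rw [← hzr]
    refine le_trans ?_ hzy
    rw [dist_eq_norm]
    simpa using abs_norm_sub_norm_le (z - c) (y - c)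
  -- Since y lies on `t γ`, the separation required by `same_side` fails. Instead `t γ` is followed
  -- from y to the circle of radius r, where it cannot be on the arc.
  obtain ⟨ξ, hξt, hξn, τ, hτt, hτc, hyτ, hξτ, hτ⟩ := hcont γ _ hd y hyt rfl
  obtain ⟨ha0, ha⟩ := H.length β r hr1
  have hclose := fun x hx => segment_close (c := c) hzr hzy hrpos (x := x) hx
  have hτr : ∀ x ∈ τ, |r - ‖x - c‖| ≤ η := by
    intro x hx
    have := hτ x hx
    rw [mem_uIcc] at this
    have hd' := abs_le.1 hd
    rw [abs_le]
    rcases this with h | h <;> constructor <;> linarith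
  have hne : ∀ x ∈ τ, x ≠ c := by
    rintro x hx rfl
    have := hτr x hx
    rw [sub_self, norm_zero, sub_zero, abs_of_pos hrpos0] at this
    linarith
  set A := dirFrom c '' segment ℝ z y ∪ dirFrom c '' τ with hA
  have hA1 : ∀ d ∈ A, ‖d‖ = 1 := by
    rintro d (⟨x, hx, rfl⟩ | ⟨x, hx, rfl⟩)
    · exact norm_dirFrom (hclose x hx).1
    · exact norm_dirFrom (hne x hx)
  have hAc : IsPreconnected A := by
    refine IsPreconnected.union (dirFrom c y) ⟨y, right_mem_segment ℝ z y, rfl⟩ ⟨y, hyτ, rfl⟩ ?_ ?_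
    · exact (convex_segment z y).isPreconnected.image _
        ((continuousOn_dirFrom c).mono fun x hx => (hclose x hx).1)
    · exact hτc.image _ ((continuousOn_dirFrom c).mono fun x hx => hne x hx)
  have hξ : dirFrom c ξ ∉ arcDir u (σ β r) (a β r) := by
    intro h
    refine H.avoid β r hr1 _ h (H.t_subset γ ?_)
    rw [← hξn, add_norm_mul_dirFrom]; exact hξt
  -- Every direction occurring in A gives a point of the circle within η of `t γ`, but both ends of
  -- the arc are farther from `t γ`.
  have hfin : ∀ w : ℂ, w ∈ A → (∀ y' ∈ t γ, η < dist (c + r * w) y') → False := by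
    rintro w (⟨x, hx, rfl⟩ | ⟨x, hx, rfl⟩) hw
    · linarith [(hclose x hx).2, hw y hyt]
    · have := dist_add_mul_dirFrom c x r (hne x hx)
      linarith [hτr x hx, hw x (hτt hx)]
  rcases arc_trap H.norm_u (H.sign β r hr1) ha0 ha hAc hA1
    (Or.inl ⟨z, left_mem_segment ℝ z y, rfl⟩) hz (Or.inr ⟨ξ, hξτ, rfl⟩) hξ with h | h
  · exact hfin _ h fun y' hy' => hP _ (H.start_mem r hr1) y' hy'
  · exact hfin _ h fun y' hy' => ht _ (H.end_mem β r hr1) y' hy'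

/-! ### Following a segment between two circles -/

lemma exists_first_hit {g : ℝ → ℝ} (hg : Continuous g) {r : ℝ} (h0 : g 0 ≤ r) (h1 : r ≤ g 1) :
    ∃ s ∈ Icc (0 : ℝ) 1, g s = r ∧ ∀ s' ∈ Icc 0 s, g s' ≤ r := by
  set S := {s | s ∈ Icc (0 : ℝ) 1 ∧ r ≤ g s} with hS
  have hSc : IsClosed S := isClosed_Icc.inter (isClosed_le continuous_const hg)
  have hne : S.Nonempty := ⟨1, ⟨zero_le_one, le_rfl⟩, h1⟩
  have hbd : BddBelow S := ⟨0, fun s hs => hs.1.1⟩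
  have hmem : sInf S ∈ S := hSc.csInf_mem hne hbd
  have hlt : ∀ s' ∈ Ico 0 (sInf S), g s' < r := by
    intro s' hs'
    by_contra hcon
    exact absurd (csInf_le hbd (show s' ∈ S from
      ⟨⟨hs'.1, hs'.2.le.trans hmem.1.2⟩, not_lt.1 hcon⟩)) (not_le.2 hs'.2)
  have heq : g (sInf S) = r := by
    refine le_antisymm ?_ hmem.2
    obtain ⟨s', hs', h⟩ := intermediate_value_Icc hmem.1.1 hg.continuousOn ⟨h0, hmem.2⟩
    have : s' = sInf S := le_antisymm hs'.2
      (csInf_le hbd ⟨⟨hs'.1, hs'.2.trans hmem.1.2⟩, h.ge⟩)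
    rw [← this, h]
  refine ⟨sInf S, hmem.1, heq, fun s' hs' => ?_⟩
  rcases eq_or_lt_of_le hs'.2 with h | h
  · rw [h, heq]
  · exact (hlt s' ⟨hs'.1, h⟩).le

/-- The function f is the identity for outward moves and negation for inward moves. Stopping at the
first hit keeps τ on one side of the circle of radius r. -/
lemma exists_subpath {c ζ q : ℂ} {T : Set ℂ} (hT : Convex ℝ T) (hζ : ζ ∈ T) (hq : q ∈ T) {r : ℝ}
    (f : ℝ → ℝ) (hf : Continuous f) (h0 : f ‖ζ - c‖ ≤ f r) (h1 : f r ≤ f ‖q - c‖)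
    (hinj : Function.Injective f) :
    ∃ ξ ∈ T, ‖ξ - c‖ = r ∧ ∃ τ ⊆ segment ℝ ζ q, IsPreconnected τ ∧ ζ ∈ τ ∧ ξ ∈ τ ∧
      ∀ x ∈ τ, f ‖x - c‖ ≤ f r := by
  have hg : Continuous fun s : ℝ => f ‖AffineMap.lineMap ζ q s - c‖ := by
    refine hf.comp (Continuous.norm ?_)
    exact (AffineMap.lineMap_continuous).sub continuous_const
  obtain ⟨s, hs, hsr, hle⟩ := exists_first_hit hg (r := f r) (by simpa using h0) (by simpa using h1)
  have hsub : (AffineMap.lineMap ζ q '' Icc 0 s : Set ℂ) ⊆ segment ℝ ζ q := by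
    rw [segment_eq_image_lineMap]
    exact image_mono (Icc_subset_Icc_right hs.2)
  refine ⟨AffineMap.lineMap ζ q s, hT.segment_subset hζ hq (hsub ⟨s, ⟨hs.1, le_rfl⟩, rfl⟩), hinj hsr,
    AffineMap.lineMap ζ q '' Icc 0 s, hsub, isPreconnected_Icc.image _
      AffineMap.lineMap_continuous.continuousOn, ⟨0, ⟨le_rfl, hs.1⟩, by simp⟩,
      ⟨s, ⟨hs.1, le_rfl⟩, rfl⟩, ?_⟩
  rintro x ⟨s', hs', rfl⟩
  exact hle s' hs'

/-- Inward, convexity of the closed ball of radius r' suffices. Outward, a line through ζ cannot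
enter the open ball of radius r' on both sides of ζ, so towards one end the segment stays outside.
The condition on N ensures that this end has radius at least r. -/
lemma continues_segment {c N F : ℂ} {r r' : ℝ} (hex : ∃ x ∈ segment ℝ N F, ‖x - c‖ = r)
    (hF : r ≤ ‖F - c‖) (hN : r ≤ ‖N - c‖ ∨ ‖N - c‖ < r') :
    Continues c (segment ℝ N F) r' r := by
  intro ζ hζ hζr
  have hT := convex_segment (𝕜 := ℝ) N F
  rcases le_or_gt r r' with hle | hlt
  · obtain ⟨q, hq, hqr⟩ := hex
    obtain ⟨ξ, hξ, hξr, τ, hτ, hτc, h1, h2, h3⟩ := exists_subpath (c := c) hT hζ hq (r := r)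
      (fun x => -x) continuous_neg (by simpa [hζr] using hle) (by simp [hqr]) neg_injective
    refine ⟨ξ, hξ, hξr, τ, hτ.trans (hT.segment_subset hζ hq), hτc, h1, h2, fun x hx => ?_⟩
    rw [mem_uIcc]
    refine Or.inr ⟨by simpa using h3 x hx, ?_⟩
    have h4 : segment ℝ ζ q ⊆ Metric.closedBall c r' :=
      (convex_closedBall c r').segment_subset (by simp [dist_eq_norm, hζr])
        (by simp [dist_eq_norm, hqr, hle])
    simpa [dist_eq_norm] using h4 (hτ hx)
  · have hside : ∃ q ∈ segment ℝ N F, r ≤ ‖q - c‖ ∧ ∀ x ∈ segment ℝ ζ q, r' ≤ ‖x - c‖ := by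
      by_contra hcon
      push Not at hcon
      obtain ⟨x₁, hx₁, h₁⟩ := hcon F (right_mem_segment ℝ N F) hF
      have h₂ : ∃ x₂ ∈ segment ℝ ζ N, ‖x₂ - c‖ < r' := by
        rcases hN with h | h
        · exact hcon N (left_mem_segment ℝ N F) h
        · exact ⟨N, right_mem_segment ℝ ζ N, h⟩
      obtain ⟨x₂, hx₂, h₂⟩ := h₂
      rw [mem_segment_iff_wbtw] at hζ hx₁ hx₂
      have h3 : Wbtw ℝ x₂ ζ x₁ := (hζ.trans_right_left hx₁).trans_left_right hx₂.symm
      have h4 := (convex_ball c r').segment_subset (x := x₂) (y := x₁)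
        (by simpa [dist_eq_norm] using h₂) (by simpa [dist_eq_norm] using h₁)
        (mem_segment_iff_wbtw.2 h3)
      rw [Metric.mem_ball, dist_eq_norm, hζr] at h4
      exact lt_irrefl _ h4
    obtain ⟨q, hq, hqr, hside⟩ := hside
    obtain ⟨ξ, hξ, hξr, τ, hτ, hτc, h1, h2, h3⟩ := exists_subpath (c := c) hT hζ hq (r := r)
      id continuous_id (by simpa [hζr] using hlt.le) (by simpa using hqr) Function.injective_id
    refine ⟨ξ, hξ, hξr, τ, hτ.trans (hT.segment_subset hζ hq), hτc, h1, h2, fun x hx => ?_⟩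
    rw [mem_uIcc]
    exact Or.inl ⟨hside x (hτ hx), h3 x hx⟩

end ArcPair
end CantorExample

namespace CantorExample

/-! ### Positions of the squares -/

lemma abs_re_lt_of_mem_interior_square {c r : ℝ} {z : ℂ} (h : z ∈ interior (square c r)) :
    |z.re - c| < r := by
  have h1 : square c r = Icc (c - r) (c + r) ×ℂ Icc (-r) r := by
    ext z
    simp only [square, mem_ofPred_eq, Complex.mem_reProdIm, mem_Icc, abs_le]
    constructor
    · rintro ⟨⟨_, _⟩, _, _⟩; exact ⟨⟨by linarith, by linarith⟩, by linarith, by linarith⟩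
    · rintro ⟨⟨_, _⟩, _, _⟩; exact ⟨⟨by linarith, by linarith⟩, by linarith, by linarith⟩
  rw [h1, Complex.interior_reProdIm, Complex.mem_reProdIm, interior_Icc] at h
  rw [abs_lt]
  exact ⟨by linarith [h.1.1], by linarith [h.1.2]⟩

lemma isClosed_square (c r : ℝ) : IsClosed (square c r) :=
  (isClosed_le (f := fun z : ℂ => |z.re - c|) (by fun_prop) continuous_const).inter
    (isClosed_le (f := fun z : ℂ => |z.im|) (by fun_prop) continuous_const)

namespace Squares

variable (S : Squares)

/-- The squares are centred on the real axis, so horizontal projections can be tested at real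
points. Nesting and disjointness of the squares thereby pass to their projections. -/
lemma ofReal_mem_Q {w : List (Fin 2)} {s : ℝ} : (s : ℂ) ∈ S.Q w ↔ |s - S.x w| ≤ S.R w.length := by
  simp [Q, square, (S.R_pos _).le]

lemma abs_re_le {w : List (Fin 2)} {z : ℂ} (h : z ∈ S.Q w) : |z.re - S.x w| ≤ S.R w.length := h.1

lemma isClosed_Q (w : List (Fin 2)) : IsClosed (S.Q w) := isClosed_square _ _

lemma Q_append_singleton_subset (w : List (Fin 2)) (i : Fin 2) :
    S.Q (w ++ [i]) ⊆ interior (S.Q w) := by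
  have := S.nested w i
  simpa [Q] using this

lemma Q_append_subset (w z : List (Fin 2)) : S.Q (w ++ z) ⊆ S.Q w := by
  induction z using List.reverseRecOn with
  | nil => simp
  | append_singleton z i ih =>
    rw [← List.append_assoc]
    exact ((S.Q_append_singleton_subset _ i).trans interior_subset).trans ih

lemma Q_subset_take (w : List (Fin 2)) (n : ℕ) : S.Q w ⊆ S.Q (w.take n) := by
  conv_lhs => rw [← List.take_append_drop n w]
  exact S.Q_append_subset _ _

lemma eq_of_abs_le {w w' : List (Fin 2)} (hl : w.length = w'.length) {s : ℝ}
    (h : |s - S.x w| ≤ S.R w.length) (h' : |s - S.x w'| ≤ S.R w'.length) : w = w' := by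
  by_contra hne
  exact Set.disjoint_left.1 (S.disjoint w w' hl hne) (S.ofReal_mem_Q.2 h) (S.ofReal_mem_Q.2 h')

lemma abs_sub_lt_of_append {w z : List (Fin 2)} (hz : z ≠ []) {s : ℝ}
    (h : |s - S.x (w ++ z)| ≤ S.R (w ++ z).length) : |s - S.x w| < S.R w.length := by
  obtain ⟨i, z, rfl⟩ := List.exists_cons_of_ne_nil hz
  have h1 : (s : ℂ) ∈ S.Q (w ++ [i]) := by
    have : w ++ i :: z = (w ++ [i]) ++ z := by simp
    rw [this] at h
    exact S.Q_append_subset _ z (S.ofReal_mem_Q.2 h)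
  simpa using abs_re_lt_of_mem_interior_square (S.Q_append_singleton_subset w i h1)

lemma collar_subset_Q (w : List (Fin 2)) : S.collar w ⊆ S.Q w :=
  sdiff_subset.trans interior_subset

/-- A longer word either extends w, so that its square lies in a child of Q_w, or has a different
prefix of the same length as w, whose square is disjoint from Q_w. -/
lemma disjoint_collar_Q {w w' : List (Fin 2)} (h : w.length < w'.length) :
    Disjoint (S.collar w) (S.Q w') := by
  rw [Set.disjoint_left]
  intro z hz hz'
  have h1 := S.Q_subset_take w' (w.length + 1) hz'
  rw [List.take_add_one] at h1
  obtain ⟨i, hi⟩ : ∃ i, w'[w.length]?.toList = [i] :=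
    ⟨w'[w.length], by rw [List.getElem?_eq_getElem h]; rfl⟩
  rw [hi] at h1
  by_cases hw : w'.take w.length = w
  · rw [hw] at h1
    apply hz.2
    fin_cases i
    · exact Or.inl h1
    · exact Or.inr h1
  · have hl : (w'.take w.length).length = w.length := by simp [h.le]
    refine Set.disjoint_left.1 (S.disjoint _ _ hl hw) ?_ (S.collar_subset_Q w hz)
    exact (S.Q_append_subset _ _ h1)

lemma disjoint_collar {w w' : List (Fin 2)} (h : w ≠ w') : Disjoint (S.collar w) (S.collar w') := by
  rcases lt_trichotomy w.length w'.length with hl | hl | hl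
  · exact (S.disjoint_collar_Q hl).mono_right (S.collar_subset_Q w')
  · exact (S.disjoint w w' hl h).mono (S.collar_subset_Q w) (S.collar_subset_Q w')
  · exact ((S.disjoint_collar_Q hl).mono_right (S.collar_subset_Q w)).symm

end Squares

/-- The index `m` of the segment `I_m(w, v)` with endpoint `hub s α w v`. -/
def hubIndex (s α : Fin 2) : Fin 3 := if s = 0 then α.castSucc else α.succ

namespace Segments

variable (S : Segments)

lemma exp_one_bounds : (2.7 : ℝ) < Real.exp 1 := by
  have := Real.exp_one_gt_d9; linarith

lemma ε_succ_le (k : ℕ) : 2.7 * S.ε (k + 1) ≤ S.ε k := by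
  have h := S.ε_decay k
  rw [le_div_iff₀ (Real.exp_pos 1)] at h
  nlinarith [exp_one_bounds, S.ε_pos (k + 1)]

lemma ε_anti {k l : ℕ} (h : k ≤ l) : S.ε l ≤ S.ε k :=
  antitone_nat_of_succ_le (fun k => by linarith [S.ε_succ_le k, S.ε_pos (k + 1)]) h

lemma I_subset_collar {m w v} (h : w.length = v.length) : S.I m w v ⊆ S.collar w :=
  S.segment_subset m w v h

lemma re_bounds_of_mem_segment {p q z : ℂ} {l h : ℝ} (hz : z ∈ segment ℝ p q)
    (hp : l ≤ p.re ∧ p.re ≤ h) (hq : l ≤ q.re ∧ q.re ≤ h) : l ≤ z.re ∧ z.re ≤ h := by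
  have hc : Convex ℝ {z : ℂ | l ≤ z.re ∧ z.re ≤ h} :=
    (convex_halfSpace_re_ge l).inter (convex_halfSpace_re_le h)
  exact hc.segment_subset hp hq hz

/-- A point of a segment of generation `k` is not above or below a square of generation `k + 1`. -/
lemma R_lt_abs_of_mem_I {m w v} (h : w.length = v.length) {z : ℂ} (hz : z ∈ S.I m w v)
    {w' : List (Fin 2)} (hw' : w'.length = w.length + 1) :
    S.R (w.length + 1) < |z.re - S.x w'| := by
  by_contra hcon
  rw [not_lt] at hcon
  have hs : |z.re - S.x w'| ≤ S.R w'.length := by rwa [hw']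
  -- If z.re is in the projection of Q_{w'}, it is in that of the prefix square. As z ∈ Q_w, the
  -- prefix is w and w' is a child of w.
  obtain ⟨i, hi⟩ : ∃ i, w' = w ++ [i] := by
    have hne : w'.drop w.length ≠ [] := by
      intro h0
      have := congrArg List.length h0
      simp [hw'] at this
    have h1 : w'.take w.length = w := by
      have hl : (w'.take w.length).length = w.length := by simp [hw']
      refine S.eq_of_abs_le hl (s := z.re) ?_ ?_
      · refine (S.abs_sub_lt_of_append hne ?_).le
        rwa [List.take_append_drop]
      · exact S.abs_re_le (S.collar_subset_Q w (S.I_subset_collar h hz))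
    obtain ⟨i, hi⟩ : ∃ i, w'.drop w.length = [i] := by
      rw [← List.length_eq_one_iff]; simp [hw']
    refine ⟨i, ?_⟩
    conv_lhs => rw [← List.take_append_drop w.length w', h1, hi]
  obtain ⟨p1, p2, p3⟩ := S.position₁ w v h
  obtain ⟨p4, p5, p6, p7, p8⟩ := S.position₂ w v h
  obtain ⟨p9, p10, p11⟩ := S.position₃ w v h
  have hR := S.R_pos (w.length + 1)
  have hc := abs_le.1 hcon
  subst hi
  fin_cases m
  · have := (re_bounds_of_mem_segment (l := (S.a 0 w v).re) (h := (S.b 0 w v).re) hz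
      ⟨le_rfl, p1.le⟩ ⟨p1.le, le_rfl⟩).2
    fin_cases i
    · simp at hc; linarith
    · simp at hc; linarith
  · have := re_bounds_of_mem_segment (l := (S.a 1 w v).re) (h := (S.b 1 w v).re) hz
      ⟨le_rfl, p6.le⟩ ⟨p6.le, le_rfl⟩
    fin_cases i
    · simp at hc; linarith
    · simp at hc; linarith
  · have := (re_bounds_of_mem_segment (l := (S.a 2 w v).re) (h := (S.b 2 w v).re) hz
      ⟨le_rfl, p11.le⟩ ⟨p11.le, le_rfl⟩).1
    fin_cases i
    · simp at hc; linarith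
    · simp at hc; linarith

/-- A point of a segment of generation `k` is far away, horizontally, from every square of
generation at least `k + 2`. -/
lemma far_of_mem_Q {m w v} (h : w.length = v.length) {z : ℂ} (hz : z ∈ S.I m w v)
    {w' : List (Fin 2)} (hw' : w.length + 2 ≤ w'.length) {y : ℂ} (hy : y ∈ S.Q w') :
    10 * S.ε w.length < |z.re - y.re| := by
  set u := w'.take (w.length + 1) with hu
  have hul : u.length = w.length + 1 := by rw [hu, List.length_take]; omega
  have h1 := S.Q_subset_take w' (w.length + 2) hy
  have hlt : w.length + 1 < w'.length := by omega
  obtain ⟨i, hi⟩ : ∃ i, w'.take (w.length + 2) = u ++ [i] :=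
    ⟨w'[w.length + 1], by rw [List.take_add_one, List.getElem?_eq_getElem hlt]; rfl⟩
  rw [hi] at h1
  have h2 := S.abs_re_le h1
  rw [List.length_append, hul] at h2
  have h3 := S.ε_small w.length u i hul
  have h4 := S.R_lt_abs_of_mem_I h hz hul
  have h5 : |z.re - S.x u| ≤ |z.re - y.re| + |y.re - S.x (u ++ [i])| + |S.x (u ++ [i]) - S.x u| := by
    calc _ = |(z.re - y.re) + (y.re - S.x (u ++ [i])) + (S.x (u ++ [i]) - S.x u)| := by
          congr 1; ring
      _ ≤ _ := abs_add_three _ _ _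
  simp only [List.length_cons, List.length_nil] at h2
  linarith

/-! ### The centres of the arcs -/

/-- The four segment endpoints next to the squares `Q_{w0}` and `Q_{w1}`: the centre of the arcs
around the left (`s = 0`) or right (`s = 1`) side of `Q_{wα}`. -/
def hub (s α : Fin 2) (w : List (Fin 2)) (v : List (Fin 4)) : ℂ :=
  if s = 0 then S.b α.castSucc w v else S.a α.succ w v

lemma hub_mem_I (s α w v) : S.hub s α w v ∈ S.I (hubIndex s α) w v := by
  unfold hub hubIndex I
  split_ifs
  · exact right_mem_segment ℝ _ _
  · exact left_mem_segment ℝ _ _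

lemma hub_mem_endpoints (s α) {w : List (Fin 2)} {v : List (Fin 4)} (h : w.length = v.length) :
    S.hub s α w v ∈ endpoints S.a S.b w.length := by
  unfold hub
  split_ifs
  · exact ⟨_, w, v, rfl, h.symm, Or.inr rfl⟩
  · exact ⟨_, w, v, rfl, h.symm, Or.inl rfl⟩

lemma hub_near (s α : Fin 2) {w : List (Fin 2)} {v : List (Fin 4)} (h : w.length = v.length) :
    |(S.hub s α w v).re - S.x (w ++ [α])| < S.R (w.length + 1) + S.ε (w.length + 1) / 10 := by
  obtain ⟨p1, p2, p3⟩ := S.position₁ w v h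
  obtain ⟨p4, p5, p6, p7, p8⟩ := S.position₂ w v h
  obtain ⟨p9, p10, p11⟩ := S.position₃ w v h
  have hR := S.R_pos (w.length + 1)
  have hε := S.ε_pos (w.length + 1)
  rw [abs_lt]
  fin_cases s <;> fin_cases α <;> simp [hub] <;> constructor <;> linarith

lemma hub_side (s α : Fin 2) {w : List (Fin 2)} {v : List (Fin 4)} (h : w.length = v.length) :
    (s = 0 → (S.hub s α w v).re < S.x (w ++ [α]) - S.R (w.length + 1)) ∧
    (s = 1 → S.x (w ++ [α]) + S.R (w.length + 1) < (S.hub s α w v).re) := by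
  obtain ⟨p1, p2, p3⟩ := S.position₁ w v h
  obtain ⟨p4, p5, p6, p7, p8⟩ := S.position₂ w v h
  obtain ⟨p9, p10, p11⟩ := S.position₃ w v h
  fin_cases s <;> fin_cases α <;> simp [hub] <;> linarith

/-- A hub of generation `k ≥ 1` is deep inside, horizontally, its square of generation `k`. -/
lemma hub_deep (s α : Fin 2) {w : List (Fin 2)} {v : List (Fin 4)} (h : w.length = v.length) {k : ℕ}
    (hk : w.length = k + 1) : |(S.hub s α w v).re - S.x w| + 9 * S.ε k < S.R (k + 1) := by
  have h1 := S.hub_near s α h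
  have h2 := S.ε_small k w α hk
  rw [hk] at h1
  have h3 : |(S.hub s α w v).re - S.x w|
      ≤ |(S.hub s α w v).re - S.x (w ++ [α])| + |S.x (w ++ [α]) - S.x w| := abs_sub_le _ _ _
  have h4 := S.ε_anti (show k ≤ k + 1 + 1 by omega)
  have h5 := S.ε_pos k
  have : k + 1 + 1 = k + 2 := rfl
  linarith

/-- A hub is far away, horizontally, from the segments of earlier generations. -/
lemma hub_far_earlier (s α : Fin 2) {w : List (Fin 2)} {v : List (Fin 4)}
    (h : w.length = v.length) {k : ℕ} (hk : w.length = k + 1) {m w' v'}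
    (h' : w'.length = v'.length) (hw' : w'.length < w.length) {z : ℂ} (hz : z ∈ S.I m w' v') :
    9 * S.ε k < |(S.hub s α w v).re - z.re| := by
  by_contra hcon
  rw [not_lt] at hcon
  have h1 := S.hub_deep s α h hk
  -- If z were horizontally that close to the hub, its real part would lie in the projection of Q_w,
  -- hence in that of the prefix square one generation after z, which `R_lt_abs_of_mem_I` excludes.
  have h2 : |z.re - S.x w| < S.R w.length := by
    have : |z.re - S.x w| ≤ |z.re - (S.hub s α w v).re| + |(S.hub s α w v).re - S.x w| :=
      abs_sub_le _ _ _
    rw [abs_sub_comm] at hcon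
    rw [hk]; linarith
  have hul : (w.take (w'.length + 1)).length = w'.length + 1 := by rw [List.length_take]; omega
  have h3 := S.R_lt_abs_of_mem_I h' hz hul
  have h4 : |z.re - S.x (w.take (w'.length + 1))| ≤ S.R (w'.length + 1) := by
    have := S.abs_re_le (S.Q_subset_take w (w'.length + 1) (S.ofReal_mem_Q.2 h2.le))
    rwa [hul] at this
  linarith

/-- The segments of the same or an other generation are disjoint. -/
lemma disjoint_I {m m' w w' v v'} (h : w.length = v.length) (h' : w'.length = v'.length)
    (hne : (m, w, v) ≠ (m', w', v')) : Disjoint (S.I m w v) (S.I m' w' v') := by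
  by_cases hw : w = w'
  · subst hw
    exact S.segment_disjoint m m' w w v v' h h' rfl hne
  · exact (S.disjoint_collar hw).mono (S.I_subset_collar h) (S.I_subset_collar h')

lemma I_injective {m w w' v v'} {z : ℂ} (h : w.length = v.length) (h' : w'.length = v'.length)
    (hz : z ∈ S.I m w v) (hz' : z ∈ S.I m w' v') : w = w' ∧ v = v' := by
  by_contra hcon
  refine Set.disjoint_left.1 (S.disjoint_I h h' ?_) hz hz'
  rintro heq
  simp only [Prod.mk.injEq, true_and] at heq
  exact hcon heq

/-- The balls around different hubs of the same kind are disjoint. -/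
lemma disjoint_balls (s α : Fin 2) {w w' : List (Fin 2)} {v v' : List (Fin 4)}
    (h : w.length = v.length) (h' : w'.length = v'.length) (hne : (w, v) ≠ (w', v')) :
    Disjoint (Metric.ball (S.hub s α w v) (S.ε w.length))
      (Metric.ball (S.hub s α w' v') (S.ε w'.length)) := by
  -- Hubs of different generations are horizontally at least 9 ε apart for the larger ε, and the two
  -- radii add up to at most 2 ε.
  have aux : ∀ {w w' : List (Fin 2)} {v v' : List (Fin 4)}, w.length = v.length →
      w'.length = v'.length → w'.length < w.length →
      Disjoint (Metric.ball (S.hub s α w v) (S.ε w.length))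
        (Metric.ball (S.hub s α w' v') (S.ε w'.length)) := by
    intro w w' v v' h h' hl
    apply Metric.ball_disjoint_ball
    have hd : |(S.hub s α w v).re - (S.hub s α w' v').re| ≤
        dist (S.hub s α w v) (S.hub s α w' v') := by
      rw [dist_eq_norm, ← Complex.sub_re]; exact Complex.abs_re_le_norm _
    have h0 := S.ε_pos w'.length
    have h1 : S.ε w.length ≤ S.ε w'.length := S.ε_anti hl.le
    rcases (show w.length = w'.length + 1 ∨ w'.length + 2 ≤ w.length by omega) with h2 | h2
    · have := S.hub_far_earlier s α h h2 h' hl (S.hub_mem_I s α w' v')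
      linarith
    · have := S.far_of_mem_Q h' (S.hub_mem_I s α w' v') h2
        (S.collar_subset_Q w (S.I_subset_collar h (S.hub_mem_I s α w v)))
      rw [abs_sub_comm] at this
      linarith
  rcases lt_trichotomy w.length w'.length with hl | hl | hl
  · exact (aux h' h hl).symm
  · have h1 : S.hub s α w v ≠ S.hub s α w' v' := by
      intro heq
      obtain ⟨rfl, rfl⟩ := S.I_injective h h' (S.hub_mem_I s α w v)
        (heq ▸ S.hub_mem_I s α w' v')
      exact hne rfl
    have h2 := S.balls_disjoint w.length _ (S.hub_mem_endpoints s α h) _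
      (hl ▸ S.hub_mem_endpoints s α h') h1
    rw [← hl]
    exact h2.mono Metric.ball_subset_closedBall Metric.ball_subset_closedBall
  · exact aux h h' hl

/-- Of the segments with index `(wα, ·)`, those on the other side or in the middle are far away from
the hubs at one side of `Q_{wα}`; the far endpoint of the others is far away, too. -/
lemma hub_far_other (s α : Fin 2) {w : List (Fin 2)} {v : List (Fin 4)} (h : w.length = v.length)
    {v' : List (Fin 4)} (hv' : v'.length = w.length + 1) {m : Fin 3}
    (hm : m ≠ if s = 0 then 0 else 2) {z : ℂ} (hz : z ∈ S.I m (w ++ [α]) v') :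
    9 * S.ε w.length < |(S.hub s α w v).re - z.re| := by
  have hl : (w ++ [α]).length = v'.length := by simp [hv']
  obtain ⟨p1, p2, p3⟩ := S.position₁ (w ++ [α]) v' hl
  obtain ⟨p4, p5, p6, p7, p8⟩ := S.position₂ (w ++ [α]) v' hl
  obtain ⟨p9, p10, p11⟩ := S.position₃ (w ++ [α]) v' hl
  have hs := S.hub_side s α h
  have hlen : (w ++ [α]).length = w.length + 1 := by simp
  -- The hub is outside the projection of Q_{wα}, and the squares of the next generation are 10 ε_k
  -- inside it. The segments in question lie beyond one of these squares.
  have e0 := S.ε_small w.length (w ++ [α]) 0 hlen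
  have e1 := S.ε_small w.length (w ++ [α]) 1 hlen
  have hlen2 : (w ++ [α]).length + 1 = w.length + 2 := by simp
  rw [hlen2] at p2 p3 p4 p5 p7 p8 p9 p10
  have f0 := abs_le.1 (le_refl |S.x (w ++ [α] ++ [0]) - S.x (w ++ [α])|)
  have f1 := abs_le.1 (le_refl |S.x (w ++ [α] ++ [1]) - S.x (w ++ [α])|)
  have hR := S.R_pos (w.length + 2)
  have hε := S.ε_pos w.length
  have b1 := fun (hz : z ∈ S.I 0 (w ++ [α]) v') =>
    re_bounds_of_mem_segment (l := (S.a 0 (w ++ [α]) v').re)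
      (h := (S.b 0 (w ++ [α]) v').re) hz ⟨le_rfl, p1.le⟩ ⟨p1.le, le_rfl⟩
  have b2 := fun (hz : z ∈ S.I 1 (w ++ [α]) v') =>
    re_bounds_of_mem_segment (l := (S.a 1 (w ++ [α]) v').re)
      (h := (S.b 1 (w ++ [α]) v').re) hz ⟨le_rfl, p6.le⟩ ⟨p6.le, le_rfl⟩
  have b3 := fun (hz : z ∈ S.I 2 (w ++ [α]) v') =>
    re_bounds_of_mem_segment (l := (S.a 2 (w ++ [α]) v').re)
      (h := (S.b 2 (w ++ [α]) v').re) hz ⟨le_rfl, p11.le⟩ ⟨p11.le, le_rfl⟩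
  rw [lt_abs]
  obtain rfl | rfl : s = 0 ∨ s = 1 := by fin_cases s <;> simp
  · right
    have hs := hs.1 rfl
    fin_cases m
    · simp at hm
    · have := b2 hz; linarith
    · have := b3 hz; linarith
  · left
    have hs := hs.2 rfl
    fin_cases m
    · have := b1 hz; linarith
    · have := b2 hz; linarith
    · simp at hm

/-- The far endpoint of the children of a hub. -/
lemma hub_far_end (s α : Fin 2) {w : List (Fin 2)} {v : List (Fin 4)} (h : w.length = v.length)
    {v' : List (Fin 4)} (hv' : v'.length = w.length + 1) :
    9 * S.ε w.length < |(S.hub s α w v).re -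
      (if s = 0 then S.b 0 (w ++ [α]) v' else S.a 2 (w ++ [α]) v').re| := by
  have hl : (w ++ [α]).length = v'.length := by simp [hv']
  obtain ⟨p1, p2, p3⟩ := S.position₁ (w ++ [α]) v' hl
  obtain ⟨p9, p10, p11⟩ := S.position₃ (w ++ [α]) v' hl
  have hs := S.hub_side s α h
  have hlen : (w ++ [α]).length = w.length + 1 := by simp
  have e0 := S.ε_small w.length (w ++ [α]) 0 hlen
  have e1 := S.ε_small w.length (w ++ [α]) 1 hlen
  have hlen2 : (w ++ [α]).length + 1 = w.length + 2 := by simp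
  rw [hlen2] at p2 p3 p9 p10
  have f0 := abs_le.1 (le_refl |S.x (w ++ [α] ++ [0]) - S.x (w ++ [α])|)
  have f1 := abs_le.1 (le_refl |S.x (w ++ [α] ++ [1]) - S.x (w ++ [α])|)
  have hR := S.R_pos (w.length + 2)
  have hε := S.ε_pos w.length
  have hε' := S.ε_anti (show w.length ≤ w.length + 2 by omega)
  rw [lt_abs]
  obtain rfl | rfl : s = 0 ∨ s = 1 := by fin_cases s <;> simp
  · right
    have hs := hs.1 rfl
    simp only [if_true]
    linarith
  · left
    have hs := hs.2 rfl
    simp only [one_ne_zero, if_false]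
    linarith

end Segments
end CantorExample

namespace CantorExample

/-! ### The pairs of arcs around a hub -/

/-- The parent meets the circle only in direction u, so one end of the arc is there. The sign σ
records whether it is the initial or the final angle. -/
lemma exists_arcDir_of_openArc {c u : ℂ} {r θ₁ θ₂ : ℝ} (hr : 0 < r) {P T : Set ℂ}
    (hP : ∀ p ∈ P, ‖p - c‖ = r → p = c + (r : ℂ) * u) (h12 : θ₁ < θ₂) (h21 : θ₂ < θ₁ + 2 * Real.pi)
    (h : (circleMap c r θ₁ ∈ P ∧ circleMap c r θ₂ ∈ T) ∨
      (circleMap c r θ₁ ∈ T ∧ circleMap c r θ₂ ∈ P)) :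
    ∃ σ a : ℝ, (σ = 1 ∨ σ = -1) ∧ (0 < a ∧ a < 2 * Real.pi) ∧ c + (r : ℂ) * u ∈ P ∧
      c + (r : ℂ) * (u * Complex.exp ((σ * a : ℝ) * Complex.I)) ∈ T ∧
      ∀ d ∈ arcDir u σ a, c + (r : ℂ) * d ∈ openArc c r θ₁ θ₂ := by
  have hr0 : (r : ℂ) ≠ 0 := by exact_mod_cast hr.ne'
  have hn : ∀ θ : ℝ, ‖circleMap c r θ - c‖ = r := fun θ => by
    simp [circleMap, abs_of_pos hr]
  have hexp : ∀ θ : ℝ, circleMap c r θ ∈ P → u = Complex.exp (θ * Complex.I) := by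
    intro θ hθ
    have h1 := hP _ hθ (hn θ)
    rw [circleMap] at h1
    exact (mul_left_cancel₀ hr0 (add_left_cancel h1)).symm
  have hmul : ∀ θ σ s : ℝ, u = Complex.exp (θ * Complex.I) →
      c + (r : ℂ) * (u * Complex.exp ((σ * s : ℝ) * Complex.I)) = circleMap c r (θ + σ * s) := by
    intro θ σ s hu
    rw [circleMap, hu, ← Complex.exp_add]
    congr 3
    push_cast; ring
  rcases h with ⟨h1, h2⟩ | ⟨h2, h1⟩
  · have hu1 := hexp _ h1
    refine ⟨1, θ₂ - θ₁, Or.inl rfl, ⟨by linarith, by linarith⟩, ?_, ?_, ?_⟩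
    · rw [← hP _ h1 (hn _)]; exact h1
    · rw [hmul _ _ _ hu1]; convert h2 using 2; ring
    · rintro d ⟨s, hs, rfl⟩
      simp only
      rw [hmul _ _ _ hu1]
      exact ⟨_, ⟨by linarith [hs.1], by linarith [hs.2]⟩, rfl⟩
  · have hu1 := hexp _ h1
    refine ⟨-1, θ₂ - θ₁, Or.inr rfl, ⟨by linarith, by linarith⟩, ?_, ?_, ?_⟩
    · rw [← hP _ h1 (hn _)]; exact h1
    · rw [hmul _ _ _ hu1]; convert h2 using 2; ring
    · rintro d ⟨s, hs, rfl⟩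
      simp only
      rw [hmul _ _ _ hu1]
      exact ⟨_, ⟨by linarith [hs.2], by linarith [hs.1]⟩, rfl⟩

/-- The two letters `β` which share the same radii. -/
def pairLetter (κ i : Fin 2) : Fin 4 := ⟨2 * κ.val + i.val, by omega⟩

lemma pairLetter_injective (κ : Fin 2) : Function.Injective (pairLetter κ) := by
  intro i i' h
  simp only [pairLetter, Fin.mk.injEq] at h
  exact Fin.ext (by omega)

lemma exists_pairLetter (β : Fin 4) : ∃ κ i, pairLetter κ i = β := by
  refine ⟨⟨β.val / 2, by omega⟩, ⟨β.val % 2, by omega⟩, Fin.ext ?_⟩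
  simp only [pairLetter]; omega

/-- The index `m` of the segments which are the ends of the arcs on side `s`. -/
def endIndex (s : Fin 2) : Fin 3 := if s = 0 then 0 else 2

namespace Segments

variable (S : Segments)

/-- The inner radius of the annulus filled by the arcs of the pair `κ` of generation `k + 1`. -/
def innerRadius (κ : Fin 2) (k : ℕ) : ℝ :=
  if κ = 0 then S.ε (k + 1) else Real.sqrt (S.ε k * S.ε (k + 1))

/-- The outer radius of the annulus filled by the arcs of the pair `κ` of generation `k + 1`. -/
def outerRadius (κ : Fin 2) (k : ℕ) : ℝ :=
  if κ = 0 then Real.sqrt (S.ε k * S.ε (k + 1)) else S.ε k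

/-- The ratio ε_k / ε_{k+1} exceeds 2.7, and the geometric mean splits it into two equal factors
larger than 1.6. -/
lemma radii (κ : Fin 2) (k : ℕ) : S.ε (k + 1) ≤ S.innerRadius κ k ∧
    1.6 * S.innerRadius κ k < S.outerRadius κ k ∧ S.outerRadius κ k ≤ S.ε k := by
  have h := S.ε_succ_le k
  have h0 := S.ε_pos k
  have h1 := S.ε_pos (k + 1)
  have hs := Real.mul_self_sqrt (mul_pos h0 h1).le
  have hs0 := Real.sqrt_nonneg (S.ε k * S.ε (k + 1))
  set q := Real.sqrt (S.ε k * S.ε (k + 1))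
  have hq1 : 1.6 * S.ε (k + 1) < q := by nlinarith
  have hq2 : 1.6 * q < S.ε k := by nlinarith
  unfold innerRadius outerRadius
  split_ifs
  · exact ⟨le_rfl, hq1, by linarith⟩
  · exact ⟨by linarith, hq2, le_rfl⟩

/-- The segments of generation at most `k`. -/
def segmentsUpTo (k : ℕ) : Set ℂ := {z | ∃ m w v, w.length = v.length ∧ w.length ≤ k ∧ z ∈ S.I m w v}

lemma dirFrom_of_mem_segment {c e p : ℂ} {r : ℝ} (hr : 0 < r) (hp : p ∈ segment ℝ c e)
    (hpr : ‖p - c‖ = r) : p = c + (r : ℂ) * dirFrom c e := by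
  rw [segment_eq_image'] at hp
  obtain ⟨τ, hτ, rfl⟩ := hp
  have h1 : ‖τ • (e - c)‖ = r := by simpa using hpr
  rw [norm_smul, Real.norm_of_nonneg hτ.1] at h1
  have hne : ‖e - c‖ ≠ 0 := by rintro h; rw [h, mul_zero] at h1; exact hr.ne h1
  have hne' : ((‖e - c‖ : ℝ) : ℂ) ≠ 0 := by exact_mod_cast hne
  simp only [Complex.real_smul]
  rw [dirFrom, ← h1]
  push_cast
  field_simp

/-- The parent is a segment issuing from the hub, so it meets each circle about the hub at most once
and always in the same direction. -/
lemma exists_direction (s α : Fin 2) {w : List (Fin 2)} {v : List (Fin 4)}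
    (h : w.length = v.length) : ∃ u : ℂ, ‖u‖ = 1 ∧ ∀ r : ℝ, 0 < r →
      ∀ p ∈ S.I (hubIndex s α) w v, ‖p - S.hub s α w v‖ = r → p = S.hub s α w v + (r : ℂ) * u := by
  have hne : ∀ m, S.a m w v ≠ S.b m w v := by
    intro m heq
    have p1 := S.position₁ w v h
    have p2 := S.position₂ w v h
    have p3 := S.position₃ w v h
    have := congrArg Complex.re heq
    fin_cases m
    · exact absurd this p1.1.ne
    · exact absurd this p2.2.2.1.ne
    · exact absurd this p3.2.2.ne
  unfold hub hubIndex I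
  split_ifs
  · refine ⟨dirFrom (S.b α.castSucc w v) (S.a α.castSucc w v), norm_dirFrom (hne _), ?_⟩
    intro r hr p hp hpr
    rw [segment_symm] at hp
    exact dirFrom_of_mem_segment hr hp hpr
  · refine ⟨dirFrom (S.a α.succ w v) (S.b α.succ w v), norm_dirFrom (hne _).symm, ?_⟩
    intro r hr p hp hpr
    exact dirFrom_of_mem_segment hr hp hpr

/-- The letters 2κ and 2κ + 1 share an annulus, so at each of its radii two arcs leave the parent.
This pairing is what allows the comparison of arcs of different radii. -/
lemma exists_arcPair (s α κ : Fin 2) {w : List (Fin 2)} {v : List (Fin 4)}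
    (h : w.length = v.length) : ∃ u σ a, ArcPair (S.hub s α w v) u (S.innerRadius κ w.length)
      (S.outerRadius κ w.length) (S.I (hubIndex s α) w v) (S.segmentsUpTo (w.length + 1))
      (fun i => S.I (endIndex s) (w ++ [α]) (v ++ [pairLetter κ i])) σ a := by
  obtain ⟨u, hu, hdir⟩ := S.exists_direction s α h
  have hri : 0 < S.innerRadius κ w.length := (S.ε_pos _).trans_le (S.radii κ _).1
  set ix : Fin 2 → ArcIndex := fun i => ⟨s, w, v, α, pairLetter κ i⟩ with hix
  have hix_inj : ix 0 ≠ ix 1 := by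
    intro h
    have := congrArg ArcIndex.β h
    exact absurd (pairLetter_injective κ this) (by simp)
  have hcenter : ∀ i, (ix i).center S.a S.b = S.hub s α w v := fun i => rfl
  have hparent : ∀ i, (ix i).parent S.a S.b = S.I (hubIndex s α) w v := by
    intro i; simp only [ArcIndex.parent, hix, hubIndex, I]; split_ifs <;> rfl
  have hchild : ∀ i, (ix i).child S.a S.b =
      S.I (endIndex s) (w ++ [α]) (v ++ [pairLetter κ i]) := by
    intro i; simp only [ArcIndex.child, hix, endIndex, I]; split_ifs <;> rfl
  have hactive : ∀ i, ∀ r ∈ Ioo (S.innerRadius κ w.length) (S.outerRadius κ w.length),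
      (ix i).IsActive S.ε r := by
    intro i r hr
    refine ⟨h, ?_⟩
    have hβ : ((ix i).β.val < 2) ↔ κ = 0 := by
      simp only [hix, pairLetter]
      constructor
      · intro hlt; apply Fin.ext; simp only [Fin.val_zero]; omega
      · rintro rfl; simp only [Fin.val_zero]; omega
    simp only [ArcIndex.rInner, ArcIndex.rOuter, hβ]
    simp only [innerRadius, outerRadius, h] at hr
    exact hr
  -- Signs and lengths are chosen for each radius separately, without any regularity in r. Outside
  -- the annulus the value is a dummy zero.
  have main : ∀ r, ∃ σ a : Fin 2 → ℝ, r ∈ Ioo (S.innerRadius κ w.length) (S.outerRadius κ w.length) →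
      (∀ i, (σ i = 1 ∨ σ i = -1) ∧ (0 < a i ∧ a i < 2 * Real.pi) ∧
        S.hub s α w v + (r : ℂ) * u ∈ S.I (hubIndex s α) w v ∧
        S.hub s α w v + (r : ℂ) * (u * Complex.exp ((σ i * a i : ℝ) * Complex.I)) ∈
          S.I (endIndex s) (w ++ [α]) (v ++ [pairLetter κ i]) ∧
        ∀ d ∈ arcDir u (σ i) (a i), S.hub s α w v + (r : ℂ) * d ∉ S.segmentsUpTo (w.length + 1)) ∧
      Disjoint (arcDir u (σ 0) (a 0)) (arcDir u (σ 1) (a 1)) := by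
    intro r
    by_cases hr : r ∈ Ioo (S.innerRadius κ w.length) (S.outerRadius κ w.length)
    swap
    · exact ⟨fun _ => 0, fun _ => 0, fun h => absurd h hr⟩
    have hr0 : 0 < r := hri.trans hr.1
    obtain ⟨θ₁, θ₂, hθ, hdisj⟩ := S.arcs r
    have hex : ∀ i, ∃ σ a : ℝ, (σ = 1 ∨ σ = -1) ∧ (0 < a ∧ a < 2 * Real.pi) ∧
        S.hub s α w v + (r : ℂ) * u ∈ S.I (hubIndex s α) w v ∧
        S.hub s α w v + (r : ℂ) * (u * Complex.exp ((σ * a : ℝ) * Complex.I)) ∈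
          S.I (endIndex s) (w ++ [α]) (v ++ [pairLetter κ i]) ∧
        ∀ d ∈ arcDir u σ a, S.hub s α w v + (r : ℂ) * d ∈
          openArc (S.hub s α w v) r (θ₁ (ix i)) (θ₂ (ix i)) := by
      intro i
      obtain ⟨h1, h2, h3, h4⟩ := hθ (ix i) (hactive i r hr)
      rw [hcenter, hparent, hchild] at h3
      exact exists_arcDir_of_openArc hr0 (fun p hp hpr => hdir r hr0 p hp hpr) h1 h2 h3
    choose σ a h1 h2 h3 h4 h5 using hex
    refine ⟨σ, a, fun _ => ⟨fun i => ⟨h1 i, h2 i, h3 i, h4 i, ?_⟩, ?_⟩⟩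
    · rintro d hd ⟨m, w', v', hl, hle, hmem⟩
      have := (hθ (ix i) (hactive i r hr)).2.2.2 m w' v' hl hle
      exact Set.disjoint_left.1 this (h5 i d hd) hmem
    · rw [Set.disjoint_left]
      intro d hd0 hd1
      exact Set.disjoint_left.1 (hdisj (ix 0) (ix 1) (hactive 0 r hr) (hactive 1 r hr) hix_inj)
        (h5 0 d hd0) (h5 1 d hd1)
  choose σ a hσa using main
  refine ⟨u, fun i r => σ r i, fun i r => a r i, hu, hri.le, ?_, ?_, ?_, ?_, ?_, ?_, ?_, ?_⟩
  · exact fun i r hr => ((hσa r hr).1 i).1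
  · exact fun i r hr => ((hσa r hr).1 i).2.1
  · exact fun r hr => ((hσa r hr).1 0).2.2.1
  · exact fun i r hr => ((hσa r hr).1 i).2.2.2.1
  · exact fun r hr => (hσa r hr).2
  · exact fun i r hr => ((hσa r hr).1 i).2.2.2.2
  · exact fun i x hx => ⟨_, _, _, by simp [h], by simp, hx⟩
  · intro i
    refine S.disjoint_I h (by simp [h]) ?_
    intro heq
    have := congrArg (fun x : Fin 3 × List (Fin 2) × List (Fin 4) => x.2.1.length) heq
    simp at this

/-- The endpoint near the hub of the segment at the end of the arcs on side `s`. -/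
def nearEnd (s : Fin 2) (w : List (Fin 2)) (v : List (Fin 4)) : ℂ :=
  if s = 0 then S.a 0 w v else S.b 2 w v

/-- The radii for which the arcs of the pair avoid all components except the ones at their ends. -/
def goodRadii (s α κ : Fin 2) (w : List (Fin 2)) (v : List (Fin 4)) : Set ℝ :=
  {r | r ∈ Ioo (S.innerRadius κ w.length + S.ε (w.length + 2) / 50)
      (S.outerRadius κ w.length - S.ε (w.length + 2) / 50) ∧
    ∀ i, ‖S.nearEnd s (w ++ [α]) (v ++ [pairLetter κ i]) - S.hub s α w v‖ ∉
      Ico (r - S.ε (w.length + 2) / 50) r}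

/-- The far endpoint of the child is outside the ball of radius ε_k about the hub. A good radius
keeps the distance of the near endpoint out of [r - η, r) for η = ε_{k+2}/50, so that endpoint is
either beyond the circle of radius r or inside that of radius r', as `continues_segment` needs. -/
lemma continues_end (s α κ : Fin 2) {w : List (Fin 2)} {v : List (Fin 4)} (h : w.length = v.length)
    {u : ℂ} {σ a : Fin 2 → ℝ → ℝ} (H : ArcPair (S.hub s α w v) u (S.innerRadius κ w.length)
      (S.outerRadius κ w.length) (S.I (hubIndex s α) w v) (S.segmentsUpTo (w.length + 1))
      (fun i => S.I (endIndex s) (w ++ [α]) (v ++ [pairLetter κ i])) σ a)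
    {r : ℝ} (hr : r ∈ S.goodRadii s α κ w v) (i : Fin 2) {r' : ℝ}
    (hr' : |r - r'| ≤ S.ε (w.length + 2) / 50) :
    ArcPair.Continues (S.hub s α w v) (S.I (endIndex s) (w ++ [α]) (v ++ [pairLetter κ i])) r' r := by
  have hε := S.ε_pos (w.length + 2)
  have hr1 : r ∈ Ioo (S.innerRadius κ w.length) (S.outerRadius κ w.length) :=
    ⟨by linarith [hr.1.1], by linarith [hr.1.2]⟩
  have hr0 : 0 < r := H.ri_nonneg.trans_lt hr1.1
  have hex : ∃ x ∈ S.I (endIndex s) (w ++ [α]) (v ++ [pairLetter κ i]),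
      ‖x - S.hub s α w v‖ = r :=
    ⟨_, H.end_mem i r hr1, norm_add_mul_sub hr0.le (norm_mul_exp H.norm_u _)⟩
  have hfar := S.hub_far_end s α h (v' := v ++ [pairLetter κ i]) (by simp [h])
  have hF : r ≤ ‖(if s = 0 then S.b 0 (w ++ [α]) (v ++ [pairLetter κ i]) else
      S.a 2 (w ++ [α]) (v ++ [pairLetter κ i])) - S.hub s α w v‖ := by
    rw [norm_sub_rev]
    refine le_trans ?_ (Complex.abs_re_le_norm _)
    rw [Complex.sub_re]
    linarith [hr1.2, (S.radii κ w.length).2.2, S.ε_pos w.length]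
  have hN : r ≤ ‖S.nearEnd s (w ++ [α]) (v ++ [pairLetter κ i]) - S.hub s α w v‖ ∨
      ‖S.nearEnd s (w ++ [α]) (v ++ [pairLetter κ i]) - S.hub s α w v‖ < r' := by
    by_contra hcon
    push Not at hcon
    exact hr.2 i ⟨by linarith [(abs_le.1 hr').2, hcon.2], hcon.1⟩
  unfold nearEnd at hN
  unfold endIndex I at *
  split_ifs at * with hs
  · exact ArcPair.continues_segment hex hF hN
  · rw [segment_symm] at *
    exact ArcPair.continues_segment hex hF hN

lemma mem_rest {E : Set ℂ} {m w v} (h : w.length = v.length) {x : ℂ} (hx : x ∈ S.I m w v)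
    (hE : Disjoint (S.I m w v) E) : x ∈ S.rest E := by
  refine ⟨?_, Set.disjoint_left.1 hE hx⟩
  simp only [domain, mem_compl_iff, not_not]
  refine ⟨x, Or.inr ?_, rfl⟩
  simp only [mem_iUnion]
  exact ⟨m, w, v, h, hx⟩

/-- The factor 1/100 leaves room to pass to the closure and to replace the distance to E by the
distance to a point of E, at the price of 1/50. Positivity of the width comes from nonemptiness of
the neighbourhood. -/
lemma exists_close_of_mem_closure_nbhd {E : Set ℂ} (hE : E.Nonempty) {k : ℕ} {z : ℂ}
    (hz : z ∈ closure (S.nbhd k E)) : ∃ y ∈ E, ∃ η, dist z y ≤ η ∧ η ≤ S.ε (k + 1) / 50 ∧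
      ∀ y' ∈ E, ∀ x ∈ S.rest E, η < dist x y' := by
  set δ := min (S.ε (k + 1)) (sInf (image2 dist E (S.rest E))) with hδ
  have hne : (S.nbhd k E).Nonempty := by
    rw [← closure_nonempty_iff]; exact ⟨z, hz⟩
  have hpos : 0 < δ := by
    obtain ⟨x, hx⟩ := hne
    have h1 : Metric.infDist x E < δ / 100 := hx
    linarith [Metric.infDist_nonneg (x := x) (s := E)]
  have hle : Metric.infDist z E ≤ δ / 100 := by
    have hcl : IsClosed {x | Metric.infDist x E ≤ δ / 100} :=
      isClosed_le (Metric.continuous_infDist_pt E) continuous_const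
    exact closure_minimal (fun x hx => le_of_lt (show Metric.infDist x E < δ / 100 from hx)) hcl hz
  obtain ⟨y, hy, hzy⟩ := (Metric.infDist_lt_iff hE (x := z) (r := δ / 50)).1 (by linarith)
  refine ⟨y, hy, δ / 50, hzy.le, by linarith [min_le_left (S.ε (k + 1)) (sInf (image2 dist E (S.rest E)))],
    fun y' hy' x hx => ?_⟩
  have h1 : sInf (image2 dist E (S.rest E)) ≤ dist y' x := by
    refine csInf_le ⟨0, ?_⟩ ⟨y', hy', x, hx, rfl⟩
    rintro _ ⟨_, _, _, _, rfl⟩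
    exact dist_nonneg
  rw [dist_comm] at h1
  linarith [min_le_right (S.ε (k + 1)) (sInf (image2 dist E (S.rest E)))]

end Segments
end CantorExample

/-! ### Good arcs and the thickened components -/

namespace CantorExample
namespace Exhaustion

variable (E : Exhaustion)

lemma closure_Um_subset_U {m w v j} (h : w.length = v.length) (hj : w.length + 1 ≤ j) :
    closure (E.Um m j w v) ⊆ closure (E.U w v) := by
  induction j, hj using Nat.le_induction with
  | base => rw [E.Um_first m w v h]
  | succ j hj ih =>
    exact ((E.Um_subset m w v j h hj).trans inter_subset_left).trans (subset_closure.trans ih)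

lemma closure_Um_subset_collar {m w v j} (h : w.length = v.length) (hj : w.length + 1 ≤ j) :
    closure (E.Um m j w v) ⊆ E.collar w :=
  (E.closure_Um_subset_U h hj).trans (E.U_subset w v h)

lemma closure_Um_subset_Q {m w v j} (h : w.length = v.length) (hj : w.length + 1 ≤ j) :
    closure (E.Um m j w v) ⊆ E.Q w :=
  (E.closure_Um_subset_collar h hj).trans (E.collar_subset_Q w)

lemma closure_Um_subset_nbhd {m w v j} (h : w.length = v.length) (hj : w.length + 2 ≤ j) :
    closure (E.Um m j w v) ⊆ E.nbhd j (E.I m w v) := by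
  obtain ⟨j, rfl⟩ : ∃ i, j = i + 1 := ⟨j - 1, by omega⟩
  exact (E.Um_subset m w v j h (by omega)).trans inter_subset_right

lemma I_subset_triple (m w v) : E.I m w v ⊆ E.triple w v :=
  subset_iUnion (fun m => E.I m w v) m

lemma I_subset_Um {m w v j} (h : w.length = v.length) (hj : w.length + 1 ≤ j) :
    E.I m w v ⊆ E.Um m j w v := by
  rcases (show j = w.length + 1 ∨ w.length + 2 ≤ j by omega) with rfl | h2
  · rw [E.Um_first m w v h]
    exact (E.I_subset_triple m w v).trans (E.triple_subset w v h)
  · exact E.segment_subset_Um m w v j h h2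

lemma I_nonempty (m w v) : (E.I m w v).Nonempty := ⟨_, left_mem_segment ℝ _ _⟩

lemma isPreconnected_Um {m w v j} (h : w.length = v.length) (hj : w.length + 1 ≤ j) :
    IsPreconnected (E.Um m j w v) := by
  rcases (show j = w.length + 1 ∨ w.length + 2 ≤ j by omega) with rfl | h2
  · rw [E.Um_first m w v h]
    exact (E.U_jordan w v h).2.1.isPreconnected
  · exact (E.Um_jordan m w v j h h2).2.1.isPreconnected

lemma disjoint_closure_U {w v w' v'} (h : w.length = v.length) (h' : w'.length = v'.length)
    (hne : (w, v) ≠ (w', v')) : Disjoint (closure (E.U w v)) (closure (E.U w' v')) := by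
  by_cases hw : w = w'
  · subst hw
    exact E.U_disjoint w v v' h h' (fun hv => hne (by rw [hv]))
  · exact (E.disjoint_collar hw).mono (E.U_subset w v h) (E.U_subset w' v' h')

lemma disjoint_I_triple {m w v w' v'} (h : w.length = v.length) (h' : w'.length = v'.length)
    (hne : (w, v) ≠ (w', v')) : Disjoint (E.I m w v) (E.triple w' v') := by
  rw [Segments.triple, disjoint_iUnion_right]
  intro m'
  refine E.disjoint_I h h' fun heq => hne ?_
  simp only [Prod.mk.injEq] at heq
  rw [heq.2.1, heq.2.2]

/-- A good arc meets only the components at its ends. -/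
lemma arc_avoids_components (s α κ β : Fin 2) {w : List (Fin 2)} {v : List (Fin 4)}
    (h : w.length = v.length) {u : ℂ} {σ a : Fin 2 → ℝ → ℝ}
    (H : ArcPair (E.hub s α w v) u (E.innerRadius κ w.length)
      (E.outerRadius κ w.length) (E.I (hubIndex s α) w v) (E.segmentsUpTo (w.length + 1))
      (fun i => E.I (endIndex s) (w ++ [α]) (v ++ [pairLetter κ i])) σ a)
    {r : ℝ} (hr : r ∈ E.goodRadii s α κ w v) {j : ℕ} (hj : w.length + 2 ≤ j) {z : ℂ}
    (hzr : ‖z - E.hub s α w v‖ = r) (hz : dirFrom (E.hub s α w v) z ∈ arcDir u (σ β r) (a β r))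
    {m : Fin 3} {w' : List (Fin 2)} {v' : List (Fin 4)} (h' : w'.length = v'.length)
    (hw'j : w'.length < j) (hzU : z ∈ closure (E.Um m j w' v')) :
    z ∈ closure (E.Um (hubIndex s α) j w v) ∨
      z ∈ closure (E.Um (endIndex s) j (w ++ [α]) (v ++ [pairLetter κ β])) := by
  by_contra hcon
  rw [not_or] at hcon
  obtain ⟨hcon1, hcon2⟩ := hcon
  have hε := E.ε_pos (w.length + 2)
  have hε0 := E.ε_pos w.length
  have hεle : E.ε (w.length + 2) ≤ E.ε w.length := E.ε_anti (by omega)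
  have hlt : (w ++ [α]).length = w.length + 1 := by simp
  have hl : ∀ i, (w ++ [α]).length = (v ++ [pairLetter κ i]).length := by simp [h]
  have hrε : r < E.ε w.length := by linarith [hr.1.2, (E.radii κ w.length).2.2]
  -- horizontal distances
  have hnear : ∀ y : ℂ, dist z y ≤ E.ε (w.length + 2) / 50 →
      |(E.hub s α w v).re - y.re| < 2 * E.ε w.length := by
    intro y hy
    have h1 : |(E.hub s α w v).re - y.re| ≤ dist (E.hub s α w v) y := by
      rw [dist_eq_norm, ← Complex.sub_re]; exact Complex.abs_re_le_norm _
    have h2 : dist (E.hub s α w v) z = r := by rw [dist_comm, dist_eq_norm, hzr]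
    linarith [dist_triangle (E.hub s α w v) z y]
  have hcont := fun i r' (hr' : |r - r'| ≤ E.ε (w.length + 2) / 50) =>
    E.continues_end s α κ h H hr i hr'
  -- the two uses of the avoidance lemmas
  have hother : ∀ (F : Set ℂ) (y : ℂ) (η : ℝ) (m' : Fin 3), y ∈ F → y ∈ E.I m' w' v' →
      w'.length ≤ w.length + 1 → dist z y ≤ η → η ≤ E.ε (w.length + 2) / 50 →
      (∀ y' ∈ F, ∀ x ∈ E.rest F, η < dist x y') →
      Disjoint (E.I (hubIndex s α) w v) F →
      (∀ i, Disjoint (E.I (endIndex s) (w ++ [α]) (v ++ [pairLetter κ i])) F) → False := by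
    intro F y η m' hyF hy hw' hzy hη hF hdP hdt
    refine H.not_close (η := η) (β := β) ⟨by linarith [hr.1.1], by linarith [hr.1.2]⟩ hzr hz
      ⟨m', w', v', h', hw', hy⟩ hzy (fun i r' hr' => hcont i r' (hr'.trans hη)) ?_ ?_
    · exact fun x hx => hF y hyF x (E.mem_rest h hx hdP)
    · exact fun i x hx => hF y hyF x (E.mem_rest (hl i) hx (hdt i))
  have hsame : ∀ (F : Set ℂ) (y : ℂ) (η : ℝ) (γ : Fin 2),
      y ∈ E.I (endIndex s) (w ++ [α]) (v ++ [pairLetter κ γ]) →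
      E.I (endIndex s) (w ++ [α]) (v ++ [pairLetter κ γ]) ⊆ F →
      dist z y ≤ η → η ≤ E.ε (w.length + 2) / 50 →
      (∀ y' ∈ F, ∀ x ∈ E.rest F, η < dist x y') →
      Disjoint (E.I (hubIndex s α) w v) F →
      Disjoint (E.I (endIndex s) (w ++ [α]) (v ++ [pairLetter κ β])) F → False := by
    intro F y η γ hy hsub hzy hη hF hdP hdt
    refine H.not_close_other (η := η) (β := β) (γ := γ)
      ⟨by linarith [hr.1.1], by linarith [hr.1.2]⟩ hzr hz
      hy hzy (fun i r' hr' => hcont i r' (hr'.trans hη)) ?_ ?_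
    · exact fun x hx y' hy' => hF y' (hsub hy') x (E.mem_rest h hx hdP)
    · exact fun x hx y' hy' => hF y' (hsub hy') x (E.mem_rest (hl β) hx hdt)
  have hidx : ∀ i, (w, v) ≠ (w ++ [α], v ++ [pairLetter κ i]) := by
    intro i heq
    have := congrArg (fun x : List (Fin 2) × List (Fin 4) => x.1.length) heq
    simp at this
  have hwne : ∀ {x y : List (Fin 2)}, x.length ≠ y.length → x ≠ y := by
    rintro x y hxy rfl; exact hxy rfl
  -- In the first case the component is a thin neighbourhood of a single segment. In the second it
  -- is the whole closure of U(w',v'), which is known to be thin only inside balls of earlier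
  -- generations.
  rcases (show w'.length + 2 ≤ j ∨ j = w'.length + 1 by omega) with hj' | hj'
  · rcases (show w.length + 2 ≤ w'.length ∨ w'.length ≤ w.length + 1 by omega) with hg | hg
    · have h1 := E.far_of_mem_Q h (E.hub_mem_I s α w v) hg (E.closure_Um_subset_Q h' (by omega) hzU)
      linarith [hnear z (by rw [dist_self]; positivity)]
    obtain ⟨y, hy, η, hzy, hη, hF⟩ := E.exists_close_of_mem_closure_nbhd (E.I_nonempty m w' v')
      (subset_closure (E.closure_Um_subset_nbhd h' hj' hzU))
    have hη' : η ≤ E.ε (w.length + 2) / 50 := by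
      have : E.ε (j + 1) ≤ E.ε (w.length + 2) := E.ε_anti (by omega)
      linarith
    by_cases hlow : w'.length < w.length
    · obtain ⟨k, hk⟩ : ∃ k, w.length = k + 1 := ⟨w.length - 1, by omega⟩
      have h1 := E.hub_far_earlier s α h hk h' hlow hy
      have h2 := hnear y (hzy.trans hη')
      have h3 : E.ε w.length ≤ E.ε k := E.ε_anti (by omega)
      linarith [E.ε_pos k]
    have hneP : (hubIndex s α, w, v) ≠ (m, w', v') := by
      intro heq
      simp only [Prod.mk.injEq] at heq
      obtain ⟨rfl, rfl, rfl⟩ := heq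
      exact hcon1 hzU
    by_cases hend : ∃ γ, (endIndex s, w ++ [α], v ++ [pairLetter κ γ]) = (m, w', v')
    · obtain ⟨γ, hγ⟩ := hend
      simp only [Prod.mk.injEq] at hγ
      obtain ⟨rfl, rfl, rfl⟩ := hγ
      have hγβ : γ ≠ β := by rintro rfl; exact hcon2 hzU
      refine hsame _ y η γ hy Subset.rfl hzy hη' hF (E.disjoint_I h h' hneP)
        (E.disjoint_I (hl β) h' ?_)
      intro heq
      simp only [Prod.mk.injEq, true_and, List.append_cancel_left_eq, List.cons.injEq,
        and_true] at heq
      exact hγβ (pairLetter_injective κ heq).symm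
    · push Not at hend
      exact hother _ y η m hy hy hg hzy hη' hF (E.disjoint_I h h' hneP)
        fun i => E.disjoint_I (hl i) h' (hend i)
  · subst hj'
    rcases (show w.length + 2 ≤ w'.length ∨ w'.length = w.length + 1 by omega) with hg | hg
    · have h1 := E.far_of_mem_Q h (E.hub_mem_I s α w v) hg (E.closure_Um_subset_Q h' (by omega) hzU)
      linarith [hnear z (by rw [dist_self]; positivity)]
    have hzU' : z ∈ closure (E.U w' v') := E.closure_Um_subset_U h' le_rfl hzU
    have hzB : z ∈ Metric.ball (E.hub s α w v) (E.ε w.length) := by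
      rw [Metric.mem_ball, dist_eq_norm, hzr]; exact hrε
    -- The ball is open, so z is a limit of points of U(w',v') inside the ball, where `U_ball`
    -- applies.
    have hzUB : z ∈ closure (E.U w' v' ∩ Metric.ball (E.hub s α w v) (E.ε w.length)) :=
      Metric.isOpen_ball.closure_inter ⟨hzU', hzB⟩
    have hzN : z ∈ closure (E.nbhd w'.length (E.triple w' v')) := by
      rcases E.U_ball w' v' h' w.length (by omega) _ (E.hub_mem_endpoints s α h) with hd | ⟨_, hs⟩
      · rw [hd.inter_eq, closure_empty] at hzUB; exact absurd hzUB (notMem_empty _)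
      · exact closure_mono hs hzUB
    have hne : (E.triple w' v').Nonempty := (E.I_nonempty 0 w' v').mono (E.I_subset_triple 0 w' v')
    obtain ⟨y, hy, η, hzy, hη, hF⟩ := E.exists_close_of_mem_closure_nbhd hne hzN
    rw [hg] at hη
    obtain ⟨m', hym⟩ := mem_iUnion.1 hy
    have hneP : (w, v) ≠ (w', v') := by
      intro heq
      simp only [Prod.mk.injEq] at heq
      rw [heq.1] at hg; omega
    by_cases hend : ∃ γ, (w ++ [α], v ++ [pairLetter κ γ]) = (w', v')
    · obtain ⟨γ, hγ⟩ := hend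
      simp only [Prod.mk.injEq] at hγ
      obtain ⟨rfl, rfl⟩ := hγ
      have hγβ : γ ≠ β := by
        rintro rfl
        rw [E.Um_first _ _ _ h'] at hcon2
        exact hcon2 hzU'
      -- In the triple of the sibling only the segment at the end of the other arc can be near the
      -- hub.
      by_cases hm' : m' = endIndex s
      · subst hm'
        refine hsame _ y η γ hym (E.I_subset_triple _ _ _) hzy hη hF (E.disjoint_I_triple h h' hneP)
          (E.disjoint_I_triple (hl β) h' ?_)
        intro heq
        simp only [Prod.mk.injEq, true_and, List.append_cancel_left_eq, List.cons.injEq,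
          and_true] at heq
        exact hγβ (pairLetter_injective κ heq).symm
      · have h1 := E.hub_far_other s α h (v' := v ++ [pairLetter κ γ]) (by simp [h]) hm' hym
        linarith [hnear y (hzy.trans hη)]
    · push Not at hend
      exact hother _ y η m' hy hym hg.le hzy hη hF (E.disjoint_I_triple h h' hneP)
        fun i => E.disjoint_I_triple (hl i) h' (hend i)

/-- A point near a hub of generation `k` is in no square of generation at least `k + 2`. -/
lemma notMem_Q_of_near_hub (s α : Fin 2) {w : List (Fin 2)} {v : List (Fin 4)}
    (h : w.length = v.length) {z : ℂ} (hz : ‖z - E.hub s α w v‖ < E.ε w.length)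
    {w' : List (Fin 2)} (hw' : w.length + 2 ≤ w'.length) : z ∉ E.Q w' := by
  intro hzQ
  have h1 := E.far_of_mem_Q h (E.hub_mem_I s α w v) hw' hzQ
  have h2 : |(E.hub s α w v).re - z.re| ≤ ‖z - E.hub s α w v‖ := by
    rw [norm_sub_rev, ← Complex.sub_re]; exact Complex.abs_re_le_norm _
  linarith [E.ε_pos w.length]

end Exhaustion
end CantorExample

namespace Transboundary

open MeasureTheory

/-! ### Path integrals along circular arcs -/

lemma norm_circleMap_sub (c : ℂ) {r : ℝ} (hr : 0 ≤ r) (x y : ℝ) :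
    ‖circleMap c r y - circleMap c r x‖ = 2 * r * |Real.sin ((y - x) / 2)| := by
  have h1 : circleMap c r y - circleMap c r x
      = r * Complex.exp (x * Complex.I) * (Complex.exp (Complex.I * ((y - x : ℝ) : ℂ)) - 1) := by
    rw [mul_sub, mul_assoc, ← Complex.exp_add]
    simp only [circleMap]
    have : (x : ℂ) * Complex.I + Complex.I * ((y - x : ℝ) : ℂ) = y * Complex.I := by
      push_cast; ring
    rw [this]; ring
  rw [h1, norm_mul, norm_mul, Complex.norm_exp_ofReal_mul_I, Complex.norm_exp_I_mul_ofReal_sub_one,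
    Complex.norm_real, Real.norm_of_nonneg hr, Real.norm_eq_abs, abs_mul]
  norm_num; ring

/-- The upper bound is the Lipschitz constant. The lower bound comes from inscribed polygons with n
equal chords, each at least r (d/n - (d/n)³). The exact value is needed to identify the natural
parametrization. -/
lemma eVariationOn_circleMap (c : ℂ) {r : ℝ} (hr : 0 ≤ r) {x y : ℝ} (hxy : x ≤ y) :
    eVariationOn (circleMap c r) (Icc x y) = ENNReal.ofReal (r * (y - x)) := by
  apply le_antisymm
  · have h := (lipschitzWith_circleMap c r).lipschitzOnWith (s := univ) |>.comp_eVariationOn_le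
      (g := (id : ℝ → ℝ)) (s := Icc x y) (mapsTo_univ _ _)
    rw [eVariationOn_id_Icc] at h
    refine h.trans ?_
    rw [ENNReal.ofReal_mul hr]
    gcongr
    simp [ENNReal.ofReal, Real.nnabs_of_nonneg hr]
  · rcases eq_or_lt_of_le hxy with rfl | hlt
    · simp
    set d := y - x with hd
    have hd0 : 0 < d := sub_pos.2 hlt
    have key : ∀ n : ℕ, d ≤ n → 0 < n →
        ENNReal.ofReal (r * (d - d ^ 3 / n ^ 2)) ≤ eVariationOn (circleMap c r) (Icc x y) := by
      intro n hn hn0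
      have hn0' : (0 : ℝ) < n := by exact_mod_cast hn0
      set u : ℕ → ℝ := fun i => x + (min i n : ℕ) * (d / n) with hu
      have hmono : Monotone u := by
        intro i i' h
        simp only [hu]
        gcongr
      have hmem : ∀ i, u i ∈ Icc x y := by
        intro i
        have h1 : ((min i n : ℕ) : ℝ) ≤ n := by exact_mod_cast min_le_right i n
        constructor
        · simp only [hu]; have : 0 ≤ ((min i n : ℕ) : ℝ) * (d / n) := by positivity
          linarith
        · simp only [hu]
          have : ((min i n : ℕ) : ℝ) * (d / n) ≤ n * (d / n) := by gcongr
          rw [mul_div_cancel₀ _ hn0'.ne'] at this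
          linarith
      refine le_trans ?_ (eVariationOn.sum_le hmono hmem (n := n))
      have hterm : ∀ i ∈ Finset.range n, ENNReal.ofReal (r * (d / n - (d / n) ^ 3)) ≤
          edist (circleMap c r (u (i + 1))) (circleMap c r (u i)) := by
        intro i hi
        have hi' := Finset.mem_range.1 hi
        have hdiff : u (i + 1) - u i = d / n := by
          simp only [hu, min_eq_left hi'.le, min_eq_left (Nat.succ_le_of_lt hi')]
          push_cast; ring
        rw [edist_dist, dist_eq_norm, norm_circleMap_sub c hr, hdiff]
        apply ENNReal.ofReal_le_ofReal
        have hq0 : 0 < d / n := by positivity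
        have hq1 : d / n ≤ 1 := (div_le_one hn0').2 hn
        have hs := Real.sin_gt_sub_cube (x := d / n / 2) (by linarith)
        have h3 : 2 * ((d / n / 2) - (d / n / 2) ^ 3 / 6) ≤ 2 * |Real.sin (d / n / 2)| := by
          linarith [le_abs_self (Real.sin (d / n / 2))]
        have h4 : d / n - (d / n) ^ 3 ≤ 2 * |Real.sin (d / n / 2)| := by
          have : 0 < (d / n) ^ 3 := by positivity
          nlinarith
        calc r * (d / n - (d / n) ^ 3) ≤ r * (2 * |Real.sin (d / n / 2)|) := by gcongr
          _ = _ := by ring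
      refine le_trans ?_ (Finset.sum_le_sum hterm)
      rw [Finset.sum_const, Finset.card_range, nsmul_eq_mul, ← ENNReal.ofReal_natCast,
        ← ENNReal.ofReal_mul hn0'.le]
      apply ENNReal.ofReal_le_ofReal
      apply le_of_eq
      field_simp
    have hlim : Filter.Tendsto (fun n : ℕ => ENNReal.ofReal (r * (d - d ^ 3 / (n : ℝ) ^ 2)))
        Filter.atTop (nhds (ENNReal.ofReal (r * d))) := by
      apply ENNReal.tendsto_ofReal
      have h1 : Filter.Tendsto (fun n : ℕ => d ^ 3 / (n : ℝ) ^ 2) Filter.atTop (nhds 0) :=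
        Filter.Tendsto.div_atTop tendsto_const_nhds
          ((Filter.tendsto_pow_atTop two_ne_zero).comp tendsto_natCast_atTop_atTop)
      simpa using (h1.const_sub d).const_mul r
    refine le_of_tendsto hlim ?_
    filter_upwards [tendsto_natCast_atTop_atTop.eventually_ge_atTop d, Filter.eventually_gt_atTop 0]
      with n h1 h2
    exact key n h1 h2

/-- The integral of `h` over the circle of radius `r` around `c`. -/
def circleLIntegral (h : ℂ → ℝ≥0∞) (c : ℂ) (r : ℝ) : ℝ≥0∞ :=
  ENNReal.ofReal r * ∫⁻ θ in Ioo (-Real.pi) Real.pi, h (circleMap c r θ)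

/-- The interval is contained in one period, and the integral over a period does not depend on where
the period starts. -/
lemma setLIntegral_le_circle (h : ℂ → ℝ≥0∞) (c : ℂ) (r : ℝ) {x y : ℝ} (hxy : y ≤ x + 2 * Real.pi) :
    ∫⁻ θ in Icc x y, h (circleMap c r θ) ≤ ∫⁻ θ in Ioo (-Real.pi) Real.pi, h (circleMap c r θ) := by
  have h1 : ∫⁻ θ in Icc x y, h (circleMap c r θ) ≤ ∫⁻ θ in Ioc x (x + 2 * Real.pi), h (circleMap c r θ) := by
    rw [restrict_Ioc_eq_restrict_Icc]
    exact lintegral_mono_set (Icc_subset_Icc_right hxy)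
  refine h1.trans (le_of_eq ?_)
  have h2 : ∫⁻ θ in Ioc (-Real.pi) (-Real.pi + 2 * Real.pi), h (circleMap c r θ)
      = ∫⁻ θ in Ioo (-Real.pi) Real.pi, h (circleMap c r θ) := by
    rw [restrict_Ioo_eq_restrict_Ioc]
    congr 3; ring
  rw [← h2]
  refine IsAddFundamentalDomain.setLIntegral_eq (isAddFundamentalDomain_Ioc Real.two_pi_pos x volume)
    (isAddFundamentalDomain_Ioc Real.two_pi_pos (-Real.pi) volume) _ ?_
  rintro ⟨g, hg⟩ θ
  obtain ⟨n, rfl⟩ := AddSubgroup.mem_zmultiples_iff.1 hg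
  congr 1
  have h4 := ((periodic_circleMap c r).int_mul n) θ
  rw [add_comm] at h4
  simpa [AddSubgroup.vadd_def, zsmul_eq_mul] using h4

section

variable {f : unitInterval → ℂ} {c : ℂ} {r A B : ℝ} {a b : unitInterval}

lemma eVariationOn_of_circle (hr : 0 ≤ r) (hf : ∀ t ∈ Icc a b, f t = circleMap c r (A * t + B))
    {x y : unitInterval} (hax : a ≤ x) (hxy : x ≤ y) (hyb : y ≤ b) :
    eVariationOn f (Icc x y) = ENNReal.ofReal (r * |A| * ((y : ℝ) - x)) := by
  set φ : unitInterval → ℝ := fun t => A * t + B with hφ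
  have h1 : eVariationOn f (Icc x y) = eVariationOn (circleMap c r ∘ φ) (Icc x y) :=
    eVariationOn.eq_of_eqOn fun t ht => hf t ⟨hax.trans ht.1, ht.2.trans hyb⟩
  have hφc : Continuous φ := by fun_prop
  have hxy' : (x : ℝ) ≤ y := hxy
  rw [h1]
  rcases le_total 0 A with hA | hA
  · have hm : Monotone φ := fun s t hst => by
      have : (s : ℝ) ≤ t := hst
      simp only [hφ]; gcongr
    rw [eVariationOn.comp_eq_of_monotoneOn _ _ (hm.monotoneOn _)]
    have him : φ '' Icc x y = Icc (φ x) (φ y) := by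
      apply Subset.antisymm
      · rintro _ ⟨t, ht, rfl⟩; exact ⟨hm ht.1, hm ht.2⟩
      · exact intermediate_value_Icc hxy hφc.continuousOn
    rw [him, eVariationOn_circleMap c hr (hm hxy), abs_of_nonneg hA]
    congr 1; simp only [hφ]; ring
  · have hm : Antitone φ := fun s t hst => by
      have : (s : ℝ) ≤ t := hst
      simp only [hφ]; nlinarith
    rw [eVariationOn.comp_eq_of_antitoneOn _ _ (hm.antitoneOn _)]
    have him : φ '' Icc x y = Icc (φ y) (φ x) := by
      apply Subset.antisymm
      · rintro _ ⟨t, ht, rfl⟩; exact ⟨hm ht.2, hm ht.1⟩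
      · exact intermediate_value_Icc' hxy hφc.continuousOn
    rw [him, eVariationOn_circleMap c hr (hm hxy), abs_of_nonpos hA]
    congr 1; simp only [hφ]; ring

/-- The natural parametrization is a chosen right inverse of the variation. Here the variation is
linear in time with non-zero slope, so there is only one choice. -/
lemma naturalParameterization_of_circle (hr : 0 < r) (hA : A ≠ 0)
    (hf : ∀ t ∈ Icc a b, f t = circleMap c r (A * t + B)) {s : ℝ}
    (hs : s ∈ Icc 0 (r * |A| * ((b : ℝ) - a))) :
    ∃ t ∈ Icc a b, (t : ℝ) = a + s / (r * |A|) ∧ naturalParameterization f (Icc a b) a s = f t := by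
  have hpos : 0 < r * |A| := mul_pos hr (abs_pos.2 hA)
  have hvar : ∀ t ∈ Icc a b, variationOnFromTo f (Icc a b) a t = r * |A| * ((t : ℝ) - a) := by
    intro t ht
    have hat : (a : ℝ) ≤ t := ht.1
    rw [variationOnFromTo.eq_of_le _ _ ht.1, inter_eq_self_of_subset_right (Icc_subset_Icc_right ht.2),
      eVariationOn_of_circle hr.le hf le_rfl ht.1 ht.2, ENNReal.toReal_ofReal]
    exact mul_nonneg hpos.le (sub_nonneg.2 hat)
  have hex : ∃ t ∈ Icc a b, variationOnFromTo f (Icc a b) a t = s := by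
    have h0 : 0 ≤ s / (r * |A|) := div_nonneg hs.1 hpos.le
    have h1 : s / (r * |A|) ≤ (b : ℝ) - a := by
      rw [div_le_iff₀ hpos]; linarith [hs.2]
    set t : unitInterval := ⟨a + s / (r * |A|), by linarith [a.2.1], by linarith [b.2.2]⟩
    have ht : t ∈ Icc a b := ⟨by
      show (a : ℝ) ≤ a + s / (r * |A|); linarith, by
      show a + s / (r * |A|) ≤ (b : ℝ); linarith⟩
    refine ⟨t, ht, ?_⟩
    rw [hvar t ht]
    show r * |A| * ((a : ℝ) + s / (r * |A|) - a) = s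
    field_simp
    ring
  have : Nonempty unitInterval := ⟨a⟩
  obtain ⟨h1, h2⟩ := Function.invFunOn_pos hex
  refine ⟨_, h1, ?_, rfl⟩
  rw [hvar _ h1] at h2
  have h3 := (div_eq_iff hpos.ne').2 (h2.symm.trans (mul_comm _ _))
  rw [h3]; ring

lemma arcIntegral_le_circleLIntegral {g h : ℂ → ℝ≥0∞} (hr : 0 < r) (hA : A ≠ 0) (hab : a ≤ b)
    (hf : ∀ t ∈ Icc a b, f t = circleMap c r (A * t + B)) (hgh : ∀ t ∈ Icc a b, g (f t) ≤ h (f t))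
    (hlen : |A| * ((b : ℝ) - a) ≤ 2 * Real.pi) :
    arcIntegral g f a b ≤ circleLIntegral h c r := by
  have hab' : (a : ℝ) ≤ b := hab
  set V := r * |A| * ((b : ℝ) - a) with hV
  have hpos : 0 < r * |A| := mul_pos hr (abs_pos.2 hA)
  have hV0 : 0 ≤ V := mul_nonneg hpos.le (sub_nonneg.2 hab')
  obtain ⟨σ, hσ, hAσ⟩ : ∃ σ : ℝ, (σ = 1 ∨ σ = -1) ∧ A = σ * |A| := by
    rcases lt_or_gt_of_ne hA with h | h
    · exact ⟨-1, Or.inr rfl, by rw [abs_of_neg h]; ring⟩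
    · exact ⟨1, Or.inl rfl, by rw [abs_of_pos h]; ring⟩
  -- The angle as a function of arc length. Its slope ± 1/r gives the factor r in the change of
  -- variables.
  set ψ : ℝ → ℝ := fun s => (A * a + B) + (σ / r) * s with hψ
  have hσ0 : σ ≠ 0 := by rcases hσ with rfl | rfl <;> norm_num
  have hσabs : |σ| = 1 := by rcases hσ with rfl | rfl <;> norm_num
  have h1 : arcIntegral g f a b ≤ ∫⁻ s in Icc 0 V, h (circleMap c r (ψ s)) := by
    rw [arcIntegral, eVariationOn_of_circle hr.le hf le_rfl hab le_rfl, ENNReal.toReal_ofReal hV0]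
    refine setLIntegral_mono' measurableSet_Icc fun s hs => ?_
    obtain ⟨t, ht, hts, hnat⟩ := naturalParameterization_of_circle hr hA hf hs
    rw [hnat]
    refine (hgh t ht).trans (le_of_eq ?_)
    rw [hf t ht, hts]
    congr 2
    simp only [hψ]
    have hA' : |A| ≠ 0 := abs_ne_zero.2 hA
    have h5 : A * (s / (r * |A|)) = σ / r * s := by
      conv_lhs => rw [hAσ, abs_mul, hσabs, abs_abs, one_mul]
      field_simp
    rw [mul_add, h5]; ring
  have hinj : Function.Injective ψ := by
    intro s s' hss
    simp only [hψ, add_right_inj] at hss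
    exact mul_left_cancel₀ (div_ne_zero hσ0 hr.ne') hss
  have hder : ∀ s ∈ Icc 0 V, HasDerivWithinAt ψ (σ / r) (Icc 0 V) s := by
    intro s _
    have := ((hasDerivAt_id s).const_mul (σ / r)).const_add (A * a + B)
    simpa [hψ] using this.hasDerivWithinAt
  have h2 := lintegral_image_eq_lintegral_abs_deriv_mul measurableSet_Icc hder hinj.injOn
    (fun θ => h (circleMap c r θ))
  have habs : |σ / r| = r⁻¹ := by rw [abs_div, hσabs, abs_of_pos hr, one_div]
  have h3 : ∫⁻ s in Icc 0 V, h (circleMap c r (ψ s))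
      = ENNReal.ofReal r * ∫⁻ θ in ψ '' Icc 0 V, h (circleMap c r θ) := by
    rw [h2, habs, ← lintegral_const_mul' _ _ ENNReal.ofReal_ne_top]
    refine lintegral_congr fun s => ?_
    rw [← mul_assoc, ← ENNReal.ofReal_mul hr.le, mul_inv_cancel₀ hr.ne', ENNReal.ofReal_one, one_mul]
  refine h1.trans (h3.le.trans ?_)
  rw [circleLIntegral]
  refine mul_le_mul' le_rfl ?_
  have hVr : V / r ≤ 2 * Real.pi := by
    rw [hV]; rw [div_le_iff₀ hr]; nlinarith
  rcases hσ with rfl | rfl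
  · refine le_trans (lintegral_mono_set (t := Icc (A * a + B) (A * a + B + V / r)) ?_)
      (setLIntegral_le_circle h c r (x := A * a + B)
        (y := A * a + B + V / r) (by linarith))
    rintro _ ⟨s, hs, rfl⟩
    have e1 : 0 ≤ s / r := div_nonneg hs.1 hr.le
    have e2 : s / r ≤ V / r := div_le_div_of_nonneg_right hs.2 hr.le
    have e3 : ψ s = A * a + B + s / r := by simp only [hψ]; ring
    rw [e3]; constructor <;> linarith
  · refine le_trans (lintegral_mono_set (t := Icc (A * a + B - V / r) (A * a + B)) ?_)
      (setLIntegral_le_circle h c r (x := A * a + B - V / r)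
        (y := A * a + B) (by linarith))
    rintro _ ⟨s, hs, rfl⟩
    have e1 : 0 ≤ s / r := div_nonneg hs.1 hr.le
    have e2 : s / r ≤ V / r := div_le_div_of_nonneg_right hs.2 hr.le
    have e3 : ψ s = A * a + B - s / r := by simp only [hψ]; ring
    rw [e3]; constructor <;> linarith

end

end Transboundary

namespace Transboundary

open MeasureTheory

/-! ### Piecewise circular paths in `Ĝ` -/

variable {G : Set (OnePoint ℂ)}

lemma proj_eq_iff {x y : OnePoint ℂ} : proj G x = proj G y ↔ x = y ∨
    (x ∈ Gᶜ ∧ y ∈ Gᶜ ∧ connectedComponentIn Gᶜ x = connectedComponentIn Gᶜ y) :=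
  Quotient.eq (r := collapse G)

lemma eq_of_proj_eq {x y : OnePoint ℂ} (hx : x ∈ G) (h : proj G x = proj G y) : x = y := by
  rcases proj_eq_iff.1 h with h | ⟨h, _⟩
  · exact h
  · exact absurd hx h

lemma proj_eq_of_isPreconnected {C : Set (OnePoint ℂ)} (hC : IsPreconnected C) (hCG : C ⊆ Gᶜ)
    {x y : OnePoint ℂ} (hx : x ∈ C) (hy : y ∈ C) : proj G x = proj G y :=
  proj_eq_iff.2 (Or.inr ⟨hCG hx, hCG hy,
    (connectedComponentIn_eq (hC.subset_connectedComponentIn hx hCG hy))⟩)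

lemma coord_proj {z : ℂ} (hz : (z : OnePoint ℂ) ∈ G) : coord G (proj G z) = z := by
  have h : ∃ z' : ℂ, (z' : OnePoint ℂ) ∈ G ∧ proj G (z' : OnePoint ℂ) = proj G z := ⟨z, hz, rfl⟩
  rw [coord, dif_pos h]
  have := eq_of_proj_eq h.choose_spec.1 h.choose_spec.2
  exact OnePoint.coe_injective this

lemma notMem_components_of_mem {x : OnePoint ℂ} (hx : x ∈ G) : proj G x ∉ components G := by
  rintro ⟨y, hy, h⟩
  have := eq_of_proj_eq hx h.symm
  subst this
  exact hy hx

lemma continuous_proj : Continuous (proj G) := continuous_quotient_mk'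

/-- The function `ρ` on the plane, extended by zero outside of `G`. -/
def extend (G : Set (OnePoint ℂ)) (ρ : Hat G → ℝ≥0∞) : ℂ → ℝ≥0∞ :=
  indicator {z : ℂ | (z : OnePoint ℂ) ∈ G} fun z => ρ (proj G (z : OnePoint ℂ))

lemma extend_of_mem (ρ : Hat G → ℝ≥0∞) {z : ℂ} (hz : (z : OnePoint ℂ) ∈ G) :
    extend G ρ z = ρ (proj G z) := indicator_of_mem (show z ∈ {z : ℂ | (z : OnePoint ℂ) ∈ G} from hz) _

/-- The path `γ` consists of finitely many circular arcs in `G`, on the time intervals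
`(l i, h i)`; at all other times it is in the set `V` of complementary components. -/
structure PiecewiseCircular (γ : unitInterval → Hat G) {ι : Type} (l h A B r : ι → ℝ) (c : ι → ℂ)
    (V : Set (Hat G)) : Prop where
  l_nonneg : ∀ i, 0 ≤ l i
  l_lt : ∀ i, l i < h i
  h_le : ∀ i, h i ≤ 1
  disj : ∀ i i', i ≠ i' → Disjoint (Ioo (l i) (h i)) (Ioo (l i') (h i'))
  r_pos : ∀ i, 0 < r i
  A_ne : ∀ i, A i ≠ 0
  len : ∀ i, |A i| * (h i - l i) ≤ 2 * Real.pi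
  mem : ∀ i, ∀ t : unitInterval, (t : ℝ) ∈ Ioo (l i) (h i) →
    (circleMap (c i) (r i) (A i * t + B i) : OnePoint ℂ) ∈ G
  eq : ∀ i, ∀ t : unitInterval, (t : ℝ) ∈ Ioo (l i) (h i) →
    γ t = proj G (circleMap (c i) (r i) (A i * t + B i))
  off : ∀ t : unitInterval, (∀ i, (t : ℝ) ∉ Ioo (l i) (h i)) → γ t ∈ V
  subset : V ⊆ components G

namespace PiecewiseCircular

variable {ι : Type} {l h A B r : ι → ℝ} {c : ι → ℂ} {V : Set (Hat G)} {γ : C(unitInterval, Hat G)}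

lemma mem_freeTimes (H : PiecewiseCircular γ l h A B r c V) {t : unitInterval} :
    t ∈ freeTimes G γ ↔ ∃ i, (t : ℝ) ∈ Ioo (l i) (h i) := by
  constructor
  · rintro ⟨z, hz, hzt⟩
    by_contra hcon
    push Not at hcon
    have := H.subset (H.off t hcon)
    rw [← hzt] at this
    exact notMem_components_of_mem hz this
  · rintro ⟨i, hi⟩
    exact ⟨_, H.mem i t hi, (H.eq i t hi).symm⟩

lemma planar_eq (H : PiecewiseCircular γ l h A B r c V) {i : ι} {t : unitInterval}
    (ht : (t : ℝ) ∈ Ioo (l i) (h i)) : planar G γ t = circleMap (c i) (r i) (A i * t + B i) := by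
  rw [planar, H.eq i t ht, coord_proj (H.mem i t ht)]

/-- The `i`-th excursion. -/
def piece (l h : ι → ℝ) (i : ι) : Set unitInterval := {t | (t : ℝ) ∈ Ioo (l i) (h i)}

/-- An end of one interval inside another would make the two overlap. Hence an excursion, being
order connected, cannot leave its piece. -/
lemma notMem_of_end (H : PiecewiseCircular γ l h A B r c V) {i : ι} {s : unitInterval}
    (hs : (s : ℝ) = l i ∨ (s : ℝ) = h i) : s ∉ freeTimes G γ := by
  rw [H.mem_freeTimes]
  rintro ⟨k, hk⟩
  have hli := H.l_lt i
  by_cases hik : i = k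
  · subst hik
    rcases hs with hs | hs
    · exact absurd hk.1 (by rw [hs]; exact lt_irrefl _)
    · exact absurd hk.2 (by rw [hs]; exact lt_irrefl _)
  · have hd := Set.disjoint_left.1 (H.disj i k hik)
    rcases hs with hs | hs
    · rw [hs] at hk
      obtain ⟨x, hx1, hx2⟩ := exists_between (lt_min hli hk.2)
      exact hd (a := x) ⟨hx1, hx2.trans_le (min_le_left _ _)⟩
        ⟨hk.1.trans hx1, hx2.trans_le (min_le_right _ _)⟩
    · rw [hs] at hk
      obtain ⟨x, hx1, hx2⟩ := exists_between (max_lt hli hk.1)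
      exact hd (a := x) ⟨(le_max_left _ _).trans_lt hx1, hx2⟩
        ⟨(le_max_right _ _).trans_lt hx1, hx2.trans hk.2⟩

lemma exists_piece (H : PiecewiseCircular γ l h A B r c V) {C : Set unitInterval}
    (hC : C ∈ excursions G γ) : ∃ i, C = piece l h i := by
  obtain ⟨t₀, ht₀, rfl⟩ := hC
  obtain ⟨i, hi⟩ := H.mem_freeTimes.1 ht₀
  refine ⟨i, Subset.antisymm ?_ ?_⟩
  · intro t ht
    have hoc : OrdConnected (connectedComponentIn (freeTimes G γ) t₀) :=
      isPreconnected_connectedComponentIn.ordConnected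
    have hself := mem_connectedComponentIn ht₀
    have hsub : ∀ s, s ∈ connectedComponentIn (freeTimes G γ) t₀ → s ∈ freeTimes G γ :=
      fun s hs => connectedComponentIn_subset _ _ hs
    constructor
    · by_contra hcon
      rw [not_lt] at hcon
      set s : unitInterval := ⟨l i, H.l_nonneg i, (H.l_lt i).le.trans (H.h_le i)⟩
      refine H.notMem_of_end (i := i) (s := s) (Or.inl rfl) (hsub s (hoc.out ht hself ⟨?_, ?_⟩))
      · exact hcon
      · exact hi.1.le
    · by_contra hcon
      rw [not_lt] at hcon
      set s : unitInterval := ⟨h i, (H.l_nonneg i).trans (H.l_lt i).le, H.h_le i⟩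
      refine H.notMem_of_end (i := i) (s := s) (Or.inr rfl) (hsub s (hoc.out hself ht ⟨?_, ?_⟩))
      · exact hi.2.le
      · exact hcon
  · have hoc : OrdConnected (piece l h i) := by
      refine ⟨fun x hx y hy z hz => ⟨hx.1.trans_le ?_, lt_of_le_of_lt ?_ hy.2⟩⟩
      · exact hz.1
      · exact hz.2
    exact hoc.isPreconnected.subset_connectedComponentIn hi fun t ht => H.mem_freeTimes.2 ⟨i, ht⟩

lemma isLocallyRectifiable (H : PiecewiseCircular γ l h A B r c V) : IsLocallyRectifiable G γ := by
  intro C hC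
  obtain ⟨i, rfl⟩ := H.exists_piece hC
  intro a b ha hb
  refine ne_top_of_le_ne_top ?_ (eVariationOn.mono _ inter_subset_right)
  rcases le_total a b with hab | hab
  · rw [eVariationOn_of_circle (f := planar G γ) (c := c i) (r := r i) (A := A i) (B := B i)
      (a := a) (b := b) (H.r_pos i).le
      (fun t ht => H.planar_eq ⟨ha.1.trans_le ht.1, lt_of_le_of_lt ht.2 hb.2⟩) le_rfl hab le_rfl]
    exact ENNReal.ofReal_ne_top
  · rw [eVariationOn.subsingleton]
    · exact ENNReal.zero_ne_top
    · intro x hx y hy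
      exact le_antisymm (hx.2.trans (hab.trans hy.1)) (hy.2.trans (hab.trans hx.1))

/-- Different excursions are different pieces, so the sum over excursions injects into the sum over
ι. -/
lemma pathIntegral_le [Fintype ι] (H : PiecewiseCircular γ l h A B r c V) (ρ : Hat G → ℝ≥0∞) :
    pathIntegral G ρ γ ≤ ∑ i, circleLIntegral (extend G ρ) (c i) (r i) := by
  set F : Set unitInterval → ℝ≥0∞ := fun C => ⨆ (a : unitInterval) (b : unitInterval) (_ : a ≤ b)
    (_ : Icc a b ⊆ C),
      arcIntegral (fun z => ρ (proj G (z : OnePoint ℂ))) (planar G γ) a b with hF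
  choose ix hix using fun C : excursions G γ => H.exists_piece C.2
  have hinj : Function.Injective ix := by
    intro C C' h
    apply Subtype.ext
    rw [hix C, hix C', h]
  have h1 : pathIntegral G ρ γ = ∑' C : excursions G γ, F (piece l h (ix C)) := by
    rw [pathIntegral]
    refine tsum_congr fun C => ?_
    rw [← hix C]
  rw [h1]
  refine (ENNReal.tsum_comp_le_tsum_of_injective hinj (fun i => F (piece l h i))).trans ?_
  rw [tsum_fintype]
  refine Finset.sum_le_sum fun i _ => ?_
  simp only [hF]
  refine iSup_le fun a => iSup_le fun b => iSup_le fun hab => iSup_le fun hsub => ?_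
  have hplanar : ∀ t ∈ Icc a b, planar G γ t = circleMap (c i) (r i) (A i * t + B i) :=
    fun t ht => H.planar_eq (hsub ht)
  refine arcIntegral_le_circleLIntegral (H.r_pos i) (H.A_ne i) hab hplanar (fun t ht => ?_) ?_
  · have hm := H.mem i t (hsub ht)
    rw [hplanar t ht, extend_of_mem ρ hm]
  · have ha := hsub (left_mem_Icc.2 hab)
    have hb := hsub (right_mem_Icc.2 hab)
    refine le_trans ?_ (H.len i)
    gcongr
    · exact hb.2.le
    · exact ha.1.le

end PiecewiseCircular

/-- There is a piecewise circular path from `p` to `q` along which the total mass of `ρ` is at most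
`M`. -/
def Joins (ρ : Hat G → ℝ≥0∞) (p q : Hat G) (M : ℝ≥0∞) : Prop :=
  ∃ (γ : Path p q) (ι : Type) (_ : Fintype ι) (l h A B r : ι → ℝ) (c : ι → ℂ) (V : Finset (Hat G)),
    PiecewiseCircular γ l h A B r c V ∧
      ∑ i, circleLIntegral (extend G ρ) (c i) (r i) + ∑ x ∈ V, ρ x ≤ M

namespace Joins

variable {ρ : Hat G → ℝ≥0∞} {p q s : Hat G} {M M' : ℝ≥0∞}

lemma mono (H : Joins ρ p q M) (h : M ≤ M') : Joins ρ p q M' := by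
  obtain ⟨γ, ι, _, l, h', A, B, r, c, V, H1, H2⟩ := H
  exact ⟨γ, ι, _, l, h', A, B, r, c, V, H1, H2.trans h⟩

lemma refl (ρ : Hat G → ℝ≥0∞) (hp : p ∈ components G) : Joins ρ p p (ρ p) := by
  refine ⟨Path.refl p, Empty, inferInstance, Empty.elim, Empty.elim, Empty.elim, Empty.elim,
    Empty.elim, Empty.elim, {p}, ⟨fun i => i.elim, fun i => i.elim, fun i => i.elim,
      fun i => i.elim, fun i => i.elim, fun i => i.elim, fun i => i.elim, fun i => i.elim,
      fun i => i.elim, fun t _ => by simp, by simpa using hp⟩, by simp⟩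

lemma of_arc (ρ : Hat G → ℝ≥0∞) {c : ℂ} {r θ₁ θ₂ : ℝ} (hr : 0 < r) (hne : θ₁ ≠ θ₂)
    (hlen : |θ₂ - θ₁| ≤ 2 * Real.pi) (h1 : (circleMap c r θ₁ : OnePoint ℂ) ∉ G)
    (h2 : (circleMap c r θ₂ : OnePoint ℂ) ∉ G)
    (hmem : ∀ t ∈ Ioo (0 : ℝ) 1, (circleMap c r ((θ₂ - θ₁) * t + θ₁) : OnePoint ℂ) ∈ G) :
    Joins ρ (proj G (circleMap c r θ₁)) (proj G (circleMap c r θ₂))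
      (circleLIntegral (extend G ρ) c r + ρ (proj G (circleMap c r θ₁)) +
        ρ (proj G (circleMap c r θ₂))) := by
  classical
  have hcont : Continuous fun t : unitInterval =>
      proj G (circleMap c r ((θ₂ - θ₁) * t + θ₁) : OnePoint ℂ) := by
    refine continuous_proj.comp (OnePoint.continuous_coe.comp ?_)
    exact (continuous_circleMap c r).comp (by fun_prop)
  set γ : Path (proj G (circleMap c r θ₁)) (proj G (circleMap c r θ₂)) :=
    { toFun := fun t => proj G (circleMap c r ((θ₂ - θ₁) * t + θ₁) : OnePoint ℂ)
      continuous_toFun := hcont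
      source' := by simp
      target' := by simp } with hγ
  have hγt : ∀ t : unitInterval, γ t = proj G (circleMap c r ((θ₂ - θ₁) * t + θ₁) : OnePoint ℂ) :=
    fun t => rfl
  refine ⟨γ, Unit, inferInstance, fun _ => 0, fun _ => 1, fun _ => θ₂ - θ₁, fun _ => θ₁,
    fun _ => r, fun _ => c, {proj G (circleMap c r θ₁), proj G (circleMap c r θ₂)},
    ⟨fun _ => le_rfl, fun _ => one_pos, fun _ => le_rfl, fun i i' h => absurd rfl h, fun _ => hr,
      fun _ => sub_ne_zero.2 hne.symm, fun _ => by simpa using hlen, fun _ t ht => hmem t ht,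
      fun _ t _ => hγt t, ?_, ?_⟩, ?_⟩
  · intro t ht
    have ht := ht ()
    have : (t : ℝ) = 0 ∨ (t : ℝ) = 1 := by
      by_contra hcon
      rw [not_or] at hcon
      exact ht ⟨lt_of_le_of_ne t.2.1 (Ne.symm hcon.1), lt_of_le_of_ne t.2.2 hcon.2⟩
    rw [hγt]
    rcases this with h | h
    · rw [h]; simp
    · rw [h]; simp
  · intro x hx
    simp only [Finset.coe_insert, Finset.coe_singleton, mem_insert_iff, mem_singleton_iff] at hx
    rcases hx with rfl | rfl
    · exact ⟨_, h1, rfl⟩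
    · exact ⟨_, h2, rfl⟩
  · simp only [Finset.univ_unique, Finset.sum_const, Finset.card_singleton, one_smul]
    rw [add_assoc]
    gcongr
    by_cases hpq : proj G (circleMap c r θ₁ : OnePoint ℂ) = proj G (circleMap c r θ₂ : OnePoint ℂ)
    · simp [hpq]
    · rw [Finset.sum_pair hpq]

/-- Each path runs at double speed, which doubles the slopes; in the second half A' (2t - 1) + B'
has the constant term B' - A'. Components common to both halves are counted once in the union. -/
lemma trans (H : Joins ρ p q M) (H' : Joins ρ q s M') : Joins ρ p s (M + M') := by
  classical
  obtain ⟨γ, ι, _, l, h, A, B, r, c, V, H1, H2⟩ := H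
  obtain ⟨γ', ι', _, l', h', A', B', r', c', V', H1', H2'⟩ := H'
  refine ⟨γ.trans γ', ι ⊕ ι', inferInstance, Sum.elim (fun i => l i / 2) (fun i => (1 + l' i) / 2),
    Sum.elim (fun i => h i / 2) (fun i => (1 + h' i) / 2),
    Sum.elim (fun i => 2 * A i) (fun i => 2 * A' i), Sum.elim B (fun i => B' i - A' i),
    Sum.elim r r', Sum.elim c c', V ∪ V', ⟨?_, ?_, ?_, ?_, ?_, ?_, ?_, ?_, ?_, ?_, ?_⟩, ?_⟩
  · rintro (i | i) <;> simp only [Sum.elim_inl, Sum.elim_inr]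
    · linarith [H1.l_nonneg i]
    · linarith [H1'.l_nonneg i]
  · rintro (i | i) <;> simp only [Sum.elim_inl, Sum.elim_inr]
    · linarith [H1.l_lt i]
    · linarith [H1'.l_lt i]
  · rintro (i | i) <;> simp only [Sum.elim_inl, Sum.elim_inr]
    · linarith [H1.h_le i]
    · linarith [H1'.h_le i]
  · rintro (i | i) (k | k) hik <;> simp only [Sum.elim_inl, Sum.elim_inr] <;>
      rw [Set.disjoint_left] <;> intro x hx hx'
    · exact Set.disjoint_left.1 (H1.disj i k (by simpa using hik))
        (show 2 * x ∈ Ioo (l i) (h i) from ⟨by linarith [hx.1], by linarith [hx.2]⟩)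
        ⟨by linarith [hx'.1], by linarith [hx'.2]⟩
    · linarith [hx.2, hx'.1, H1.h_le i, H1'.l_nonneg k]
    · linarith [hx.1, hx'.2, H1.h_le k, H1'.l_nonneg i]
    · exact Set.disjoint_left.1 (H1'.disj i k (by simpa using hik))
        (show 2 * x - 1 ∈ Ioo (l' i) (h' i) from ⟨by linarith [hx.1], by linarith [hx.2]⟩)
        ⟨by linarith [hx'.1], by linarith [hx'.2]⟩
  · rintro (i | i)
    · exact H1.r_pos i
    · exact H1'.r_pos i
  · rintro (i | i)
    · simpa using H1.A_ne i
    · simpa using H1'.A_ne i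
  · rintro (i | i) <;> simp only [Sum.elim_inl, Sum.elim_inr, abs_mul, abs_two]
    · linarith [H1.len i]
    · linarith [H1'.len i]
  · rintro (i | i) t ht <;> simp only [Sum.elim_inl, Sum.elim_inr] at ht ⊢
    · have := H1.mem i ⟨2 * t, by linarith [t.2.1], by linarith [ht.2, H1.h_le i]⟩
        ⟨by simp only; linarith [ht.1], by simp only; linarith [ht.2]⟩
      convert this using 3
      simp only; ring
    · have := H1'.mem i ⟨2 * t - 1, by linarith [ht.1, H1'.l_nonneg i], by linarith [t.2.2]⟩
        ⟨by simp only; linarith [ht.1], by simp only; linarith [ht.2]⟩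
      convert this using 3
      simp only; ring
  · rintro (i | i) t ht <;> simp only [Sum.elim_inl, Sum.elim_inr] at ht ⊢
    · have hle : (t : ℝ) ≤ 1 / 2 := by linarith [ht.2, H1.h_le i]
      rw [Path.trans_apply, dif_pos hle]
      rw [H1.eq i _ ⟨by simp only; linarith [ht.1], by simp only; linarith [ht.2]⟩]
      congr 3
      simp only; ring
    · have hle : ¬ (t : ℝ) ≤ 1 / 2 := by linarith [ht.1, H1'.l_nonneg i]
      rw [Path.trans_apply, dif_neg hle]
      rw [H1'.eq i _ ⟨by simp only; linarith [ht.1], by simp only; linarith [ht.2]⟩]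
      congr 3
      simp only; ring
  · intro t ht
    rw [Finset.coe_union]
    rw [Path.trans_apply]
    split_ifs with hle
    · refine Or.inl (H1.off _ fun i hi => ht (Sum.inl i) ?_)
      simp only [Sum.elim_inl]
      exact ⟨by have := hi.1; simp only at this; linarith, by have := hi.2; simp only at this; linarith⟩
    · refine Or.inr (H1'.off _ fun i hi => ht (Sum.inr i) ?_)
      simp only [Sum.elim_inr]
      exact ⟨by have := hi.1; simp only at this; linarith, by have := hi.2; simp only at this; linarith⟩
  · rw [Finset.coe_union]
    exact union_subset H1.subset H1'.subset
  · rw [Fintype.sum_sum_type]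
    simp only [Sum.elim_inl, Sum.elim_inr]
    have h3 : ∑ x ∈ V ∪ V', ρ x ≤ ∑ x ∈ V, ρ x + ∑ x ∈ V', ρ x := by
      rw [← Finset.sum_union_inter]
      exact le_self_add
    calc _ ≤ (∑ i, circleLIntegral (extend G ρ) (c i) (r i) +
          ∑ i, circleLIntegral (extend G ρ) (c' i) (r' i)) + (∑ x ∈ V, ρ x + ∑ x ∈ V', ρ x) := by
          gcongr
      _ = _ := add_add_add_comm _ _ _ _
      _ ≤ _ := add_le_add H2 H2'

/-- On the arcs the path is in G, so every component it meets belongs to V, and M bounds the whole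
mass that admissibility refers to. -/
lemma one_le {X Y : Set (OnePoint ℂ)} (hρ : ρ ∈ admissible G (joining X Y G)) (hp : p ∈ proj G '' X)
    (hq : q ∈ proj G '' Y) (H : Joins ρ p q M) : 1 ≤ M := by
  obtain ⟨γ, ι, _, l, h, A, B, r, c, V, H1, H2⟩ := H
  have H1 : PiecewiseCircular γ.toContinuousMap l h A B r c V := H1
  have hγ : γ.toContinuousMap ∈ joining X Y G := by
    constructor
    · have : γ.toContinuousMap 0 = p := γ.source
      rw [this]; exact hp
    · have : γ.toContinuousMap 1 = q := γ.target
      rw [this]; exact hq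
  refine (hρ.2 _ hγ H1.isLocallyRectifiable).trans (le_trans ?_ H2)
  gcongr
  · exact H1.pathIntegral_le ρ
  · have hsub : components G ∩ range γ.toContinuousMap ⊆ (V : Set (Hat G)) := by
      rintro _ ⟨hx, t, rfl⟩
      refine H1.off t fun i hi => ?_
      rw [H1.eq i t hi] at hx
      exact notMem_components_of_mem (H1.mem i t hi) hx
    refine (ENNReal.tsum_mono_subtype ρ hsub).trans (le_of_eq ?_)
    exact Finset.tsum_subtype V ρ

end Joins

end Transboundary

namespace Transboundary

open MeasureTheory

/-! ### Choosing a radius -/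

/-- Polar coordinates about c, with the indicator of the ball moved into the integrand so that the
formula for the whole plane applies. -/
lemma lintegral_polar_le {h : ℂ → ℝ≥0∞} (hh : Measurable h) (c : ℂ) {D : Set ℝ}
    (hD : MeasurableSet D) {ε : ℝ} (hDε : D ⊆ Ioo 0 ε) :
    ∫⁻ r in D, ENNReal.ofReal r * ∫⁻ θ in Ioo (-Real.pi) Real.pi, h (circleMap c r θ) ≤
      ∫⁻ z in Metric.ball c ε, h z := by
  set g : ℂ → ℝ≥0∞ := (Metric.ball 0 ε).indicator fun z => h (c + z) with hg
  have hgm : Measurable g := (hh.comp (measurable_const_add c)).indicator Metric.isOpen_ball.measurableSet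
  have h1 : ∫⁻ z in Metric.ball c ε, h z = ∫⁻ z, g z := by
    rw [← lintegral_indicator Metric.isOpen_ball.measurableSet,
      ← lintegral_add_left_eq_self _ c]
    refine lintegral_congr fun z => ?_
    simp only [hg, indicator, Metric.mem_ball, dist_eq_norm, add_sub_cancel_left, sub_zero]
  rw [h1, ← Complex.lintegral_comp_polarCoord_symm]
  have htarget : polarCoord.target = Ioi (0 : ℝ) ×ˢ Ioo (-Real.pi) Real.pi := rfl
  have hmeas : Measurable fun p : ℝ × ℝ => ENNReal.ofReal p.1 • g (Complex.polarCoord.symm p) := by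
    refine (ENNReal.measurable_ofReal.comp measurable_fst).mul (hgm.comp ?_)
    have : (fun p : ℝ × ℝ => Complex.polarCoord.symm p) = fun p : ℝ × ℝ =>
        (p.1 : ℂ) * (Real.cos p.2 + Real.sin p.2 * Complex.I) := by
      funext p; rw [Complex.polarCoord_symm_apply]
    change Measurable fun p : ℝ × ℝ => Complex.polarCoord.symm p
    rw [this]
    fun_prop
  rw [htarget, Measure.volume_eq_prod, setLIntegral_prod _ hmeas.aemeasurable]
  refine le_trans ?_ (lintegral_mono_set (hDε.trans Ioo_subset_Ioi_self))
  refine setLIntegral_mono' hD fun r hr => ?_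
  rw [← lintegral_const_mul' _ _ ENNReal.ofReal_ne_top]
  refine lintegral_mono fun θ => ?_
  simp only [smul_eq_mul]
  gcongr
  have h2 : (Complex.polarCoord.symm (r, θ)) ∈ Metric.ball (0 : ℂ) ε := by
    rw [mem_ball_zero_iff, Complex.norm_polarCoord_symm, abs_of_pos (hDε hr).1]
    exact (hDε hr).2
  rw [hg, indicator_of_mem h2, Complex.polarCoord_symm_apply, circleMap, Complex.exp_mul_I]
  push_cast
  exact le_rfl

/-- Cauchy-Schwarz against the constant 1 on an interval of length 2π. -/
lemma circleLIntegral_sq_le {h : ℂ → ℝ≥0∞} (hh : Measurable h) (c : ℂ) (r : ℝ) :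
    circleLIntegral h c r ^ 2 ≤ ENNReal.ofReal r ^ 2 * (ENNReal.ofReal (2 * Real.pi) *
      ∫⁻ θ in Ioo (-Real.pi) Real.pi, h (circleMap c r θ) ^ 2) := by
  rw [circleLIntegral, mul_pow]
  gcongr
  have hm : Measurable fun θ => h (circleMap c r θ) :=
    hh.comp (continuous_circleMap c r).measurable
  have h1 := ENNReal.lintegral_mul_le_Lp_mul_Lq (volume.restrict (Ioo (-Real.pi) Real.pi))
    Real.HolderConjugate.two_two (f := fun _ => 1) (g := fun θ => h (circleMap c r θ))
    aemeasurable_const hm.aemeasurable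
  simp only [Pi.mul_apply, one_mul, ENNReal.one_rpow, lintegral_const, Measure.restrict_apply_univ,
    Real.volume_Ioo] at h1
  have h2 := pow_le_pow_left' h1 2
  rw [mul_pow, ← ENNReal.rpow_natCast, ← ENNReal.rpow_natCast, ← ENNReal.rpow_natCast,
    ← ENNReal.rpow_mul, ← ENNReal.rpow_mul] at h2
  norm_num at h2
  refine h2.trans (le_of_eq ?_)
  congr 3
  · ring

/-- Some circle with radius in `D` has small integral. -/
lemma exists_circleLIntegral_sq_le {h : ℂ → ℝ≥0∞} (hh : Measurable h) (c : ℂ) {D : Set ℝ}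
    (hD : MeasurableSet D) {s ε : ℝ} (hs : 0 < s) (hDs : D ⊆ Ioo 0 (1.5 * s)) (hsε : 1.5 * s ≤ ε)
    (hvol : ENNReal.ofReal (0.35 * s) ≤ volume D) :
    ∃ r ∈ D, circleLIntegral h c r ^ 2 ≤ 27 * ∫⁻ z in Metric.ball c ε, h z ^ 2 := by
  set F : ℝ → ℝ≥0∞ := fun r =>
    ENNReal.ofReal r * ∫⁻ θ in Ioo (-Real.pi) Real.pi, h (circleMap c r θ) ^ 2 with hF
  set E := ∫⁻ z in Metric.ball c ε, h z ^ 2 with hE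
  have hle : ∫⁻ r in D, F r ≤ E :=
    lintegral_polar_le (hh.pow_const 2) c hD (hDs.trans (Ioo_subset_Ioo_right hsε))
  have hs' : 0 < ENNReal.ofReal (0.35 * s) := by rw [ENNReal.ofReal_pos]; positivity
  have hFm : Measurable F := by
    refine ENNReal.measurable_ofReal.mul ?_
    refine Measurable.lintegral_prod_right' (f := fun p : ℝ × ℝ => h (circleMap c p.1 p.2) ^ 2) ?_
    refine (hh.comp ?_).pow_const 2
    unfold circleMap
    fun_prop
  obtain ⟨r, hr, hravg⟩ := exists_le_setLAverage (hs'.trans_le hvol).ne'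
    (measure_ne_top_of_subset hDs (by simp)) hFm.aemeasurable (f := F)
  refine ⟨r, hr, (circleLIntegral_sq_le hh c r).trans ?_⟩
  rw [setLAverage_eq] at hravg
  have h1 : F r ≤ E / ENNReal.ofReal (0.35 * s) := hravg.trans (by gcongr)
  -- The constant is 27 = 1.5 · 6.3 / 0.35, from r ≤ 1.5 s, 2π ≤ 6.3 and the lower bound for the
  -- measure of D.
  calc _ = ENNReal.ofReal r * ENNReal.ofReal (2 * Real.pi) * F r := by rw [hF]; ring
    _ ≤ ENNReal.ofReal (1.5 * s) * ENNReal.ofReal 6.3 * (E / ENNReal.ofReal (0.35 * s)) := by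
        gcongr
        · exact (hDs hr).2.le
        · linarith [Real.pi_lt_d2]
    _ = ENNReal.ofReal (27 * (0.35 * s)) * (E / ENNReal.ofReal (0.35 * s)) := by
        rw [← ENNReal.ofReal_mul (by positivity)]
        congr 2; ring
    _ = 27 * (ENNReal.ofReal (0.35 * s) * (E / ENNReal.ofReal (0.35 * s))) := by
        rw [ENNReal.ofReal_mul (by norm_num), mul_assoc]
        norm_num
    _ = 27 * E := by rw [ENNReal.mul_div_cancel hs'.ne' ENNReal.ofReal_ne_top]

end Transboundary

/-! ### The measure of the set of good radii -/

namespace CantorExample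
namespace Segments

open MeasureTheory

variable (S : Segments)

/-- From (1.1 q, 1.5 q) two intervals of length η are removed, one for each near endpoint. What
remains has measure at least 0.4 q - 2η ≥ 0.35 q, since η = ε_{k+2}/50 and 2.7 ε_{k+2} ≤ ε_{k+1} ≤
q. -/
lemma volume_goodRadii (s α κ : Fin 2) (w : List (Fin 2)) (v : List (Fin 4)) :
    ∃ D ⊆ S.goodRadii s α κ w v, MeasurableSet D ∧
      D ⊆ Ioo 0 (1.5 * S.innerRadius κ w.length) ∧
      ENNReal.ofReal (0.35 * S.innerRadius κ w.length) ≤ volume D := by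
  set q := S.innerRadius κ w.length with hq
  set η := S.ε (w.length + 2) / 50 with hη
  have h0 := S.ε_pos (w.length + 2)
  have h1 := S.ε_succ_le (w.length + 1)
  obtain ⟨h2, h3, h4⟩ := S.radii κ w.length
  rw [← hq] at h2 h3
  have hηq : 135 * η ≤ q := by rw [hη]; linarith
  have hη0 : 0 < η := by positivity
  set N : Fin 2 → ℝ := fun i => ‖S.nearEnd s (w ++ [α]) (v ++ [pairLetter κ i]) - S.hub s α w v‖
    with hN
  refine ⟨Ioo (1.1 * q) (1.5 * q) \ (Ioc (N 0) (N 0 + η) ∪ Ioc (N 1) (N 1 + η)), ?_, ?_, ?_, ?_⟩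
  · rintro r ⟨hr, hrN⟩
    refine ⟨⟨by linarith [hr.1], by linarith [hr.2]⟩, fun i hi => hrN ?_⟩
    have : r ∈ Ioc (N i) (N i + η) := ⟨hi.2, by linarith [hi.1]⟩
    fin_cases i
    · exact Or.inl this
    · exact Or.inr this
  · exact measurableSet_Ioo.diff (measurableSet_Ioc.union measurableSet_Ioc)
  · exact sdiff_subset.trans (Ioo_subset_Ioo_left (by linarith))
  · refine le_trans ?_ (le_measure_sdiff)
    refine le_trans ?_ (tsub_le_tsub_left (measure_union_le _ _) _)
    rw [Real.volume_Ioo, Real.volume_Ioc, Real.volume_Ioc, ← ENNReal.ofReal_add (by linarith)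
      (by linarith), ← ENNReal.ofReal_sub _ (by linarith)]
    apply ENNReal.ofReal_le_ofReal
    linarith

end Segments
end CantorExample

/-! ### Measurability on the plane and cutting paths to subpaths -/

namespace Transboundary

open MeasureTheory

lemma measurable_extend {G : Set (OnePoint ℂ)} (hG : MeasurableSet {z : ℂ | (z : OnePoint ℂ) ∈ G})
    {ρ : Hat G → ℝ≥0∞} (hρ : @Measurable (Hat G) ℝ≥0∞ (borel (Hat G)) _ ρ) :
    Measurable (extend G ρ) := by
  refine Measurable.indicator ?_ hG
  let _ : MeasurableSpace (Hat G) := borel (Hat G)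
  have : BorelSpace (Hat G) := ⟨rfl⟩
  exact hρ.comp (continuous_proj.comp OnePoint.continuous_coe).measurable

lemma lintegral_extend_sq {G : Set (OnePoint ℂ)}
    (hG : MeasurableSet {z : ℂ | (z : OnePoint ℂ) ∈ G}) (ρ : Hat G → ℝ≥0∞) :
    ∫⁻ z, extend G ρ z ^ 2 = ∫⁻ z in {z : ℂ | (z : OnePoint ℂ) ∈ G}, ρ (proj G z) ^ 2 := by
  rw [← lintegral_indicator hG]
  refine lintegral_congr fun z => ?_
  by_cases hz : (z : OnePoint ℂ) ∈ G <;> simp [extend, indicator, hz]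

/-- A path from `A` to `B` contains a subpath which leaves `A` and enters `B` only at its ends. -/
lemma exists_subinterval {X : Type*} [TopologicalSpace X] {f : ℝ → X} (hf : Continuous f)
    {A B : Set X} (hA : IsClosed A) (hB : IsClosed B) (hAB : Disjoint A B) {a : ℝ} (ha : 0 ≤ a)
    (h0 : f 0 ∈ A) (h1 : f a ∈ B) :
    ∃ s t, 0 ≤ s ∧ s < t ∧ t ≤ a ∧ f s ∈ A ∧ f t ∈ B ∧ ∀ x ∈ Ioo s t, f x ∉ A ∧ f x ∉ B := by
  set SA := Icc 0 a ∩ f ⁻¹' A with hSA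
  have hSAc : IsClosed SA := isClosed_Icc.inter (hA.preimage hf)
  have hSAb : BddAbove SA := ⟨a, fun x hx => hx.1.2⟩
  have hs : sSup SA ∈ SA := hSAc.csSup_mem ⟨0, ⟨le_rfl, ha⟩, h0⟩ hSAb
  set s := sSup SA
  set SB := Icc s a ∩ f ⁻¹' B with hSB
  have hSBc : IsClosed SB := isClosed_Icc.inter (hB.preimage hf)
  have hSBb : BddBelow SB := ⟨s, fun x hx => hx.1.1⟩
  have ht : sInf SB ∈ SB := hSBc.csInf_mem ⟨a, ⟨hs.1.2, le_rfl⟩, h1⟩ hSBb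
  set t := sInf SB
  refine ⟨s, t, hs.1.1, lt_of_le_of_ne ht.1.1 ?_, ht.1.2, hs.2, ht.2, fun x hx => ⟨fun hxA => ?_, fun hxB => ?_⟩⟩
  · intro heq
    exact Set.disjoint_left.1 hAB hs.2 (by rw [heq]; exact ht.2)
  · exact absurd (le_csSup hSAb ⟨⟨hs.1.1.trans hx.1.le, hx.2.le.trans ht.1.2⟩, hxA⟩) (not_le.2 hx.1)
  · exact absurd (csInf_le hSBb ⟨⟨hx.1.le, hx.2.le.trans ht.1.2⟩, hxB⟩) (not_le.2 hx.2)

end Transboundary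

namespace CantorExample
namespace Exhaustion

open Transboundary

variable (E : Exhaustion)

/-! ### The complementary components of `D_j` -/

/-- The indices `(m, w, v)` of the complementary components of `D_j` other than squares. -/
def indices (j : ℕ) : Set (Fin 3 × List (Fin 2) × List (Fin 4)) :=
  {t | t.2.1.length = t.2.2.length ∧ t.2.1.length < j}

lemma finite_indices (j : ℕ) : (indices j).Finite := by
  refine Set.Finite.subset (Set.finite_univ.prod
    ((List.finite_length_lt (Fin 2) j).prod (List.finite_length_lt (Fin 4) j))) ?_
  rintro ⟨m, w, v⟩ ⟨h1, h2⟩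
  exact ⟨mem_univ _, h2, show v.length < j by simp only at h1 h2; omega⟩

lemma coe_mem_Dj {j : ℕ} {z : ℂ} : (z : OnePoint ℂ) ∈ E.Dj j ↔
    (∀ w : List (Fin 2), w.length = j → z ∉ E.Q w) ∧
      ∀ t ∈ indices j, z ∉ closure (E.Um t.1 j t.2.1 t.2.2) := by
  rw [Dj, mem_compl_iff, OnePoint.coe_injective.mem_set_image]
  simp only [mem_union, mem_iUnion, not_or, not_exists]
  refine and_congr Iff.rfl ⟨fun h t ht => h t.1 t.2.1 t.2.2 ht.1 ht.2,
    fun h m w v h1 h2 => h (m, w, v) ⟨h1, h2⟩⟩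

lemma isClosed_union_components {j : ℕ} {T : Set (Fin 3 × List (Fin 2) × List (Fin 4))}
    (hT : T ⊆ indices j) : IsClosed (⋃ t ∈ T, closure (E.Um t.1 j t.2.1 t.2.2)) :=
  ((finite_indices j).subset hT).isClosed_biUnion fun _ _ => isClosed_closure

lemma isClosed_union_Q (j : ℕ) : IsClosed (⋃ w ∈ {w : List (Fin 2) | w.length = j}, E.Q w) :=
  (List.finite_length_eq (Fin 2) j).isClosed_biUnion fun w _ => E.isClosed_Q w

lemma measurableSet_Dj (j : ℕ) : MeasurableSet {z : ℂ | (z : OnePoint ℂ) ∈ E.Dj j} := by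
  have : {z : ℂ | (z : OnePoint ℂ) ∈ E.Dj j} =
      ((⋃ w ∈ {w : List (Fin 2) | w.length = j}, E.Q w) ∪
        ⋃ t ∈ indices j, closure (E.Um t.1 j t.2.1 t.2.2))ᶜ := by
    ext z
    rw [mem_ofPred_eq, coe_mem_Dj]
    simp only [mem_compl_iff, mem_union, mem_iUnion, not_or, not_exists, mem_ofPred_eq]
  rw [this]
  exact ((E.isClosed_union_Q j).union (E.isClosed_union_components le_rfl)).measurableSet.compl

/-- The component of the complement of `D_j` which contains `I_m(w, v)`. -/
def vertex (j : ℕ) (m : Fin 3) (w : List (Fin 2)) (v : List (Fin 4)) : Hat (E.Dj j) :=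
  proj (E.Dj j) (E.a m w v : ℂ)

variable {E}

lemma notMem_Dj {j m w v} (h : w.length = v.length) (hj : w.length < j) {z : ℂ}
    (hz : z ∈ closure (E.Um m j w v)) : (z : OnePoint ℂ) ∉ E.Dj j :=
  fun hD => (E.coe_mem_Dj.1 hD).2 (m, w, v) ⟨h, hj⟩ hz

lemma a_mem_closure {j} (m) {w v} (h : w.length = v.length) (hj : w.length < j) :
    E.a m w v ∈ closure (E.Um m j w v) :=
  subset_closure (E.I_subset_Um h hj (left_mem_segment ℝ _ _))

lemma proj_eq_vertex {j m w v} (h : w.length = v.length) (hj : w.length < j) {z : ℂ}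
    (hz : z ∈ closure (E.Um m j w v)) : proj (E.Dj j) (z : OnePoint ℂ) = E.vertex j m w v := by
  refine proj_eq_of_isPreconnected (C := (↑) '' closure (E.Um m j w v)) ?_ ?_ ⟨z, hz, rfl⟩
    ⟨_, a_mem_closure m h hj, rfl⟩
  · exact (E.isPreconnected_Um h hj).closure.image _ OnePoint.continuous_coe.continuousOn
  · rintro _ ⟨x, hx, rfl⟩
    exact notMem_Dj h hj hx

lemma vertex_mem_components {j} (m) {w v} (h : w.length = v.length) (hj : w.length < j) :
    E.vertex j m w v ∈ components (E.Dj j) :=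
  ⟨_, notMem_Dj h hj (a_mem_closure m h hj), rfl⟩

/-- For the words of maximal length the three segments are in the same component. -/
lemma vertex_eq_of_leaf {w : List (Fin 2)} {v : List (Fin 4)} (h : w.length = v.length)
    (m m' : Fin 3) : E.vertex (w.length + 1) m w v = E.vertex (w.length + 1) m' w v := by
  refine proj_eq_vertex h (by omega) ?_
  have := a_mem_closure (E := E) m h (show w.length < w.length + 1 by omega)
  rwa [E.Um_first m w v h, ← E.Um_first m' w v h] at this

/-- The closure of U(w,v) is disjoint from the finite closed union of the squares and of the pieces
with another index, and together they cover the complement of D_j. A connected subset of the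
complement therefore cannot leave the closure of U(w,v). -/
lemma vertex_injective {j m w v w' v'} (h : w.length = v.length) (hj : w.length < j)
    (h' : w'.length = v'.length) (hj' : w'.length < j)
    (heq : E.vertex j m w v = E.vertex j m w' v') : (w, v) = (w', v') := by
  by_contra hne
  have hx := a_mem_closure (E := E) m h hj
  have hy := a_mem_closure (E := E) m h' hj'
  have hdisj : ∀ {m' w' v'}, w'.length = v'.length → w'.length < j → (w, v) ≠ (w', v') →
      Disjoint (closure (E.U w v)) (closure (E.Um m' j w' v')) := fun h' hj' hne =>
    (E.disjoint_closure_U h h' hne).mono_right (E.closure_Um_subset_U h' hj')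
  have hxU := E.closure_Um_subset_U h hj hx
  rcases proj_eq_iff.1 heq with hxy | ⟨h1, h2, hC⟩
  · have hxy := OnePoint.coe_injective hxy
    rw [← hxy] at hy
    exact Set.disjoint_left.1 (hdisj h' hj' hne) hxU hy
  set C := connectedComponentIn (E.Dj j)ᶜ (E.a m w v : ℂ) with hCdef
  have hCsub : C ⊆ (E.Dj j)ᶜ := connectedComponentIn_subset _ _
  have hCr : C ⊆ range ((↑) : ℂ → OnePoint ℂ) := by
    intro z hz
    have := hCsub hz
    rw [Dj, compl_compl] at this
    exact image_subset_range _ _ this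
  -- The component avoids ∞, so the separation can be carried out in the plane.
  have hpre : IsPreconnected (((↑) : ℂ → OnePoint ℂ) ⁻¹' C) :=
    isPreconnected_connectedComponentIn.preimage_of_isOpenMap OnePoint.coe_injective
      OnePoint.isOpenEmbedding_coe.isOpenMap hCr
  have hcl : IsClosed ((⋃ u ∈ {u : List (Fin 2) | u.length = j}, E.Q u) ∪
      ⋃ t ∈ indices j ∩ {t | (w, v) ≠ t.2}, closure (E.Um t.1 j t.2.1 t.2.2)) :=
    (E.isClosed_union_Q j).union (E.isClosed_union_components inter_subset_left)
  have hsep : Disjoint (closure (E.U w v)) ((⋃ u ∈ {u : List (Fin 2) | u.length = j}, E.Q u) ∪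
      ⋃ t ∈ indices j ∩ {t | (w, v) ≠ t.2}, closure (E.Um t.1 j t.2.1 t.2.2)) := by
    simp only [disjoint_union_right, disjoint_iUnion_right]
    refine ⟨fun u hu => ?_, fun t ht => hdisj ht.1.1 ht.1.2 ht.2⟩
    have hu : u.length = j := hu
    exact (E.disjoint_collar_Q (by omega)).mono_left (E.U_subset w v h)
  have hcov : ((↑) : ℂ → OnePoint ℂ) ⁻¹' C ⊆ closure (E.U w v) ∪
      ((⋃ u ∈ {u : List (Fin 2) | u.length = j}, E.Q u) ∪
        ⋃ t ∈ indices j ∩ {t | (w, v) ≠ t.2}, closure (E.Um t.1 j t.2.1 t.2.2)) := by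
    intro z hz
    by_contra hcon
    refine hCsub hz (E.coe_mem_Dj.2 ⟨fun u hu hzu => hcon (Or.inr (Or.inl ?_)), fun t ht hzt => ?_⟩)
    · exact mem_biUnion (show u ∈ {u : List (Fin 2) | u.length = j} from hu) hzu
    · by_cases hwv : (w, v) = t.2
      · refine hcon (Or.inl ?_)
        rw [← hwv] at hzt
        exact E.closure_Um_subset_U h hj hzt
      · exact hcon (Or.inr (Or.inr (mem_biUnion (show t ∈ indices j ∩ {t | (w, v) ≠ t.2} from ⟨ht, hwv⟩) hzt)))
  rcases isPreconnected_iff_subset_of_disjoint_closed.1 hpre _ _ isClosed_closure hcl hcov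
      (by rw [hsep.inter_eq, inter_empty]) with hs | hs
  · have : E.a m w' v' ∈ closure (E.U w v) := hs (by
      rw [mem_preimage, hC]; exact mem_connectedComponentIn h2)
    exact Set.disjoint_left.1 (hdisj h' hj' hne) this hy
  · have := hs (show E.a m w v ∈ ((↑) : ℂ → OnePoint ℂ) ⁻¹' C from mem_connectedComponentIn h1)
    exact Set.disjoint_left.1 hsep hxU this

end Exhaustion
end CantorExample

/-! ### Joining neighbouring components by arcs in D_j -/

namespace CantorExample
namespace Exhaustion

open Transboundary MeasureTheory

variable (E : Exhaustion)

lemma circle_mem_Dj (s α κ β : Fin 2) {w : List (Fin 2)} {v : List (Fin 4)}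
    (h : w.length = v.length) {u : ℂ} {σ a : Fin 2 → ℝ → ℝ}
    (H : ArcPair (E.hub s α w v) u (E.innerRadius κ w.length)
      (E.outerRadius κ w.length) (E.I (hubIndex s α) w v) (E.segmentsUpTo (w.length + 1))
      (fun i => E.I (endIndex s) (w ++ [α]) (v ++ [pairLetter κ i])) σ a)
    {r : ℝ} (hr : r ∈ E.goodRadii s α κ w v) {j : ℕ} (hj : w.length + 2 ≤ j) {z : ℂ}
    (hzr : ‖z - E.hub s α w v‖ = r) (hz : dirFrom (E.hub s α w v) z ∈ arcDir u (σ β r) (a β r))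
    (hA : z ∉ closure (E.Um (hubIndex s α) j w v))
    (hB : z ∉ closure (E.Um (endIndex s) j (w ++ [α]) (v ++ [pairLetter κ β]))) :
    (z : OnePoint ℂ) ∈ E.Dj j := by
  refine E.coe_mem_Dj.2 ⟨fun w' hw' => ?_, fun t ht hzt => ?_⟩
  · refine E.notMem_Q_of_near_hub s α h ?_ (by omega)
    rw [hzr]
    linarith [hr.1.2, (E.radii κ w.length).2.2, E.ε_pos (w.length + 2)]
  · rcases E.arc_avoids_components s α κ β h H hr hj hzr hz ht.1 ht.2 hzt with h1 | h1
    · exact hA h1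
    · exact hB h1

/-- Every component of `D_j` at a hub is joined to the components of the next generation by circular
arcs with small integral, in both directions. -/
lemma exists_joins_arc (s α : Fin 2) (β : Fin 4) {w : List (Fin 2)} {v : List (Fin 4)}
    (h : w.length = v.length) {j : ℕ} (hj : w.length + 2 ≤ j) {ρ : Hat (E.Dj j) → ℝ≥0∞}
    (hρ : Measurable (extend (E.Dj j) ρ)) :
    ∃ ℓ : ℝ≥0∞, ℓ ^ 2 ≤ 27 * ∫⁻ z in Metric.ball (E.hub s α w v) (E.ε w.length),
        extend (E.Dj j) ρ z ^ 2 ∧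
      Joins ρ (E.vertex j (hubIndex s α) w v) (E.vertex j (endIndex s) (w ++ [α]) (v ++ [β]))
        (ℓ + ρ (E.vertex j (hubIndex s α) w v) +
          ρ (E.vertex j (endIndex s) (w ++ [α]) (v ++ [β]))) ∧
      Joins ρ (E.vertex j (endIndex s) (w ++ [α]) (v ++ [β])) (E.vertex j (hubIndex s α) w v)
        (ℓ + ρ (E.vertex j (endIndex s) (w ++ [α]) (v ++ [β])) +
          ρ (E.vertex j (hubIndex s α) w v)) := by
  obtain ⟨κ, β, rfl⟩ := exists_pairLetter β
  obtain ⟨u, σ, a, H⟩ := E.exists_arcPair s α κ h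
  obtain ⟨D, hDgood, hDm, hDs, hDvol⟩ := E.volume_goodRadii s α κ w v
  have hrad := E.radii κ w.length
  obtain ⟨r, hrD, hle⟩ := exists_circleLIntegral_sq_le hρ (E.hub s α w v) hDm
    ((E.ε_pos _).trans_le hrad.1) hDs (ε := E.ε w.length)
    (by linarith [E.ε_pos (w.length + 1)]) hDvol
  refine ⟨_, hle, ?_⟩
  have hr := hDgood hrD
  have hr0 : 0 < r := (hDs hrD).1
  have hr1 : r ∈ Ioo (E.innerRadius κ w.length) (E.outerRadius κ w.length) :=
    ⟨by linarith [hr.1.1, E.ε_pos (w.length + 2)], by linarith [hr.1.2, E.ε_pos (w.length + 2)]⟩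
  have hwα : (w ++ [α]).length = (v ++ [pairLetter κ β]).length := by simp [h]
  have hjα : (w ++ [α]).length < j := by simp; omega
  have hjw : w.length < j := by omega
  obtain ⟨θ, hθ⟩ := (Complex.norm_eq_one_iff u).1 H.norm_u
  obtain ⟨ha0, ha⟩ := H.length β r hr1
  set c := E.hub s α w v with hc
  set f : ℝ → ℂ := fun x => circleMap c r (σ β r * x + θ) with hf
  have hfx : ∀ x, f x = c + (r : ℂ) * (u * Complex.exp ((σ β r * x : ℝ) * Complex.I)) := by
    intro x
    simp only [hf, circleMap, ← hθ]
    rw [← Complex.exp_add]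
    congr 3
    push_cast; ring
  have hfc : Continuous f := (continuous_circleMap c r).comp (by fun_prop)
  have hA0 : f 0 ∈ closure (E.Um (hubIndex s α) j w v) := by
    rw [hfx]
    refine subset_closure (E.I_subset_Um h (by omega) ?_)
    simpa using H.start_mem r hr1
  have hBa : f (a β r) ∈ closure (E.Um (endIndex s) j (w ++ [α]) (v ++ [pairLetter κ β])) := by
    rw [hfx]
    exact subset_closure (E.I_subset_Um hwα hjα (H.end_mem β r hr1))
  have hAB : Disjoint (closure (E.Um (hubIndex s α) j w v))
      (closure (E.Um (endIndex s) j (w ++ [α]) (v ++ [pairLetter κ β]))) := by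
    refine (E.disjoint_closure_U h hwα ?_).mono (E.closure_Um_subset_U h hjw)
      (E.closure_Um_subset_U hwα hjα)
    intro heq
    have := congrArg (fun x => x.1.length) heq
    simp at this
  -- The arc may enter and leave the components at its ends several times. Between the last exit
  -- from the first and the next entrance into the second it is in D_j.
  obtain ⟨x₁, x₂, h1, h2, h3, hx₁, hx₂, hfree⟩ :=
    exists_subinterval hfc isClosed_closure isClosed_closure hAB ha0.le hA0 hBa
  have hmem : ∀ x ∈ Ioo x₁ x₂, (f x : OnePoint ℂ) ∈ E.Dj j := by
    intro x hx
    refine E.circle_mem_Dj s α κ β h H hr hj (z := f x) ?_ ?_ (hfree x hx).1 (hfree x hx).2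
    · rw [hfx]; exact norm_add_mul_sub hr0.le (norm_mul_exp H.norm_u _)
    · rw [hfx, dirFrom_add_mul hr0 (norm_mul_exp H.norm_u _)]
      exact ⟨x, ⟨h1.trans_lt hx.1, hx.2.trans_le h3⟩, rfl⟩
  have hσ : |σ β r| = 1 := by rcases H.sign β r hr1 with h | h <;> rw [h] <;> simp
  have hσ0 : σ β r ≠ 0 := by intro h; rw [h] at hσ; simp at hσ
  have hne : σ β r * x₁ + θ ≠ σ β r * x₂ + θ := fun heq =>
    h2.ne (mul_left_cancel₀ hσ0 (add_right_cancel heq))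
  have hlen : |σ β r * x₂ + θ - (σ β r * x₁ + θ)| ≤ 2 * Real.pi := by
    have : σ β r * x₂ + θ - (σ β r * x₁ + θ) = σ β r * (x₂ - x₁) := by ring
    rw [this, abs_mul, hσ, one_mul, abs_of_pos (sub_pos.2 h2)]
    linarith
  have p1 := proj_eq_vertex h hjw hx₁
  have p2 := proj_eq_vertex hwα hjα hx₂
  rw [← p1, ← p2]
  constructor
  · refine Joins.of_arc ρ hr0 hne hlen (notMem_Dj h hjw hx₁) (notMem_Dj hwα hjα hx₂) fun t ht => ?_
    have := hmem (x₁ + (x₂ - x₁) * t) ⟨by nlinarith [ht.1], by nlinarith [ht.2]⟩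
    convert this using 2
    simp only [hf]; congr 1; ring
  · refine Joins.of_arc ρ hr0 hne.symm (by rwa [abs_sub_comm]) (notMem_Dj hwα hjα hx₂)
      (notMem_Dj h hjw hx₁) fun t ht => ?_
    have := hmem (x₂ - (x₂ - x₁) * t) ⟨by nlinarith [ht.2], by nlinarith [ht.1]⟩
    convert this using 2
    simp only [hf]; congr 1; ring

end Exhaustion
end CantorExample

namespace Transboundary

/-! ### Averaging over a tree -/

lemma sq_sum_le {ι : Type*} (s : Finset ι) (f : ι → ℝ≥0∞) :
    (∑ i ∈ s, f i) ^ 2 ≤ s.card * ∑ i ∈ s, f i ^ 2 := by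
  have h := ENNReal.rpow_sum_le_const_mul_sum_rpow s f (p := 2) (by norm_num)
  norm_num at h
  exact h

lemma add_sq_le (a b : ℝ≥0∞) : (a + b) ^ 2 ≤ 2 * (a ^ 2 + b ^ 2) := by
  simpa using sq_sum_le Finset.univ ![a, b]

lemma div_four_sq (a : ℝ≥0∞) : (a / 4) ^ 2 = a ^ 2 / 16 := by
  rw [div_eq_mul_inv, mul_pow, ← ENNReal.inv_pow, ← div_eq_mul_inv]
  norm_num

lemma exists_le_average (g : Fin 4 → ℝ≥0∞) : ∃ β, g β ≤ (∑ β, g β) / 4 := by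
  obtain ⟨β, hβ⟩ := Finite.exists_min g
  refine ⟨β, ?_⟩
  rw [ENNReal.le_div_iff_mul_le (by simp) (by simp), mul_comm]
  have := Finset.card_nsmul_le_sum Finset.univ g (g β) fun x _ => hβ x
  simpa using this

/-- The sum of `X` over a random branch of length `N + 1` in the subtree of `u`, where the two
children of a node with a given first letter are both followed. -/
def branchSum (X : List (Fin 2 × Fin 4) → ℝ≥0∞) : ℕ → List (Fin 2 × Fin 4) → ℝ≥0∞
  | 0, u => X u
  | N + 1, u => X u + (∑ p, branchSum X N (u ++ [p])) / 4

lemma le_branchSum (X : List (Fin 2 × Fin 4) → ℝ≥0∞) (N : ℕ) (u : List (Fin 2 × Fin 4)) :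
    X u ≤ branchSum X N u := by
  cases N with
  | zero => exact le_rfl
  | succ N => exact le_self_add

lemma tsum_list_ge {A : Type*} [Fintype A] (g : List A → ℝ≥0∞) :
    g [] + ∑ p, ∑' z, g (p :: z) ≤ ∑' z, g z := by
  classical
  rw [ENNReal.tsum_eq_add_tsum_ite (f := g) []]
  gcongr
  have hinj : Function.Injective fun q : A × List A => q.1 :: q.2 := by
    rintro ⟨p, z⟩ ⟨p', z'⟩ h
    simpa using h
  refine le_trans (le_of_eq ?_)
    (ENNReal.tsum_comp_le_tsum_of_injective hinj _)
  rw [ENNReal.tsum_prod', tsum_fintype]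
  simp

/-- Eight children averaged with weight 1/4 give the factor 8/16 = 1/2 in Cauchy-Schwarz. It cancels
the 2 of the induction hypothesis, and (a + b)² ≤ 2 (a² + b²) restores that 2, so nothing grows with
N. -/
lemma branchSum_sq_le (X : List (Fin 2 × Fin 4) → ℝ≥0∞) (N : ℕ) (u : List (Fin 2 × Fin 4)) :
    branchSum X N u ^ 2 ≤ 2 * ∑' z, X (u ++ z) ^ 2 := by
  induction N generalizing u with
  | zero =>
    have h1 : X u ^ 2 ≤ ∑' z, X (u ++ z) ^ 2 := by
      simpa using ENNReal.le_tsum (f := fun z => X (u ++ z) ^ 2) []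
    exact h1.trans (le_mul_of_one_le_left' (by norm_num))
  | succ N ih =>
    have h1 : ((∑ p, branchSum X N (u ++ [p])) / 4) ^ 2 ≤ ∑ p, ∑' z, X (u ++ p :: z) ^ 2 := by
      rw [div_four_sq]
      refine ENNReal.div_le_of_le_mul ?_
      refine (sq_sum_le Finset.univ _).trans ?_
      calc _ ≤ (Finset.univ : Finset (Fin 2 × Fin 4)).card *
            ∑ p : Fin 2 × Fin 4, 2 * ∑' z, X (u ++ [p] ++ z) ^ 2 := by
            gcongr with p; exact ih _
        _ = _ := by
            simp only [Finset.card_univ, Fintype.card_prod, Fintype.card_fin, List.append_assoc,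
              List.singleton_append]
            rw [← Finset.mul_sum, ← mul_assoc, mul_comm]
            norm_num
    calc _ ≤ 2 * (X u ^ 2 + ((∑ p, branchSum X N (u ++ [p])) / 4) ^ 2) := add_sq_le _ _
      _ ≤ 2 * (X (u ++ []) ^ 2 + ∑ p, ∑' z, X (u ++ p :: z) ^ 2) := by
          rw [List.append_nil]; gcongr
      _ ≤ _ := by
          gcongr
          exact tsum_list_ge fun z => X (u ++ z) ^ 2

/-- The mass attached to a node: the three components and the average mass of the arcs. -/
def nodeMass (r : Fin 3 → List (Fin 2 × Fin 4) → ℝ≥0∞)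
    (ℓ : Fin 2 → Fin 2 → Fin 4 → List (Fin 2 × Fin 4) → ℝ≥0∞) (u : List (Fin 2 × Fin 4)) : ℝ≥0∞ :=
  2 * (∑ m, r m u) + (∑ i : Fin 2 × Fin 2 × Fin 4, ℓ i.1 i.2.1 i.2.2 u) / 4

/-- Here 24 = 2 · 2² · 3, and the 16 triples (s, α, β) cancel against (1/4)² = 1/16. -/
lemma nodeMass_sq_le (r : Fin 3 → List (Fin 2 × Fin 4) → ℝ≥0∞)
    (ℓ : Fin 2 → Fin 2 → Fin 4 → List (Fin 2 × Fin 4) → ℝ≥0∞) (u : List (Fin 2 × Fin 4)) :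
    nodeMass r ℓ u ^ 2 ≤ 24 * ∑ m, r m u ^ 2 +
      2 * ∑ i : Fin 2 × Fin 2 × Fin 4, ℓ i.1 i.2.1 i.2.2 u ^ 2 := by
  have h1 := sq_sum_le Finset.univ fun m => r m u
  have h2 := sq_sum_le Finset.univ fun i : Fin 2 × Fin 2 × Fin 4 => ℓ i.1 i.2.1 i.2.2 u
  simp only [Finset.card_univ, Fintype.card_prod, Fintype.card_fin] at h1 h2
  refine (add_sq_le _ _).trans ?_
  rw [mul_add]
  refine add_le_add ?_ ?_
  · rw [mul_pow, ← mul_assoc]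
    calc _ ≤ 2 * 2 ^ 2 * ((3 : ℕ) * ∑ m, r m u ^ 2) := by gcongr
      _ = _ := by rw [← mul_assoc]; norm_num
  · rw [div_four_sq]
    refine mul_le_mul' le_rfl ?_
    refine ENNReal.div_le_of_le_mul (h2.trans (le_of_eq ?_))
    rw [mul_comm]
    norm_num

/-- Regrouped by α, one level shows for each α an average over the four letters β, which bounds the
cost of the best β. -/
lemma branchSum_succ (r : Fin 3 → List (Fin 2 × Fin 4) → ℝ≥0∞)
    (ℓ : Fin 2 → Fin 2 → Fin 4 → List (Fin 2 × Fin 4) → ℝ≥0∞) (N : ℕ) (u : List (Fin 2 × Fin 4)) :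
    branchSum (nodeMass r ℓ) (N + 1) u = 2 * (∑ m, r m u) +
      ∑ α, (∑ β, (ℓ 0 α β u + ℓ 1 α β u + branchSum (nodeMass r ℓ) N (u ++ [(α, β)]))) / 4 := by
  simp only [branchSum]
  nth_rewrite 1 [nodeMass]
  simp only [Fintype.sum_prod_type, Fin.sum_univ_two, div_eq_mul_inv, Finset.sum_add_distrib]
  ring

/-- A tree of complementary components, three at each node, which are joined by arcs of small
mass. -/
structure Network {G : Set (OnePoint ℂ)} (ρ : Hat G → ℝ≥0∞) (j : ℕ)
    (P : Fin 3 → List (Fin 2 × Fin 4) → Hat G) (r : Fin 3 → List (Fin 2 × Fin 4) → ℝ≥0∞)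
    (ℓ : Fin 2 → Fin 2 → Fin 4 → List (Fin 2 × Fin 4) → ℝ≥0∞) : Prop where
  mem : ∀ m u, u.length < j → P m u ∈ components G
  mass : ∀ m u, u.length < j → ρ (P m u) = r m u
  leaf : ∀ u, u.length + 1 = j → P 0 u = P 2 u
  down : ∀ s α β u, u.length + 2 ≤ j →
    Joins ρ (P (CantorExample.hubIndex s α) u) (P (CantorExample.endIndex s) (u ++ [(α, β)]))
      (ℓ s α β u + r (CantorExample.hubIndex s α) u +
        r (CantorExample.endIndex s) (u ++ [(α, β)]))
  up : ∀ s α β u, u.length + 2 ≤ j →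
    Joins ρ (P (CantorExample.endIndex s) (u ++ [(α, β)])) (P (CantorExample.hubIndex s α) u)
      (ℓ s α β u + r (CantorExample.endIndex s) (u ++ [(α, β)]) +
        r (CantorExample.hubIndex s α) u)

namespace Network

variable {G : Set (OnePoint ℂ)} {ρ : Hat G → ℝ≥0∞} {j : ℕ}
  {P : Fin 3 → List (Fin 2 × Fin 4) → Hat G} {r : Fin 3 → List (Fin 2 × Fin 4) → ℝ≥0∞}
  {ℓ : Fin 2 → Fin 2 → Fin 4 → List (Fin 2 × Fin 4) → ℝ≥0∞}

/-- If the first components at the children of a node can be joined to the last ones, then the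
components at the node can be joined by passing through a child. -/
lemma detour (H : Network ρ j P r ℓ) (α : Fin 2) (β : Fin 4) {u : List (Fin 2 × Fin 4)}
    (hu : u.length + 2 ≤ j) {M : ℝ≥0∞}
    (hM : Joins ρ (P 0 (u ++ [(α, β)])) (P 2 (u ++ [(α, β)])) M) :
    Joins ρ (P α.castSucc u) (P α.succ u) (r α.castSucc u + r α.succ u + (ℓ 0 α β u + ℓ 1 α β u +
      (M + r 0 (u ++ [(α, β)]) + r 2 (u ++ [(α, β)])))) := by
  have h := ((H.down 0 α β u hu).trans hM).trans (H.up 1 α β u hu)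
  refine h.mono (le_of_eq ?_)
  simp [CantorExample.hubIndex, CantorExample.endIndex]
  ring

lemma nodeMass_ge (u : List (Fin 2 × Fin 4)) (m m' : Fin 3) (h : m ≠ m') :
    2 * r m u + 2 * r m' u ≤ nodeMass r ℓ u := by
  rw [← mul_add, ← Finset.sum_pair (f := fun m => r m u) h]
  refine le_trans ?_ le_self_add
  gcongr
  exact Finset.subset_univ _

/-- The arcs arriving at and leaving the node count its ends once more, hence the extra terms. The
two detours count r 0, r 1 twice and r 2; with the extra terms this is exactly the 2 ∑ r of
`nodeMass`. At a leaf the constant path suffices. -/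
lemma exists_pass (H : Network ρ j P r ℓ) (N : ℕ) {u : List (Fin 2 × Fin 4)}
    (hu : u.length + N + 1 = j) :
    ∃ M, Joins ρ (P 0 u) (P 2 u) M ∧ M + r 0 u + r 2 u ≤ branchSum (nodeMass r ℓ) N u := by
  induction N generalizing u with
  | zero =>
    refine ⟨r 0 u, ?_, ?_⟩
    · have h0 : u.length < j := by omega
      have h := Joins.refl ρ (H.mem 0 u h0)
      rw [H.mass 0 u h0] at h
      rwa [← H.leaf u (by omega)]
    · refine le_trans ?_ (nodeMass_ge u 0 2 (by decide))
      rw [two_mul, two_mul]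
      gcongr
      exact le_self_add
  | succ N ih =>
    have hu2 : u.length + 2 ≤ j := by omega
    have hchild : ∀ p : Fin 2 × Fin 4, (u ++ [p]).length + N + 1 = j := by
      intro p; simp; omega
    choose M hM hMle using fun p => ih (hchild p)
    choose β hβ using fun α => exists_le_average fun β => ℓ 0 α β u + ℓ 1 α β u +
      branchSum (nodeMass r ℓ) N (u ++ [(α, β)])
    refine ⟨_, (H.detour 0 (β 0) hu2 (hM _)).trans (H.detour 1 (β 1) hu2 (hM _)), ?_⟩
    rw [branchSum_succ]
    have key : ∀ α, ℓ 0 α (β α) u + ℓ 1 α (β α) u + (M (α, β α) + r 0 (u ++ [(α, β α)]) +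
        r 2 (u ++ [(α, β α)])) ≤
        (∑ b, (ℓ 0 α b u + ℓ 1 α b u + branchSum (nodeMass r ℓ) N (u ++ [(α, b)]))) / 4 :=
      fun α => (add_le_add le_rfl (hMle _)).trans (hβ α)
    have h01 := add_le_add (key 0) (key 1)
    rw [Fin.sum_univ_two]
    refine le_trans (le_of_eq ?_) (add_le_add_right h01 _)
    simp [Fin.sum_univ_three]
    ring

/-- For the letter 0 one descends at once. For the letter 1 the second component must first be
reached by a detour through the child 0. At most one child is used for each α, so the averages of
`branchSum` pay for it. -/
lemma exists_reach (H : Network ρ j P r ℓ) (z : List (Fin 2)) (N : ℕ) {u : List (Fin 2 × Fin 4)}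
    (hu : u.length + N + 1 = j) (hz : z.length ≤ N) :
    ∃ u', u'.map Prod.fst = u.map Prod.fst ++ z ∧ ∃ M, Joins ρ (P 0 u) (P 0 u') M ∧
      M + r 0 u ≤ branchSum (nodeMass r ℓ) N u := by
  induction z generalizing N u with
  | nil =>
    have h0 : u.length < j := by omega
    have h := Joins.refl ρ (H.mem 0 u h0)
    rw [H.mass 0 u h0] at h
    refine ⟨u, by simp, _, h, ?_⟩
    refine le_trans ?_ (le_branchSum _ _ _)
    refine le_trans ?_ (nodeMass_ge u 0 2 (by decide))
    rw [← two_mul]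
    exact le_self_add
  | cons α z ih =>
    obtain ⟨N, rfl⟩ : ∃ N', N = N' + 1 := ⟨N - 1, by simp at hz; omega⟩
    have hz' : z.length ≤ N := by simpa using hz
    have hu2 : u.length + 2 ≤ j := by omega
    have hchild : ∀ p : Fin 2 × Fin 4, (u ++ [p]).length + N + 1 = j := by
      intro p; simp; omega
    choose M hM hMle using fun p => H.exists_pass N (hchild p)
    choose β hβ using fun α => exists_le_average fun β => ℓ 0 α β u + ℓ 1 α β u +
      branchSum (nodeMass r ℓ) N (u ++ [(α, β)])
    obtain ⟨u', hu', M', hM', hMle'⟩ := ih N (hchild (α, β α)) hz'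
    have hlast := (H.down 0 α (β α) u hu2).trans hM'
    have key : ℓ 0 α (β α) u + (M' + r 0 (u ++ [(α, β α)])) ≤
        (∑ b, (ℓ 0 α b u + ℓ 1 α b u + branchSum (nodeMass r ℓ) N (u ++ [(α, b)]))) / 4 :=
      (add_le_add le_self_add hMle').trans (hβ α)
    have key0 : ∀ α, ℓ 0 α (β α) u + ℓ 1 α (β α) u + (M (α, β α) + r 0 (u ++ [(α, β α)]) +
        r 2 (u ++ [(α, β α)])) ≤
        (∑ b, (ℓ 0 α b u + ℓ 1 α b u + branchSum (nodeMass r ℓ) N (u ++ [(α, b)]))) / 4 :=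
      fun α => (add_le_add le_rfl (hMle _)).trans (hβ α)
    refine ⟨u', by simp [hu'], ?_⟩
    rw [branchSum_succ, Fin.sum_univ_two]
    have hα : α = 0 ∨ α = 1 := by omega
    simp only [CantorExample.hubIndex, CantorExample.endIndex, if_true] at hlast
    rcases hα with rfl | rfl
    · refine ⟨_, hlast, ?_⟩
      have h0 : 2 * r 0 u ≤ 2 * ∑ m, r m u := by
        gcongr
        exact Finset.single_le_sum_of_canonicallyOrdered (f := fun m => r m u) (Finset.mem_univ 0)
      refine le_trans (le_of_eq ?_) (add_le_add h0 (key.trans le_self_add))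
      simp only [Fin.castSucc_zero]
      ring
    · refine ⟨_, (H.detour 0 (β 0) hu2 (hM _)).trans hlast, ?_⟩
      have h0 : 2 * (r 0 u + r 1 u) ≤ 2 * ∑ m, r m u := by
        rw [Fin.sum_univ_three]
        exact mul_le_mul' le_rfl le_self_add
      refine le_trans (le_of_eq ?_) (add_le_add h0 (add_le_add (key0 0) key))
      simp only [Fin.castSucc_zero, Fin.castSucc_one, Fin.succ_zero_eq_one]
      ring

end Network

end Transboundary

namespace CantorExample
namespace Exhaustion

open Transboundary MeasureTheory

variable (E : Exhaustion)

/-! ### The estimate of the modulus -/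

lemma word_length (u : List (Fin 2 × Fin 4)) : (u.map Prod.fst).length = (u.map Prod.snd).length := by
  simp

lemma word_injective {u u' : List (Fin 2 × Fin 4)}
    (h : (u.map Prod.fst, u.map Prod.snd) = (u'.map Prod.fst, u'.map Prod.snd)) : u = u' := by
  simp only [Prod.mk.injEq] at h
  simpa [List.zip_map'] using congrArg₂ List.zip h.1 h.2

/-- The component of the complement of `D_j` with the index `(m, u)`. -/
def node (j : ℕ) (m : Fin 3) (u : List (Fin 2 × Fin 4)) : Hat (E.Dj j) :=
  E.vertex j m (u.map Prod.fst) (u.map Prod.snd)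

/-- The value of `ρ` at the component with the index `(m, u)`. -/
def nodeValue {j : ℕ} (ρ : Hat (E.Dj j) → ℝ≥0∞) (m : Fin 3) (u : List (Fin 2 × Fin 4)) : ℝ≥0∞ :=
  if u.length < j then ρ (E.node j m u) else 0

/-- For fixed m the nodes inject into the components. Each m is treated separately because at the
leaves the three components coincide. -/
lemma tsum_nodeValue_sq_le {j : ℕ} (ρ : Hat (E.Dj j) → ℝ≥0∞) (m : Fin 3) :
    ∑' u, E.nodeValue ρ m u ^ 2 ≤ ∑' p : components (E.Dj j), ρ p ^ 2 := by
  set T : Set (List (Fin 2 × Fin 4)) := {u | u.length < j} with hT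
  have hT' : ∀ u : T, (u : List (Fin 2 × Fin 4)).length < j := fun u => u.2
  have h1 : ∑' u, E.nodeValue ρ m u ^ 2 = ∑' u : T, ρ (E.node j m u) ^ 2 := by
    rw [tsum_subtype T fun u => ρ (E.node j m u) ^ 2]
    refine tsum_congr fun u => ?_
    by_cases hu : u.length < j <;> simp [nodeValue, hT, indicator, hu]
  rw [h1]
  set f : T → components (E.Dj j) := fun u => ⟨E.node j m u,
    vertex_mem_components m (word_length _) (by simpa using hT' u)⟩ with hf
  have hinj : Function.Injective f := by
    intro u u' h
    refine Subtype.ext (word_injective (vertex_injective (E := E) (word_length _)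
      (by simpa using hT' u) (word_length _) (by simpa using hT' u') (congrArg Subtype.val h)))
  exact ENNReal.tsum_comp_le_tsum_of_injective hinj fun p => ρ p ^ 2

lemma tsum_ball_le (s α : Fin 2) (g : ℂ → ℝ≥0∞) :
    ∑' u : List (Fin 2 × Fin 4), ∫⁻ z in Metric.ball
      (E.hub s α (u.map Prod.fst) (u.map Prod.snd)) (E.ε (u.map Prod.fst).length), g z ≤
      ∫⁻ z, g z := by
  rw [← lintegral_iUnion (fun _ => Metric.isOpen_ball.measurableSet)]
  · exact setLIntegral_le_lintegral _ _
  · intro u u' hne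
    exact E.disjoint_balls s α (word_length u) (word_length u') fun h => hne (word_injective h)

lemma exists_network (j : ℕ) {ρ : Hat (E.Dj j) → ℝ≥0∞} (hρ : Measurable (extend (E.Dj j) ρ)) :
    ∃ ℓ, Network ρ j (E.node j) (E.nodeValue ρ) ℓ ∧
      ∀ s α β, ∑' u, ℓ s α β u ^ 2 ≤ 27 * ∫⁻ z, extend (E.Dj j) ρ z ^ 2 := by
  have hex : ∀ (s α : Fin 2) (β : Fin 4) (u : List (Fin 2 × Fin 4)), ∃ ℓ : ℝ≥0∞,
      ℓ ^ 2 ≤ 27 * ∫⁻ z in Metric.ball (E.hub s α (u.map Prod.fst) (u.map Prod.snd))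
        (E.ε (u.map Prod.fst).length), extend (E.Dj j) ρ z ^ 2 ∧
      (u.length + 2 ≤ j →
        Joins ρ (E.node j (hubIndex s α) u) (E.node j (endIndex s) (u ++ [(α, β)]))
          (ℓ + E.nodeValue ρ (hubIndex s α) u + E.nodeValue ρ (endIndex s) (u ++ [(α, β)])) ∧
        Joins ρ (E.node j (endIndex s) (u ++ [(α, β)])) (E.node j (hubIndex s α) u)
          (ℓ + E.nodeValue ρ (endIndex s) (u ++ [(α, β)]) + E.nodeValue ρ (hubIndex s α) u)) := by
    intro s α β u
    by_cases hu : u.length + 2 ≤ j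
    · obtain ⟨ℓ, h1, h2, h3⟩ := E.exists_joins_arc s α β (word_length u) (j := j) (by simpa using hu) hρ
      refine ⟨ℓ, h1, fun _ => ?_⟩
      have e1 : ∀ m, E.nodeValue ρ m u = ρ (E.node j m u) := fun m => if_pos (by omega)
      have e2 : ∀ m, E.nodeValue ρ m (u ++ [(α, β)]) = ρ (E.node j m (u ++ [(α, β)])) :=
        fun m => if_pos (by simp; omega)
      rw [e1, e2]
      simp only [node, List.map_append, List.map_cons, List.map_nil]
      exact ⟨h2, h3⟩
    -- Beyond the last generation the arc mass is set to zero, so sums may run over all words.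
    · exact ⟨0, by simp, fun h => absurd h hu⟩
  choose ℓ hℓ hJ using hex
  refine ⟨ℓ, ⟨?_, ?_, ?_, ?_, ?_⟩, ?_⟩
  · exact fun m u hu => vertex_mem_components m (word_length u) (by simpa using hu)
  · exact fun m u hu => (if_pos hu).symm
  · intro u hu
    have hj : j = (u.map Prod.fst).length + 1 := by simp [hu]
    subst hj
    exact vertex_eq_of_leaf (word_length u) 0 2
  · exact fun s α β u hu => (hJ s α β u hu).1
  · exact fun s α β u hu => (hJ s α β u hu).2
  · intro s α β
    refine (ENNReal.tsum_le_tsum fun u => hℓ s α β u).trans ?_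
    rw [ENNReal.tsum_mul_left]
    gcongr
    exact E.tsum_ball_le s α _

/-- The constants are 72 = 24 · 3 for the components and 864 = 2 · 16 · 27 for the arcs. -/
lemma tsum_nodeMass_sq_le {j : ℕ} {ρ : Hat (E.Dj j) → ℝ≥0∞}
    {ℓ : Fin 2 → Fin 2 → Fin 4 → List (Fin 2 × Fin 4) → ℝ≥0∞}
    (hℓ : ∀ s α β, ∑' u, ℓ s α β u ^ 2 ≤ 27 * ∫⁻ z, extend (E.Dj j) ρ z ^ 2) :
    ∑' u, nodeMass (E.nodeValue ρ) ℓ u ^ 2 ≤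
      864 * ((∫⁻ z, extend (E.Dj j) ρ z ^ 2) + ∑' p : components (E.Dj j), ρ p ^ 2) := by
  refine (ENNReal.tsum_le_tsum fun u => nodeMass_sq_le _ _ u).trans ?_
  rw [ENNReal.tsum_add, ENNReal.tsum_mul_left, ENNReal.tsum_mul_left,
    Summable.tsum_finsetSum (fun _ _ => ENNReal.summable),
    Summable.tsum_finsetSum (fun _ _ => ENNReal.summable)]
  have h1 := Finset.sum_le_card_nsmul Finset.univ _ _ fun m _ => E.tsum_nodeValue_sq_le ρ m
  have h2 := Finset.sum_le_card_nsmul Finset.univ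
    (fun i : Fin 2 × Fin 2 × Fin 4 => ∑' u, ℓ i.1 i.2.1 i.2.2 u ^ 2) _
    fun i _ => hℓ i.1 i.2.1 i.2.2
  simp only [Finset.card_univ, Fintype.card_prod, Fintype.card_fin, nsmul_eq_mul] at h1 h2
  set V := ∑' p : components (E.Dj j), ρ p ^ 2
  set A := ∫⁻ z, extend (E.Dj j) ρ z ^ 2
  calc _ ≤ 24 * ((3 : ℕ) * V) + 2 * ((2 * (2 * 4) : ℕ) * (27 * A)) := by gcongr
    _ = 72 * V + 864 * A := by
        rw [← mul_assoc, ← mul_assoc, ← mul_assoc]; norm_num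
    _ ≤ 864 * V + 864 * A := by gcongr; norm_num
    _ = _ := by ring

end Exhaustion
end CantorExample

end

/-! ### The uniform lower bound for the modulus -/

theorem proposition4p1 (E : CantorExample.Exhaustion) (wbar : ℕ → Fin 2) (j₀ j : ℕ)
    (hj : j₀ < j) :
    ((4 : ENNReal) ^ 10)⁻¹ ≤
      Transboundary.modBetween (E.I 0 [] []) (E.Q (CantorExample.initialWord wbar j₀)) (E.Dj j) := by
  rw [Transboundary.modBetween, Transboundary.modulus]
  refine le_iInf₂ fun ρ hρ => ?_
  have hG := E.measurableSet_Dj j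
  rw [← Transboundary.lintegral_extend_sq hG ρ]
  obtain ⟨ℓ, H, hℓ⟩ := E.exists_network j (Transboundary.measurable_extend hG hρ.1)
  have hlen : (CantorExample.initialWord wbar j₀).length = j₀ := by
    simp [CantorExample.initialWord]
  -- The leaves have depth j - 1, and j₀ ≤ j - 1 lets the descent follow the whole word.
  obtain ⟨u, hu, M, hM, hMle⟩ := H.exists_reach (CantorExample.initialWord wbar j₀) (j - 1) (u := [])
    (by simp; omega) (by omega)
  simp only [List.map_nil, List.nil_append] at hu
  have h1 : 1 ≤ M := by
    -- The path ends at the component of I_1(w̄(j₀), v) for some v, whose left endpoint lies in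
    -- Q_{w̄(j₀)}.
    refine hM.one_le hρ ⟨_, ⟨_, left_mem_segment ℝ _ _, rfl⟩, rfl⟩ ⟨_, ⟨_, ?_, rfl⟩, rfl⟩
    rw [hu]
    refine E.collar_subset_Q _ (E.I_subset_collar ?_ (left_mem_segment ℝ _ _))
    rw [← hu, List.length_map, List.length_map]
  have h2 := Transboundary.branchSum_sq_le
    (Transboundary.nodeMass (E.nodeValue ρ) ℓ) (j - 1) []
  simp only [List.nil_append] at h2
  set A := (∫⁻ z, Transboundary.extend (E.Dj j) ρ z ^ 2) +
    ∑' p : Transboundary.components (E.Dj j), ρ p ^ 2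
  have h3 : 1 ≤ 4 ^ 10 * A :=
    calc (1 : ℝ≥0∞) = 1 ^ 2 := (one_pow 2).symm
      _ ≤ Transboundary.branchSum (Transboundary.nodeMass (E.nodeValue ρ) ℓ) (j - 1) [] ^ 2 := by
          gcongr
          exact h1.trans (le_self_add.trans hMle)
      _ ≤ 2 * (864 * A) := h2.trans (by gcongr; exact E.tsum_nodeMass_sq_le hℓ)
      -- The argument gives the constant 2 · 864 = 1728, well below 4^10.
      _ ≤ 4 ^ 10 * A := by rw [← mul_assoc]; gcongr; norm_num
  rw [ENNReal.inv_le_iff_le_mul (by simp) (by simp)]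
  exact h3
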